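/- Throughout, $p$ denotes a prime and $q$ a prime-power. Let $\beta, c, c_1$ be positive constants, and let $0<\delta<1$. Let $g$ be a complex-valued multiplicative function that satisfies, on the primes, $$g(p) \ll p^{1/2-\delta}, \qquad \sum_{p\le z} |g(p)|^{1+\delta}p^{-1} \ll \log\log z \quad (z\ge 3),$$ $$\sum_{z-y<p\le z} |g(p)|\log p \ll y \quad\text{uniformly for } z^{1-\delta}\le y\le z,\ z \ge 2,$$ $$\sum_{u<p\le v} |g(p)|p^{-1} \le \beta\log(\log v/\log u) + O(1) \quad\text{uniformly for } v\ge u\ge 2,$$ and suppose that the series $$\sum_{q} |g(q)|q^{-1}(\log q)^{\gamma}, \qquad \gamma = 1+c\beta(c+\beta)^{-1},$$ taken over the prime-powers $q=p^k$ with $k\ge 2$, converges. Let $3/2\le Y\le x$ and $T>0$, and suppose that $$\sum_{w<p\le x} \left(|g(p)|-c\right)p^{-1} \ge -c_1, \qquad Y\le w\le x.$$ Then, with $$\lambda = \min_{|t|\le T} \sum_{Y<p\le x}\left(|g(p)|-\mathrm{Re}\, g(p)p^{it}\right)p^{-1},$$ we have $$\sum_{n\le x} g(n) \ll \frac{x}{\log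 x}\prod_{p\le x}\left(1+|g(p)|p^{-1}\right)\left(\exp\left(-\lambda c(c+\beta)^{-1}\right)+T^{-1/2}\right)$$ uniformly for $Y$, $x$, $T$, the implied constant depending at most upon $\beta, c, c_1, \delta$, the implied constants in the four conditions on the primes, and a bound for the sum of the series over the higher prime-powers. -/

import Mathlib

/-- The primes `p` with `u < p ≤ v`, for real `u`, `v`. -/
noncomputable def primesIoc (u v : ℝ) : Finset ℕ :=
  (Finset.Ioc ⌊u⌋₊ ⌊v⌋₊).filter Nat.Prime

theorem mem_primesIoc {u v : ℝ} {p : ℕ} :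
    p ∈ primesIoc u v ↔ p.Prime ∧ u < (p : ℝ) ∧ (p : ℝ) ≤ v := by
  unfold primesIoc
  rw [Finset.mem_filter, Finset.mem_Ioc]
  constructor
  · rintro ⟨⟨h1, h2⟩, hp⟩
    exact ⟨hp, (Nat.floor_lt' hp.ne_zero).1 h1, (Nat.le_floor_iff' hp.ne_zero).1 h2⟩
  · rintro ⟨hp, h1, h2⟩
    exact ⟨⟨(Nat.floor_lt' hp.ne_zero).2 h1, (Nat.le_floor_iff' hp.ne_zero).2 h2⟩, hp⟩

/-- The prime-powers `q = p ^ k` with `p` prime and `k ≥ 2`. -/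
def higherPrimePowers : Set ℕ :=
  {q | ∃ p k : ℕ, p.Prime ∧ 2 ≤ k ∧ q = p ^ k}

/-- `∑_{Y < p ≤ x} (|g(p)| - Re (g(p) p^{it})) / p`. -/
noncomputable def twistSum (g : ArithmeticFunction ℂ) (Y x t : ℝ) : ℝ :=
  ∑ p ∈ primesIoc Y x, (‖g p‖ - (g p * (p : ℂ) ^ ((t : ℂ) * Complex.I)).re) / p

/-- The minimum over `|t| ≤ T` of `twistSum g Y x t`. -/
noncomputable def twistMin (g : ArithmeticFunction ℂ) (Y x T : ℝ) : ℝ :=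
  sInf (twistSum g Y x '' Set.Icc (-T) T)

/-- The infimum defining `twistMin` is attained, so that it is a minimum. -/
theorem isLeast_twistMin (g : ArithmeticFunction ℂ) (Y x : ℝ) {T : ℝ} (hT : 0 < T) :
    IsLeast (twistSum g Y x '' Set.Icc (-T) T) (twistMin g Y x T) := by
  have hc : Continuous (twistSum g Y x) := by
    unfold twistSum
    refine continuous_finsetSum _ fun p hp => ?_
    have hp0 : (p : ℂ) ≠ 0 := by
      exact_mod_cast (mem_primesIoc.1 hp).1.ne_zero
    refine Continuous.div_const (continuous_const.sub (Complex.continuous_re.comp ?_)) _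
    refine continuous_const.mul (Continuous.const_cpow ?_ (Or.inl hp0))
    fun_prop
  exact (isCompact_Icc.image hc).isLeast_sInf
    ((Set.nonempty_Icc.2 (by linarith)).image _)

/-! Let h be the exponentially multiplicative function with h(p) = g(p), so h(p^k) = g(p)^k / k!,
and write g = r * h as a Dirichlet convolution. The factor r vanishes at the primes, so ∑ |r(n)| (1
+ log n)^γ / n is bounded (`exists_sum_norm_expQuotient_le`), and it is enough to estimate the
partial sums S of h on [√x, x] (`norm_partialSum_le_of_expMult`). The gain in passing to h is that,
restricted to primes p ≤ x, its Dirichlet series is H(s) = exp(∑ g(p) p^{-s}), with logarithmic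
derivative supported on primes: h(n) log n = ∑_{p | n} g(p) log p · h(n/p).

The argument is of Halász type. Put s = 1 + σ + it and P = exp(∑_{p ≤ x} |g(p)|/p). Up to constants
|H(s)| is at most P (σ log x)^{-c}, by the lower condition on |g| and Mertens, and for |t| ≤ T also
at most P e^{-λ} (σ log x)^β, by the definition of λ. Plancherel bounds a mean square of the partial
sums of h(n) log n by that of H(s) ∑ g(p) log p · p^{-s}, where |H| is estimated by its supremum and
the prime sum by Chebyshev. The frequencies |t| > T cost T^{-1/2}. Scales σ log x = 2^j cover all v;
the smaller of the two bounds peaks where they cross, at 2^j = e^{λ/(c+β)}, and decays geometrically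
away from there. This produces exp(-λc/(c+β)) (`exists_sum_min_geometric_le`,
`exists_integral_log_partialSum_le`). Removing the logarithm by absorption gives ∫ |S(v)| v^{-2} dv
≪ P E with E = exp(-λc/(c+β)) + T^{-1/2} (`exists_integral_norm_partialSum_le`).

To return from the mean to a point, log u · |S(u)| is bounded by ∑ |g(p)| log p · |S(u/p)| plus an
integral. For p > z the short-interval condition lets S(u/p) be averaged over a window, which leads
back to the integral (`PrimeBounds.sum_large_primes_le`). The primes p ≤ z, with z a power of 1 +
log x, are treated by induction with the weight (X/u)^ε
(`PrimeBounds.norm_partialSum_expMult_le_rpow`). Secondary errors are harmless because E is never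
smaller than a constant times (1 + log x)^{-cβ/(c+β)} (`PrimeBounds.rpow_le_error`); that exponent,
plus one for the division by log x, is the γ of the theorem. -/

section MeanValue

open MeasureTheory Real

/-! ### Exponentially multiplicative functions -/

/-- The multiplicative function with value `a p ^ k / k!` at the prime power `p ^ k`. -/
noncomputable def expMult (a : ℕ → ℂ) : ArithmeticFunction ℂ :=
  ⟨fun n => if n = 0 then 0 else n.factorization.prod fun p k => a p ^ k / (k.factorial : ℂ),
    if_pos rfl⟩

theorem expMult_apply (a : ℕ → ℂ) {n : ℕ} (hn : n ≠ 0) :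
    expMult a n = n.factorization.prod fun p k => a p ^ k / (k.factorial : ℂ) := if_neg hn

theorem expMult_one (a : ℕ → ℂ) : expMult a 1 = 1 := by
  rw [expMult_apply a one_ne_zero]; simp

theorem expMult_isMultiplicative (a : ℕ → ℂ) : (expMult a).IsMultiplicative := by
  rw [ArithmeticFunction.IsMultiplicative.iff_ne_zero]
  refine ⟨expMult_one a, fun {m n} hm hn hmn => ?_⟩
  rw [expMult_apply a hm, expMult_apply a hn, expMult_apply a (mul_ne_zero hm hn),
    Nat.factorization_mul_of_coprime hmn]
  exact Finsupp.prod_add_index_of_disjoint (Nat.Coprime.disjoint_primeFactors hmn) _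

theorem expMult_prime_pow (a : ℕ → ℂ) {p : ℕ} (hp : p.Prime) (k : ℕ) :
    expMult a (p ^ k) = a p ^ k / (k.factorial : ℂ) := by
  rw [expMult_apply a (pow_ne_zero k hp.ne_zero), hp.factorization_pow]
  exact Finsupp.prod_single_index (by simp)

theorem expMult_congr {a b : ℕ → ℂ} {n : ℕ} (h : ∀ p ∈ n.primeFactors, a p = b p) :
    expMult a n = expMult b n := by
  rcases eq_or_ne n 0 with rfl | hn
  · simp
  rw [expMult_apply a hn, expMult_apply b hn]
  exact Finsupp.prod_congr fun p hp => by rw [h p (by simpa using hp)]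

theorem mul_apply_prime_pow (f g : ArithmeticFunction ℂ) {p : ℕ} (hp : p.Prime) (k : ℕ) :
    (f * g) (p ^ k) = ∑ i ∈ Finset.range (k + 1), f (p ^ i) * g (p ^ (k - i)) := by
  rw [ArithmeticFunction.mul_apply, Nat.sum_divisorsAntidiagonal (f := fun d e => f d * g e),
    Nat.divisors_prime_pow hp, Finset.sum_map]
  refine Finset.sum_congr rfl fun i hi => ?_
  have hik : i ≤ k := by simpa [Nat.lt_succ_iff] using hi
  simp [Nat.pow_div hik hp.pos]

/-- The binomial theorem at each prime power. Addition thus becomes Dirichlet convolution, so the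
inverse of `expMult a` is `expMult (-a)`. -/
theorem expMult_mul_expMult (a b : ℕ → ℂ) : expMult a * expMult b = expMult (a + b) := by
  rw [((expMult_isMultiplicative a).mul
    (expMult_isMultiplicative b)).eq_iff_eq_on_prime_powers _ _ (expMult_isMultiplicative _)]
  intro p k hp
  rw [mul_apply_prime_pow _ _ hp, expMult_prime_pow _ hp, Pi.add_apply, add_pow, Finset.sum_div]
  refine Finset.sum_congr rfl fun i hi => ?_
  have hik : i ≤ k := by simpa [Nat.lt_succ_iff] using hi
  rw [expMult_prime_pow a hp, expMult_prime_pow b hp, Nat.cast_choose ℂ hik]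
  have h1 : (k.factorial : ℂ) ≠ 0 := by exact_mod_cast Nat.factorial_ne_zero _
  have h2 : (i.factorial : ℂ) ≠ 0 := by exact_mod_cast Nat.factorial_ne_zero _
  have h3 : ((k - i).factorial : ℂ) ≠ 0 := by exact_mod_cast Nat.factorial_ne_zero _
  field_simp

theorem expMult_zero : expMult 0 = 1 := by
  rw [(expMult_isMultiplicative 0).eq_iff_eq_on_prime_powers _ _
    ArithmeticFunction.isMultiplicative_one]
  intro p k hp
  rw [expMult_prime_pow _ hp, ArithmeticFunction.one_apply]
  rcases eq_or_ne k 0 with rfl | hk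
  · simp
  · simp [hk, hp.ne_one]

theorem expMult_mul_expMult_neg (a : ℕ → ℂ) : expMult (-a) * expMult a = 1 := by
  rw [expMult_mul_expMult, neg_add_cancel, expMult_zero]

theorem ofReal_norm_expMult (a : ℕ → ℂ) (n : ℕ) :
    ((‖expMult a n‖ : ℝ) : ℂ) = expMult (fun p => (‖a p‖ : ℂ)) n := by
  rcases eq_or_ne n 0 with rfl | hn
  · simp
  rw [expMult_apply _ hn, expMult_apply _ hn, Finsupp.prod, Finsupp.prod, norm_prod]
  push_cast
  simp

/-- A factor n^s can be moved into the values at the primes. Sums over n may therefore be evaluated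
without s, and every Dirichlet series is a special case. -/
theorem expMult_mul_cpow (a : ℕ → ℂ) (s : ℂ) (n : ℕ) :
    expMult a n * (n : ℂ) ^ s = expMult (fun p => a p * (p : ℂ) ^ s) n := by
  rcases eq_or_ne n 0 with rfl | hn
  · simp
  have key : (n : ℂ) ^ s = n.factorization.prod fun p k => ((p : ℂ) ^ s) ^ k := by
    have h1 : ∀ t : Finset ℕ, ∀ e : ℕ → ℕ,
        (((∏ p ∈ t, p ^ e p : ℕ)) : ℂ) ^ s = ∏ p ∈ t, ((p : ℂ) ^ s) ^ e p := by
      intro t e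
      induction t using Finset.induction with
      | empty => simp
      | insert q t hq ih =>
        rw [Finset.prod_insert hq, Finset.prod_insert hq, ← ih, Nat.cast_mul,
          Complex.natCast_mul_natCast_cpow]
        congr 1
        induction e q with
        | zero => simp
        | succ k ihk => rw [pow_succ, pow_succ, Nat.cast_mul, Complex.natCast_mul_natCast_cpow, ihk]
    conv_lhs => rw [← Nat.prod_factorization_pow_eq_self hn]
    exact h1 _ _
  rw [expMult_apply _ hn, expMult_apply _ hn, key, ← Finsupp.prod_mul]
  refine Finsupp.prod_congr fun p _ => ?_
  rw [mul_pow]; ring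

/-- Since k · a^k / k! = a · a^{k-1} / (k-1)!, the part k log p of log n that belongs to p lowers
the exponent of p by exactly one. No higher prime powers enter, unlike for a general multiplicative
function. -/
theorem expMult_mul_log (a : ℕ → ℂ) (n : ℕ) :
    expMult a n * (Real.log n : ℂ) =
      ∑ p ∈ n.primeFactors, a p * (Real.log p : ℂ) * expMult a (n / p) := by
  rcases eq_or_ne n 0 with rfl | hn
  · simp
  have hlog : Real.log n = ∑ p ∈ n.primeFactors, (n.factorization p : ℝ) * Real.log p := by
    conv_lhs => rw [← Nat.prod_factorization_pow_eq_self hn]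
    rw [Finsupp.prod, Nat.cast_prod, Real.log_prod]
    · refine Finset.sum_congr rfl fun p _ => ?_
      rw [Nat.cast_pow, Real.log_pow]
    · intro p hp
      have : p.Prime := Nat.prime_of_mem_primeFactors hp
      exact_mod_cast (pow_ne_zero _ this.ne_zero)
  rw [hlog]
  push_cast
  rw [Finset.mul_sum]
  refine Finset.sum_congr rfl fun p hp => ?_
  have hpp := Nat.prime_of_mem_primeFactors hp
  set k := n.factorization p with hk
  set m := n / p ^ k with hm
  have hnm : n = p ^ k * m := (Nat.ordProj_mul_ordCompl_eq_self n p).symm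
  have hcop : Nat.Coprime p m := Nat.coprime_ordCompl hpp hn
  have hk0 : k ≠ 0 := by
    have := hpp.factorization_pos_of_dvd hn (Nat.dvd_of_mem_primeFactors hp)
    omega
  obtain ⟨j, hj⟩ := Nat.exists_eq_succ_of_ne_zero hk0
  have hdiv : n / p = p ^ j * m := by
    rw [hnm, hj, Nat.succ_eq_add_one, pow_succ]
    exact Nat.div_eq_of_eq_mul_right hpp.pos (by ring)
  have e1 : expMult a n = a p ^ k / (k.factorial : ℂ) * expMult a m := by
    conv_lhs => rw [hnm]
    rw [(expMult_isMultiplicative a).map_mul_of_coprime (Nat.Coprime.pow_left k hcop),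
      expMult_prime_pow a hpp]
  rw [hdiv, (expMult_isMultiplicative a).map_mul_of_coprime (Nat.Coprime.pow_left j hcop),
    expMult_prime_pow a hpp, e1, hj, Nat.succ_eq_add_one, Nat.factorial_succ]
  have : (j.factorial : ℂ) ≠ 0 := by exact_mod_cast Nat.factorial_ne_zero _
  have h2 : ((j : ℂ) + 1) ≠ 0 := by exact_mod_cast Nat.succ_ne_zero j
  push_cast
  field_simp
  ring

theorem expMult_eq_zero {a : ℕ → ℂ} {p n : ℕ} (hp : p ∈ n.primeFactors) (ha : a p = 0) :
    expMult a n = 0 := by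
  have hn : n ≠ 0 := fun h => by simp [h] at hp
  rw [expMult_apply a hn]
  refine Finset.prod_eq_zero (i := p) (by simpa using hp) ?_
  have hpp := Nat.prime_of_mem_primeFactors hp
  simp only [ha]
  rw [zero_pow (hpp.factorization_pos_of_dvd hn (Nat.dvd_of_mem_primeFactors hp)).ne',
    zero_div]

/-! ### Dirichlet series and partial sums of exponentially multiplicative functions -/

/-- The Euler factor at p is the exponential series of a(p). With only finitely many primes in play
the product converges absolutely without any size condition. -/
theorem summable_hasSum_expMult {a : ℕ → ℂ} {s : Finset ℕ} (hs : ∀ p ∈ s, p.Prime)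
    (ha : ∀ p, p.Prime → p ∉ s → a p = 0) :
    Summable (fun n => ‖expMult a n‖) ∧
      HasSum (fun n => expMult a n) (Complex.exp (∑ p ∈ s, a p)) := by
  have hsupp : Function.support (fun n => expMult a n) ⊆ Nat.factoredNumbers s := by
    intro n hn
    have hn0 : n ≠ 0 := by rintro rfl; simp at hn
    refine Nat.mem_factoredNumbers'.2 fun p hp hpn => ?_
    by_contra hps
    exact hn (expMult_eq_zero (Nat.mem_primeFactors.2 ⟨hp, hpn, hn0⟩) (ha p hp hps))
  have key := EulerProduct.summable_and_hasSum_factoredNumbers_prod_filter_prime_tsum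
    (f := fun n => expMult a n) (expMult_one a)
    (fun {m n} h => (expMult_isMultiplicative a).map_mul_of_coprime h)
    (fun {p} hp => by
      simp only [expMult_prime_pow a hp]
      simpa using (Real.summable_pow_div_factorial ‖a p‖)) s
  constructor
  · have h1 : Function.support (fun n => ‖expMult a n‖) ⊆ Nat.factoredNumbers s := by
      intro n hn
      exact hsupp (by simpa using hn)
    have h3 := summable_subtype_iff_indicator.1
      (show Summable ((fun n : ℕ => ‖expMult a n‖) ∘ ((↑) : Nat.factoredNumbers s → ℕ)) from key.1)
    rwa [Set.indicator_eq_self.2 h1] at h3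
  · have h2 : ∏ p ∈ s with p.Prime, ∑' n : ℕ, expMult a (p ^ n) =
        Complex.exp (∑ p ∈ s, a p) := by
      rw [Complex.exp_sum, Finset.filter_true_of_mem hs]
      refine Finset.prod_congr rfl fun p hp => ?_
      simp only [expMult_prime_pow a (hs p hp)]
      rw [Complex.exp_eq_exp_ℂ, NormedSpace.exp_eq_tsum_div]
    rw [← h2]
    have h3 : HasSum ((fun n : ℕ => expMult a n) ∘ ((↑) : Nat.factoredNumbers s → ℕ)) _ := key.2
    exact (hasSum_subtype_iff_of_support_subset hsupp).1 h3

/-- The series for -H', summed without differentiation: in the prime recursion for h(n) log n, each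
p contributes the whole series again along n = pm. -/
theorem hasSum_expMult_mul_log {a : ℕ → ℂ} {s : Finset ℕ} (hs : ∀ p ∈ s, p.Prime)
    (ha : ∀ p, p.Prime → p ∉ s → a p = 0) :
    HasSum (fun n => expMult a n * (Real.log n : ℂ))
      ((∑ p ∈ s, a p * (Real.log p : ℂ)) * Complex.exp (∑ p ∈ s, a p)) := by
  have h1 : ∀ n, expMult a n * (Real.log n : ℂ) = ∑ p ∈ s,
      if p ∣ n then a p * (Real.log p : ℂ) * expMult a (n / p) else 0 := by
    intro n
    rcases eq_or_ne n 0 with rfl | hn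
    · simp
    rw [expMult_mul_log, ← Finset.sum_filter]
    symm
    refine Finset.sum_subset (fun p hp => ?_) fun p hp hps => ?_
    · rw [Finset.mem_filter] at hp
      exact Nat.mem_primeFactors.2 ⟨hs p hp.1, hp.2, hn⟩
    · rw [Nat.mem_primeFactors] at hp
      rw [ha p hp.1 fun h => hps (Finset.mem_filter.2 ⟨h, hp.2.1⟩)]
      simp
  simp only [h1]
  rw [Finset.sum_mul]
  refine hasSum_sum fun p hp => ?_
  have hp0 := (hs p hp).pos
  have hinj : Function.Injective fun m : ℕ => p * m := fun m n h =>
    Nat.eq_of_mul_eq_mul_left hp0 h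
  rw [← hinj.hasSum_iff]
  · have := (summable_hasSum_expMult hs ha).2.mul_left (a p * (Real.log p : ℂ))
    convert! this using 2 with m
    simp [Nat.mul_div_cancel_left _ hp0]
  · intro n hn
    rw [if_neg]
    rintro ⟨m, rfl⟩
    exact hn ⟨m, rfl⟩

theorem hasSum_norm_expMult {a : ℕ → ℂ} {s : Finset ℕ} (hs : ∀ p ∈ s, p.Prime)
    (ha : ∀ p, p.Prime → p ∉ s → a p = 0) :
    HasSum (fun n => ‖expMult a n‖) (Real.exp (∑ p ∈ s, ‖a p‖)) := by
  have := (summable_hasSum_expMult (a := fun p => (‖a p‖ : ℂ)) hs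
    (fun p hp hps => by simp [ha p hp hps])).2
  simp only [← ofReal_norm_expMult] at this
  rw [← Complex.hasSum_ofReal]
  convert! this
  push_cast
  rfl

theorem summable_norm_expMult_mul_log {a : ℕ → ℂ} {s : Finset ℕ} (hs : ∀ p ∈ s, p.Prime)
    (ha : ∀ p, p.Prime → p ∉ s → a p = 0) :
    Summable (fun n => ‖expMult a n‖ * Real.log n) := by
  have := (hasSum_expMult_mul_log (a := fun p => (‖a p‖ : ℂ)) hs
    (fun p hp hps => by simp [ha p hp hps])).summable
  simp only [← ofReal_norm_expMult] at this
  exact_mod_cast this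

/-- `∑_{n ≤ v} a(n)`. -/
noncomputable def partialSum (f : ℕ → ℂ) (v : ℝ) : ℂ := ∑ n ∈ Finset.Icc 1 ⌊v⌋₊, f n

theorem partialSum_mul (f g : ArithmeticFunction ℂ) (v : ℝ) :
    partialSum (⇑(f * g)) v = ∑ n ∈ Finset.Icc 1 ⌊v⌋₊, f n * partialSum g (v / n) := by
  have h : ∀ N : ℕ, Finset.Icc 1 N = Finset.Ioc 0 N := fun N => by ext; simp; omega
  unfold partialSum
  simp only [h]
  rw [ArithmeticFunction.sum_Ioc_mul_eq_sum_sum]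
  simp only [Nat.floor_div_natCast]

theorem partialSum_expMult_mul_log (a : ℕ → ℂ) (v : ℝ) :
    partialSum (fun n => expMult a n * (Real.log n : ℂ)) v =
      ∑ p ∈ primesIoc 0 v, a p * (Real.log p : ℂ) * partialSum (expMult a) (v / p) := by
  let f : ArithmeticFunction ℂ :=
    ⟨fun n => if n.Prime then a n * (Real.log n : ℂ) else 0, by simp⟩
  have hf : ∀ n, f n = if n.Prime then a n * (Real.log n : ℂ) else 0 := fun n => rfl
  have h : (fun n => expMult a n * (Real.log n : ℂ)) = ⇑(f * expMult a) := by
    funext n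
    rcases eq_or_ne n 0 with rfl | hn
    · simp
    rw [expMult_mul_log, ArithmeticFunction.mul_apply, Nat.sum_divisorsAntidiagonal
      (f := fun d e => f d * expMult a e), Nat.primeFactors_eq_to_filter_divisors_prime,
      Finset.sum_filter]
    refine Finset.sum_congr rfl fun d _ => ?_
    rw [hf]
    split_ifs <;> simp
  rw [h, partialSum_mul]
  unfold primesIoc
  have : Finset.Icc 1 ⌊v⌋₊ = Finset.Ioc ⌊(0:ℝ)⌋₊ ⌊v⌋₊ := by ext; simp; omega
  rw [this, Finset.sum_filter]
  refine Finset.sum_congr rfl fun n _ => ?_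
  rw [hf]
  split_ifs <;> simp

/-! ### Plancherel's identity with the Lorentz kernel -/

theorem integral_exp_neg_abs_mul_cexp {u : ℝ} (hu : 0 < u) (w : ℝ) :
    Integrable (fun v : ℝ => Complex.exp (-(u * |v| : ℝ))) ∧
    ∫ v : ℝ, Complex.exp ((-w * v : ℝ) * Complex.I) * Complex.exp (-(u * |v| : ℝ)) =
      ((2 * u / (u ^ 2 + w ^ 2) : ℝ) : ℂ) := by
  have e1 : ∀ w : ℝ, Set.EqOn (fun v : ℝ => Complex.exp ((-u - w * Complex.I) * v))
      (fun v : ℝ => Complex.exp ((-w * v : ℝ) * Complex.I) * Complex.exp (-(u * |v| : ℝ)))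
      (Set.Ioi 0) := by
    intro w v hv
    simp only
    rw [abs_of_pos hv, ← Complex.exp_add]
    congr 1; push_cast; ring
  have e2 : ∀ w : ℝ, Set.EqOn (fun v : ℝ => Complex.exp ((u - w * Complex.I) * v))
      (fun v : ℝ => Complex.exp ((-w * v : ℝ) * Complex.I) * Complex.exp (-(u * |v| : ℝ)))
      (Set.Iic 0) := by
    intro w v hv
    simp only
    rw [abs_of_nonpos hv, ← Complex.exp_add]
    congr 1; push_cast; ring
  have i1 : ∀ w : ℝ, IntegrableOn (fun v : ℝ => Complex.exp ((-w * v : ℝ) * Complex.I) *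
      Complex.exp (-(u * |v| : ℝ))) (Set.Ioi 0) := fun w =>
    (integrableOn_exp_mul_complex_Ioi (a := -u - w * Complex.I) (by simpa using hu) 0).congr_fun
      (e1 w) measurableSet_Ioi
  have i2 : ∀ w : ℝ, IntegrableOn (fun v : ℝ => Complex.exp ((-w * v : ℝ) * Complex.I) *
      Complex.exp (-(u * |v| : ℝ))) (Set.Iic 0) := fun w =>
    (integrableOn_exp_mul_complex_Iic (a := u - w * Complex.I) (by simpa using hu) 0).congr_fun
      (e2 w) measurableSet_Iic
  constructor
  · have := (i2 0).union (i1 0)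
    rw [Set.Iic_union_Ioi, integrableOn_univ] at this
    simpa using this
  · rw [← intervalIntegral.integral_Iic_add_Ioi (i2 w) (i1 w),
      ← setIntegral_congr_fun measurableSet_Ioi (e1 w),
      ← setIntegral_congr_fun measurableSet_Iic (e2 w),
      integral_exp_mul_complex_Ioi (by simpa using hu),
      integral_exp_mul_complex_Iic (by simpa using hu)]
    have h1 : (u : ℂ) - w * Complex.I ≠ 0 := fun h => by
      have := congrArg Complex.re h; simp at this; exact hu.ne' this
    have h2 : -(u : ℂ) - w * Complex.I ≠ 0 := fun h => by
      have := congrArg Complex.re h; simp at this; exact hu.ne' this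
    have h3 : (u : ℂ) ^ 2 + w ^ 2 ≠ 0 := by
      have : 0 < u ^ 2 + w ^ 2 := by positivity
      exact_mod_cast this.ne'
    have h4 : (u : ℂ) ^ 2 + w ^ 2 = (u - w * Complex.I) * (u + w * Complex.I) := by
      ring_nf; rw [Complex.I_sq]; ring
    have h5 : (u : ℂ) + w * Complex.I ≠ 0 := fun h => by
      rw [h4, h, mul_zero] at h3; exact h3 rfl
    push_cast
    rw [h4]
    simp only [mul_zero, Complex.exp_zero]
    rw [show -(u : ℂ) - w * Complex.I = -(u + w * Complex.I) by ring]
    field_simp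
    ring

theorem integrable_lorentz {u : ℝ} (hu : 0 < u) : Integrable fun t : ℝ => (u ^ 2 + t ^ 2)⁻¹ := by
  have := (integrable_inv_one_add_sq.comp_div hu.ne').const_mul (u ^ 2)⁻¹
  refine this.congr (ae_of_all _ fun t => ?_)
  simp only
  rw [← mul_inv, mul_add, div_pow]
  field_simp

theorem integrable_cexp_mul_lorentz {u : ℝ} (hu : 0 < u) (y : ℝ) :
    Integrable fun t : ℝ => Complex.exp ((t * y : ℝ) * Complex.I) * ((u ^ 2 + t ^ 2)⁻¹ : ℝ) := by
  refine (integrable_lorentz hu).ofReal.bdd_mul (c := 1) ?_ (ae_of_all _ fun t => ?_)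
  · exact Continuous.aestronglyMeasurable (by fun_prop)
  · rw [Complex.norm_exp_ofReal_mul_I]

/-- Fourier inversion for exp(-2πu|v|), whose transform is a Lorentz function, evaluated at y/(2π).
-/
theorem integral_cexp_mul_lorentz {u : ℝ} (hu : 0 < u) (y : ℝ) :
    ∫ t : ℝ, Complex.exp ((t * y : ℝ) * Complex.I) * ((u ^ 2 + t ^ 2)⁻¹ : ℝ) =
      ((π / u * Real.exp (-(u * |y|)) : ℝ) : ℂ) := by
  have hpi : (0 : ℝ) < 2 * π := by positivity
  have hu' : 0 < 2 * π * u := by positivity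
  set f : ℝ → ℂ := fun v => Complex.exp (-(2 * π * u * |v| : ℝ)) with hf
  have hF : FourierTransform.fourier f = fun w : ℝ => ((u / π * (u ^ 2 + w ^ 2)⁻¹ : ℝ) : ℂ) := by
    funext w
    rw [Real.fourier_real_eq_integral_exp_smul]
    have := (integral_exp_neg_abs_mul_cexp hu' (2 * π * w)).2
    simp only [smul_eq_mul, hf]
    rw [show (u / π * (u ^ 2 + w ^ 2)⁻¹ : ℝ) =
      2 * (2 * π * u) / ((2 * π * u) ^ 2 + (2 * π * w) ^ 2) by
        have : u ^ 2 + w ^ 2 ≠ 0 := by positivity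
        rw [show (2 * π * u) ^ 2 + (2 * π * w) ^ 2 = (2 * π) ^ 2 * (u ^ 2 + w ^ 2) by ring]
        field_simp, ← this]
    congr 1; funext v; congr 3; push_cast; ring
  have hint : Integrable (FourierTransform.fourier f) := by
    rw [hF]
    exact ((integrable_lorentz hu).const_mul _).ofReal
  have hcont : Continuous f := by fun_prop
  have := congrFun (hcont.fourierInv_fourier_eq (integral_exp_neg_abs_mul_cexp hu' 0).1 hint)
    (y / (2 * π))
  rw [Real.fourierInv_eq_fourier_neg, Real.fourier_real_eq_integral_exp_smul, hF] at this
  have h2 : f (y / (2 * π)) = ((Real.exp (-(u * |y|)) : ℝ) : ℂ) := by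
    simp only [hf]
    rw [abs_div, abs_of_pos hpi]
    push_cast
    congr 2
    have : (π : ℂ) ≠ 0 := by exact_mod_cast Real.pi_ne_zero
    field_simp
  rw [h2] at this
  rw [Complex.ofReal_mul, ← this, ← integral_const_mul]
  congr 1; funext t
  have h3 : (π : ℂ) ≠ 0 := by exact_mod_cast Real.pi_ne_zero
  have h4 : (u : ℂ) ≠ 0 := by exact_mod_cast hu.ne'
  simp only [smul_eq_mul]
  rw [show ((-2 * π * t * -(y / (2 * π)) : ℝ)) = t * y by field_simp]
  push_cast
  field_simp

theorem integral_normSq_sum_mul_lorentz {u : ℝ} (hu : 0 < u) (A : Finset ℕ) (c : ℕ → ℂ)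
    (y : ℕ → ℝ) :
    Integrable (fun t : ℝ =>
      ‖∑ n ∈ A, c n * Complex.exp ((t * y n : ℝ) * Complex.I)‖ ^ 2 * (u ^ 2 + t ^ 2)⁻¹) ∧
    ((∫ t : ℝ, ‖∑ n ∈ A, c n * Complex.exp ((t * y n : ℝ) * Complex.I)‖ ^ 2 *
      (u ^ 2 + t ^ 2)⁻¹ : ℝ) : ℂ) =
      ∑ n ∈ A, ∑ m ∈ A, c n * (starRingEnd ℂ) (c m) *
        ((π / u * Real.exp (-(u * |y n - y m|)) : ℝ) : ℂ) := by
  have key : ∀ t : ℝ, ((‖∑ n ∈ A, c n * Complex.exp ((t * y n : ℝ) * Complex.I)‖ ^ 2 *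
      (u ^ 2 + t ^ 2)⁻¹ : ℝ) : ℂ) = ∑ n ∈ A, ∑ m ∈ A, c n * (starRingEnd ℂ) (c m) *
        (Complex.exp ((t * (y n - y m) : ℝ) * Complex.I) * ((u ^ 2 + t ^ 2)⁻¹ : ℝ)) := by
    intro t
    rw [Complex.ofReal_mul, Complex.ofReal_pow, ← Complex.mul_conj', map_sum,
      Finset.sum_mul_sum, Finset.sum_mul]
    refine Finset.sum_congr rfl fun n _ => ?_
    rw [Finset.sum_mul]
    refine Finset.sum_congr rfl fun m _ => ?_
    rw [map_mul, ← Complex.exp_conj, map_mul, Complex.conj_I, Complex.conj_ofReal]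
    rw [show ((t * (y n - y m) : ℝ) : ℂ) * Complex.I = (t * y n : ℝ) * Complex.I +
      (t * y m : ℝ) * -Complex.I by push_cast; ring, Complex.exp_add]
    ring
  have hint : ∀ n ∈ A, ∀ m ∈ A, Integrable (fun t : ℝ => c n * (starRingEnd ℂ) (c m) *
        (Complex.exp ((t * (y n - y m) : ℝ) * Complex.I) * ((u ^ 2 + t ^ 2)⁻¹ : ℝ))) :=
    fun n _ m _ => (integrable_cexp_mul_lorentz hu _).const_mul _
  constructor
  · have : Integrable (fun t : ℝ => ((‖∑ n ∈ A, c n * Complex.exp ((t * y n : ℝ) * Complex.I)‖ ^ 2 *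
      (u ^ 2 + t ^ 2)⁻¹ : ℝ) : ℂ)) := by
      simp only [key]
      exact integrable_finsetSum _ fun n hn => integrable_finsetSum _ fun m hm => hint n hn m hm
    exact this.re.congr (ae_of_all _ fun t => Complex.ofReal_re _)
  · rw [← integral_complex_ofReal]
    simp only [key]
    rw [integral_finsetSum _ fun n hn => integrable_finsetSum _ fun m hm => hint n hn m hm]
    refine Finset.sum_congr rfl fun n hn => ?_
    rw [integral_finsetSum _ fun m hm => hint n hn m hm]
    refine Finset.sum_congr rfl fun m hm => ?_
    rw [integral_const_mul, integral_cexp_mul_lorentz hu]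

theorem integral_normSq_step_sum_mul_rpow {u : ℝ} (hu : 0 < u) (A : Finset ℕ)
    (hA : ∀ n ∈ A, 1 ≤ n) (b : ℕ → ℂ) :
    Integrable (fun v : ℝ =>
      ‖∑ n ∈ A, (Set.Ici (n : ℝ)).indicator (fun _ => b n) v‖ ^ 2 * v ^ (-2 * u - 1)) ∧
    ((∫ v : ℝ, ‖∑ n ∈ A, (Set.Ici (n : ℝ)).indicator (fun _ => b n) v‖ ^ 2 *
      v ^ (-2 * u - 1) : ℝ) : ℂ) =
      ∑ n ∈ A, ∑ m ∈ A, b n * (starRingEnd ℂ) (b m) *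
        (((max n m : ℝ) ^ (-2 * u) / (2 * u) : ℝ) : ℂ) := by
  have key : ∀ v : ℝ, ((‖∑ n ∈ A, (Set.Ici (n : ℝ)).indicator (fun _ => b n) v‖ ^ 2 *
      v ^ (-2 * u - 1) : ℝ) : ℂ) = ∑ n ∈ A, ∑ m ∈ A, b n * (starRingEnd ℂ) (b m) *
        ((Set.Ici (max n m : ℝ)).indicator (fun v => v ^ (-2 * u - 1)) v : ℝ) := by
    intro v
    rw [Complex.ofReal_mul, Complex.ofReal_pow, ← Complex.mul_conj', map_sum,
      Finset.sum_mul_sum, Finset.sum_mul]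
    refine Finset.sum_congr rfl fun n _ => ?_
    rw [Finset.sum_mul]
    refine Finset.sum_congr rfl fun m _ => ?_
    simp only [Set.indicator_apply, Set.mem_Ici, max_le_iff]
    by_cases h1 : (n : ℝ) ≤ v <;> by_cases h2 : (m : ℝ) ≤ v <;> simp [h1, h2]
  have hpos : ∀ n ∈ A, ∀ m : ℕ, (0 : ℝ) < max (n : ℝ) m := fun n hn m =>
    lt_max_of_lt_left (by exact_mod_cast hA n hn)
  have hint0 : ∀ n ∈ A, ∀ m ∈ A, Integrable
      ((Set.Ici (max n m : ℝ)).indicator (fun v : ℝ => v ^ (-2 * u - 1))) := by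
    intro n hn m _
    rw [integrable_indicator_iff measurableSet_Ici, integrableOn_Ici_iff_integrableOn_Ioi]
    exact integrableOn_Ioi_rpow_of_lt (by linarith) (hpos n hn m)
  have hint : ∀ n ∈ A, ∀ m ∈ A, Integrable (fun v : ℝ => b n * (starRingEnd ℂ) (b m) *
      ((Set.Ici (max n m : ℝ)).indicator (fun v => v ^ (-2 * u - 1)) v : ℝ)) :=
    fun n hn m hm => (hint0 n hn m hm).ofReal.const_mul _
  constructor
  · have : Integrable (fun v : ℝ => ((‖∑ n ∈ A, (Set.Ici (n : ℝ)).indicator (fun _ => b n) v‖ ^ 2 *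
      v ^ (-2 * u - 1) : ℝ) : ℂ)) := by
      simp only [key]
      exact integrable_finsetSum _ fun n hn => integrable_finsetSum _ fun m hm => hint n hn m hm
    exact this.re.congr (ae_of_all _ fun t => Complex.ofReal_re _)
  · rw [← integral_complex_ofReal]
    simp only [key]
    rw [integral_finsetSum _ fun n hn => integrable_finsetSum _ fun m hm => hint n hn m hm]
    refine Finset.sum_congr rfl fun n hn => ?_
    rw [integral_finsetSum _ fun m hm => hint n hn m hm]
    refine Finset.sum_congr rfl fun m hm => ?_
    rw [integral_const_mul, integral_complex_ofReal, integral_indicator measurableSet_Ici,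
      integral_Ici_eq_integral_Ioi, integral_Ioi_rpow_of_lt (by linarith) (hpos n hn m)]
    congr 2
    rw [show -2 * u - 1 + 1 = -(2 * u) by ring, div_neg, neg_div, neg_neg,
      show -(2 * u) = -2 * u by ring]

/-- For finite sums Plancherel is an identity between two quadratic forms. Their matrices agree
because n^{-u} m^{-u} exp(-u|log n - log m|) = max(n, m)^{-2u}. -/
theorem integral_normSq_step_eq_lorentz {u : ℝ} (hu : 0 < u) (A : Finset ℕ)
    (hA : ∀ n ∈ A, 1 ≤ n) (b : ℕ → ℂ) :
    ∫ v : ℝ, ‖∑ n ∈ A, (Set.Ici (n : ℝ)).indicator (fun _ => b n) v‖ ^ 2 * v ^ (-2 * u - 1) =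
      (2 * π)⁻¹ * ∫ t : ℝ, ‖∑ n ∈ A, b n * (n : ℂ) ^ (-(u + t * Complex.I))‖ ^ 2 *
        (u ^ 2 + t ^ 2)⁻¹ := by
  have h1 : ∀ t : ℝ, ∑ n ∈ A, b n * (n : ℂ) ^ (-(u + t * Complex.I)) =
      ∑ n ∈ A, (b n * ((n : ℝ) ^ (-u) : ℝ)) *
        Complex.exp ((t * (-Real.log n) : ℝ) * Complex.I) := by
    intro t
    refine Finset.sum_congr rfl fun n hn => ?_
    have hn0 : (n : ℂ) ≠ 0 := by exact_mod_cast (show n ≠ 0 by have := hA n hn; omega)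
    have hn1 : (0 : ℝ) < n := by exact_mod_cast hA n hn
    rw [mul_assoc, neg_add, Complex.cpow_add _ _ hn0, Complex.ofReal_cpow hn1.le]
    congr 2
    · push_cast; rfl
    · rw [Complex.cpow_def_of_ne_zero hn0]
      push_cast
      congr 1; ring
  rw [← Complex.ofReal_inj, (integral_normSq_step_sum_mul_rpow hu A hA b).2, Complex.ofReal_mul]
  simp only [h1]
  rw [(integral_normSq_sum_mul_lorentz hu A _ _).2, Finset.mul_sum]
  refine Finset.sum_congr rfl fun n hn => ?_
  rw [Finset.mul_sum]
  refine Finset.sum_congr rfl fun m hm => ?_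
  have hn1 : (0 : ℝ) < n := by exact_mod_cast hA n hn
  have hm1 : (0 : ℝ) < m := by exact_mod_cast hA m hm
  have key : (max n m : ℝ) ^ (-2 * u) =
      (n : ℝ) ^ (-u) * (m : ℝ) ^ (-u) * Real.exp (-(u * |-Real.log n - -Real.log m|)) := by
    rw [Real.rpow_def_of_pos hn1, Real.rpow_def_of_pos hm1,
      Real.rpow_def_of_pos (lt_max_of_lt_left hn1), ← Real.exp_add, ← Real.exp_add]
    congr 1
    rcases le_total (n : ℝ) m with h | h
    · rw [max_eq_right h, abs_of_nonneg (by linarith [Real.log_le_log hn1 h])]; ring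
    · rw [max_eq_left h, abs_of_nonpos (by linarith [Real.log_le_log hm1 h])]; ring
  rw [key]
  simp only [map_mul, Complex.conj_ofReal]
  have hpi : (π : ℂ) ≠ 0 := by exact_mod_cast Real.pi_ne_zero
  have hu0 : (u : ℂ) ≠ 0 := by exact_mod_cast hu.ne'
  push_cast
  field_simp

theorem sum_indicator_eq_partialSum (b : ℕ → ℂ) {N : ℕ} {v : ℝ} (hv : 0 ≤ v) (hvN : v ≤ N) :
    ∑ n ∈ Finset.Icc 1 N, (Set.Ici (n : ℝ)).indicator (fun _ => b n) v = partialSum b v := by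
  unfold partialSum
  simp only [Set.indicator_apply, Set.mem_Ici]
  rw [← Finset.sum_filter]
  congr 1
  ext n
  simp only [Finset.mem_filter, Finset.mem_Icc]
  have := Nat.le_floor_iff (n := n) hv
  constructor
  · rintro ⟨h1, h2⟩
    exact ⟨h1.1, this.2 h2⟩
  · rintro ⟨h1, h2⟩
    exact ⟨⟨h1, by exact_mod_cast (this.1 h2).trans hvN⟩, this.1 h2⟩

/-- The Plancherel bound for the partial sums of an absolutely convergent Dirichlet series. -/
theorem integral_normSq_partialSum_le {u : ℝ} (hu : 0 < u) {b : ℕ → ℂ} (hb0 : b 0 = 0)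
    (hb : Summable fun n : ℕ => ‖b n‖ * (n : ℝ) ^ (-u)) {Z : ℝ → ℂ}
    (hZ : ∀ t : ℝ, HasSum (fun n : ℕ => b n * (n : ℂ) ^ (-(u + t * Complex.I))) (Z t)) (X : ℝ) :
    IntegrableOn (fun v : ℝ => ‖partialSum b v‖ ^ 2 * v ^ (-2 * u - 1)) (Set.Ioc 1 X) ∧
    ∫ v in Set.Ioc 1 X, ‖partialSum b v‖ ^ 2 * v ^ (-2 * u - 1) ≤
      (2 * π)⁻¹ * ∫ t : ℝ, ‖Z t‖ ^ 2 * (u ^ 2 + t ^ 2)⁻¹ := by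
  have hA : ∀ N : ℕ, ∀ n ∈ Finset.Icc 1 N, 1 ≤ n := fun N n hn => (Finset.mem_Icc.1 hn).1
  set K := ∑' n : ℕ, ‖b n‖ * (n : ℝ) ^ (-u) with hK
  have hnorm : ∀ (t : ℝ) (n : ℕ), ‖b n * (n : ℂ) ^ (-(u + t * Complex.I))‖ =
      ‖b n‖ * (n : ℝ) ^ (-u) := by
    intro t n
    rcases Nat.eq_zero_or_pos n with rfl | hn
    · simp [hb0]
    · rw [norm_mul, Complex.norm_natCast_cpow_of_pos hn]; simp
  have hEq : ∀ N : ℕ, X ≤ N → Set.EqOn (fun v : ℝ =>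
      ‖∑ n ∈ Finset.Icc 1 N, (Set.Ici (n : ℝ)).indicator (fun _ => b n) v‖ ^ 2 *
        v ^ (-2 * u - 1)) (fun v : ℝ => ‖partialSum b v‖ ^ 2 * v ^ (-2 * u - 1)) (Set.Ioc 1 X) := by
    intro N hN v hv
    simp only
    rw [sum_indicator_eq_partialSum b (by linarith [hv.1]) (hv.2.trans hN)]
  constructor
  · obtain ⟨N, hN⟩ := exists_nat_ge X
    exact ((integral_normSq_step_sum_mul_rpow hu _ (hA N) b).1.integrableOn).congr_fun (hEq N hN)
      measurableSet_Ioc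
  have hle : ∀ N : ℕ, X ≤ N → ∫ v in Set.Ioc 1 X, ‖partialSum b v‖ ^ 2 * v ^ (-2 * u - 1) ≤
      (2 * π)⁻¹ * ∫ t : ℝ, ‖∑ n ∈ Finset.Icc 1 N, b n * (n : ℂ) ^ (-(u + t * Complex.I))‖ ^ 2 *
        (u ^ 2 + t ^ 2)⁻¹ := by
    intro N hN
    rw [← integral_normSq_step_eq_lorentz hu _ (hA N), ← setIntegral_congr_fun measurableSet_Ioc
      (hEq N hN)]
    refine setIntegral_le_integral (integral_normSq_step_sum_mul_rpow hu _ (hA N) b).1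
      (ae_of_all _ fun v => ?_)
    simp only [Pi.zero_apply]
    rcases le_or_gt 0 v with hv | hv
    · positivity
    · rw [Finset.sum_eq_zero]
      · simp
      · intro n _
        rw [Set.indicator_of_notMem]
        simp only [Set.mem_Ici, not_le]
        exact hv.trans_le (Nat.cast_nonneg n)
  -- Only the frequency side needs a limit, as on (1, X] the truncated step function is already the
  -- partial sum. The norm of every truncation is at most K, which gives an integrable majorant.
  have hlim : Filter.Tendsto (fun N : ℕ => ∫ t : ℝ,
      ‖∑ n ∈ Finset.Icc 1 N, b n * (n : ℂ) ^ (-(u + t * Complex.I))‖ ^ 2 * (u ^ 2 + t ^ 2)⁻¹)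
      Filter.atTop (nhds (∫ t : ℝ, ‖Z t‖ ^ 2 * (u ^ 2 + t ^ 2)⁻¹)) := by
    refine tendsto_integral_of_dominated_convergence (fun t => K ^ 2 * (u ^ 2 + t ^ 2)⁻¹) ?_
      ((integrable_lorentz hu).const_mul _) ?_ ?_
    · intro N
      refine Continuous.aestronglyMeasurable ?_
      refine Continuous.mul (Continuous.pow (Continuous.norm ?_) 2) ?_
      · refine continuous_finsetSum _ fun n hn => continuous_const.mul ?_
        refine Continuous.const_cpow (by fun_prop) (Or.inl ?_)
        exact_mod_cast (show n ≠ 0 by have := hA N n hn; omega)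
      · exact Continuous.inv₀ (by fun_prop) fun t => by positivity
    · intro N
      refine ae_of_all _ fun t => ?_
      rw [norm_mul, norm_pow, norm_norm, norm_inv, Real.norm_of_nonneg (by positivity)]
      gcongr
      refine (norm_sum_le _ _).trans ?_
      simp only [hnorm]
      exact hb.sum_le_tsum _ fun n _ => by positivity
    · refine ae_of_all _ fun t => ?_
      refine Filter.Tendsto.mul_const _ (Filter.Tendsto.pow (Filter.Tendsto.norm ?_) 2)
      have h1 := ((hZ t).tendsto_sum_nat).comp (Filter.tendsto_add_atTop_nat 1)
      refine h1.congr fun N => ?_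
      simp only [Function.comp]
      rw [Finset.range_eq_Ico, Finset.sum_eq_sum_Ico_succ_bot (by omega), hb0, zero_mul, zero_add]
      refine Finset.sum_congr ?_ fun _ _ => rfl
      ext n; simp
  refine ge_of_tendsto (hlim.const_mul _) ?_
  obtain ⟨N, hN⟩ := exists_nat_ge X
  filter_upwards [Filter.eventually_ge_atTop N] with M hM
  exact hle M (hN.trans (by exact_mod_cast hM))

/-! ### Weighted prime sums from a Chebyshev bound -/

/-- Stands in for partial summation: the block 2^k ≤ p < 2^(k+1) carries weight at most A · 2^(k+1),
and 1/p ≤ 2^{-k} there, so each block costs 2A times its value of Φ. -/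
theorem sum_prime_dyadic_le {f : ℕ → ℝ} (hf : ∀ p, 0 ≤ f p) {A : ℝ}
    (hA : ∀ z : ℝ, 2 ≤ z → ∑ p ∈ primesIoc 0 z, f p * Real.log p ≤ A * z) {s : Finset ℕ}
    (hs : ∀ p ∈ s, p.Prime) {φ Φ : ℕ → ℝ} (hΦ : Summable Φ) (hΦ0 : ∀ k, 0 ≤ Φ k)
    (hφ : ∀ p ∈ s, φ p ≤ Φ (Nat.log 2 p)) :
    ∑ p ∈ s, f p * Real.log p / p * φ p ≤ 2 * A * ∑' k, Φ k := by
  have hA0 : 0 ≤ A := by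
    have := hA 2 le_rfl
    have h2 : 0 ≤ ∑ p ∈ primesIoc 0 2, f p * Real.log p :=
      Finset.sum_nonneg fun p _ => mul_nonneg (hf p) (Real.log_natCast_nonneg p)
    linarith
  have hblock : ∀ k : ℕ, ∑ p ∈ s with Nat.log 2 p = k, f p * Real.log p / p * φ p ≤
      2 * A * Φ k := by
    intro k
    have h1 : ∀ p ∈ s.filter (fun p => Nat.log 2 p = k), f p * Real.log p / p * φ p ≤
        f p * Real.log p * ((2 : ℝ) ^ k)⁻¹ * Φ k := by
      intro p hp
      obtain ⟨hps, hk⟩ := Finset.mem_filter.1 hp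
      have hp0 := (hs p hps).ne_zero
      have hpk : (2 : ℝ) ^ k ≤ p := by
        rw [← hk]; exact_mod_cast Nat.pow_log_le_self 2 hp0
      have hfl : 0 ≤ f p * Real.log p := mul_nonneg (hf p) (Real.log_natCast_nonneg p)
      rw [div_eq_mul_inv]
      have h2 : (p : ℝ)⁻¹ ≤ ((2 : ℝ) ^ k)⁻¹ := inv_anti₀ (by positivity) hpk
      have h3 := hφ p hps
      rw [hk] at h3
      calc f p * Real.log p * (p : ℝ)⁻¹ * φ p ≤ f p * Real.log p * (p : ℝ)⁻¹ * Φ k := by gcongr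
        _ ≤ _ := mul_le_mul_of_nonneg_right (mul_le_mul_of_nonneg_left h2 hfl) (hΦ0 k)
    refine (Finset.sum_le_sum h1).trans ?_
    rw [← Finset.sum_mul, ← Finset.sum_mul]
    have h4 : ∑ p ∈ s with Nat.log 2 p = k, f p * Real.log p ≤ A * 2 ^ (k + 1) := by
      refine le_trans ?_ (hA (2 ^ (k + 1)) ?_)
      · refine Finset.sum_le_sum_of_subset_of_nonneg ?_ fun p _ _ =>
          mul_nonneg (hf p) (Real.log_natCast_nonneg p)
        intro p hp
        obtain ⟨hps, hk⟩ := Finset.mem_filter.1 hp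
        refine mem_primesIoc.2 ⟨hs p hps, by exact_mod_cast (hs p hps).pos, ?_⟩
        have := Nat.lt_pow_succ_log_self (b := 2) (by norm_num) p
        rw [hk] at this
        exact_mod_cast this.le
      · have : (1 : ℝ) ≤ 2 ^ k := one_le_pow₀ (by norm_num)
        rw [pow_succ]; linarith
    calc _ ≤ A * 2 ^ (k + 1) * ((2 : ℝ) ^ k)⁻¹ * Φ k := by
          have := hΦ0 k
          gcongr
      _ = 2 * A * Φ k := by rw [pow_succ]; field_simp
  obtain ⟨N, hN⟩ : ∃ N, ∀ p ∈ s, Nat.log 2 p ∈ Finset.range N := by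
    refine ⟨s.sup (Nat.log 2) + 1, fun p hp => Finset.mem_range.2 ?_⟩
    exact Nat.lt_succ_of_le (Finset.le_sup (f := Nat.log 2) hp)
  rw [← Finset.sum_fiberwise_of_maps_to hN]
  refine (Finset.sum_le_sum fun k _ => hblock k).trans ?_
  rw [← Finset.mul_sum]
  exact mul_le_mul_of_nonneg_left (hΦ.sum_le_tsum _ fun k _ => hΦ0 k) (by positivity)

/-- Convexity puts 2^{-σ} below its chord over [0, 2], and the chord has slope -3/8. The gap σ/4
bounds the dyadic geometric series by 4/σ. -/
theorem two_rpow_neg_le {σ : ℝ} (h0 : 0 ≤ σ) (h2 : σ ≤ 2) : (2 : ℝ) ^ (-σ) ≤ 1 - σ / 4 := by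
  have h := (convexOn_rpow_left (b := (2 : ℝ)) (by norm_num)).2 (Set.mem_univ 0)
    (Set.mem_univ (-2)) (show 0 ≤ 1 - σ / 2 by linarith) (show 0 ≤ σ / 2 by linarith) (by ring)
  simp only [smul_eq_mul, mul_zero, zero_add, Real.rpow_zero] at h
  rw [show σ / 2 * -2 = -σ by ring] at h
  norm_num at h
  linarith

theorem sum_prime_log_mul_rpow_le {f : ℕ → ℝ} (hf : ∀ p, 0 ≤ f p) {A : ℝ}
    (hA : ∀ z : ℝ, 2 ≤ z → ∑ p ∈ primesIoc 0 z, f p * Real.log p ≤ A * z) {s : Finset ℕ}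
    (hs : ∀ p ∈ s, p.Prime) {σ : ℝ} (h0 : 0 < σ) (h2 : σ ≤ 2) :
    ∑ p ∈ s, f p * Real.log p * (p : ℝ) ^ (-(1 + σ)) ≤ 8 * A / σ := by
  have hA0 : 0 ≤ A := by
    have := hA 2 le_rfl
    have h2 : 0 ≤ ∑ p ∈ primesIoc 0 2, f p * Real.log p :=
      Finset.sum_nonneg fun p _ => mul_nonneg (hf p) (Real.log_natCast_nonneg p)
    linarith
  have hq := two_rpow_neg_le h0.le h2
  have hq0 : (0 : ℝ) ≤ (2 : ℝ) ^ (-σ) := by positivity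
  have hq1 : (2 : ℝ) ^ (-σ) < 1 := by linarith
  have h := sum_prime_dyadic_le hf hA hs (φ := fun p => (p : ℝ) ^ (-σ))
    (Φ := fun k => ((2 : ℝ) ^ (-σ)) ^ k) (summable_geometric_of_lt_one hq0 hq1)
    (fun k => by positivity) (fun p hp => by
      have : (2 : ℝ) ^ (Nat.log 2 p) ≤ p := by
        exact_mod_cast Nat.pow_log_le_self 2 (hs p hp).ne_zero
      rw [← Real.rpow_natCast, ← Real.rpow_mul (by norm_num), mul_comm (-σ),
        Real.rpow_mul (by norm_num), Real.rpow_natCast]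
      exact Real.rpow_le_rpow_of_nonpos (by positivity) this (by linarith))
  rw [tsum_geometric_of_lt_one hq0 hq1] at h
  calc _ = ∑ p ∈ s, f p * Real.log p / p * (p : ℝ) ^ (-σ) := by
        refine Finset.sum_congr rfl fun p hp => ?_
        have : (0 : ℝ) < p := by exact_mod_cast (hs p hp).pos
        rw [neg_add, Real.rpow_add this, Real.rpow_neg_one]; ring
    _ ≤ _ := h
    _ ≤ 2 * A * (σ / 4)⁻¹ := by gcongr; linarith
    _ = _ := by field_simp; ring

/-- Rankin's trick: with σ = 1/log w the factor p^{-σ} is at least 1/e on the whole range. The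
constant 24 is 8 with e rounded up to 3. -/
theorem sum_prime_log_div_le {f : ℕ → ℝ} (hf : ∀ p, 0 ≤ f p) {A : ℝ}
    (hA : ∀ z : ℝ, 2 ≤ z → ∑ p ∈ primesIoc 0 z, f p * Real.log p ≤ A * z) {s : Finset ℕ}
    (hs : ∀ p ∈ s, p.Prime) {w : ℝ} (hw : 2 ≤ w) (hsw : ∀ p ∈ s, (p : ℝ) ≤ w) :
    ∑ p ∈ s, f p * Real.log p / p ≤ 24 * A * Real.log w := by
  have hA0 : 0 ≤ A := by
    have := hA 2 le_rfl
    have h2 : 0 ≤ ∑ p ∈ primesIoc 0 2, f p * Real.log p :=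
      Finset.sum_nonneg fun p _ => mul_nonneg (hf p) (Real.log_natCast_nonneg p)
    linarith
  have hl : Real.log 2 ≤ Real.log w := Real.log_le_log (by norm_num) hw
  have hl0 : 0.69 < Real.log 2 := by linarith [Real.log_two_gt_d9]
  have hl1 : 0 < Real.log w := by linarith
  have h := sum_prime_log_mul_rpow_le hf hA hs (σ := 1 / Real.log w) (by positivity) (by
    rw [div_le_iff₀ hl1]; linarith)
  calc _ ≤ ∑ p ∈ s, Real.exp 1 * (f p * Real.log p * (p : ℝ) ^ (-(1 + 1 / Real.log w))) := by
        refine Finset.sum_le_sum fun p hp => ?_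
        have hp0 : (0 : ℝ) < p := by exact_mod_cast (hs p hp).pos
        have h3 : Real.exp (-1) ≤ (p : ℝ) ^ (-(1 / Real.log w)) := by
          rw [Real.rpow_def_of_pos hp0]
          apply Real.exp_le_exp.2
          have := Real.log_le_log hp0 (hsw p hp)
          rw [mul_neg, neg_le_neg_iff, mul_one_div, div_le_one hl1]
          exact this
        have h4 : 1 ≤ Real.exp 1 * (p : ℝ) ^ (-(1 / Real.log w)) := by
          calc (1 : ℝ) = Real.exp 1 * Real.exp (-1) := by rw [← Real.exp_add]; simp
            _ ≤ _ := by gcongr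
        rw [neg_add, Real.rpow_add hp0, Real.rpow_neg_one]
        have h5 : 0 ≤ f p * Real.log p / p := by
          have := hf p; have := Real.log_natCast_nonneg p; positivity
        calc f p * Real.log p / p = f p * Real.log p / p * 1 := (mul_one _).symm
          _ ≤ f p * Real.log p / p * (Real.exp 1 * (p : ℝ) ^ (-(1 / Real.log w))) := by gcongr
          _ = _ := by ring
    _ = Real.exp 1 * ∑ p ∈ s, f p * Real.log p * (p : ℝ) ^ (-(1 + 1 / Real.log w)) := by
        rw [Finset.mul_sum]
    _ ≤ 3 * (8 * A / (1 / Real.log w)) := by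
        have : Real.exp 1 ≤ 3 := by linarith [Real.exp_one_lt_d9]
        have h6 : 0 ≤ ∑ p ∈ s, f p * Real.log p * (p : ℝ) ^ (-(1 + 1 / Real.log w)) :=
          Finset.sum_nonneg fun p _ => by
            have := hf p; have := Real.log_natCast_nonneg p; positivity
        exact mul_le_mul this h h6 (by norm_num)
    _ = _ := by field_simp; ring

theorem sum_prime_div_log_le {f : ℕ → ℝ} (hf : ∀ p, 0 ≤ f p) {A : ℝ}
    (hA : ∀ z : ℝ, 2 ≤ z → ∑ p ∈ primesIoc 0 z, f p * Real.log p ≤ A * z) {s : Finset ℕ}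
    (hs : ∀ p ∈ s, p.Prime) :
    ∑ p ∈ s, f p / (p * Real.log p) ≤ 6 * A * ∑' k : ℕ, 1 / (k : ℝ) ^ 2 := by
  have h := sum_prime_dyadic_le hf hA hs (φ := fun p => (Real.log p ^ 2)⁻¹)
    (Φ := fun k => 3 * (1 / (k : ℝ) ^ 2)) ((Real.summable_one_div_nat_pow.2 (by norm_num)).mul_left 3)
    (fun k => by positivity) (fun p hp => by
      have hk : 0 < Nat.log 2 p := Nat.log_pos (by norm_num) (hs p hp).two_le
      have hk' : (0 : ℝ) < Nat.log 2 p := by exact_mod_cast hk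
      have h1 : (2 : ℝ) ^ (Nat.log 2 p) ≤ p := by
        exact_mod_cast Nat.pow_log_le_self 2 (hs p hp).ne_zero
      have h2 := Real.log_le_log (by positivity) h1
      rw [Real.log_pow] at h2
      have h3 : (Nat.log 2 p : ℝ) * 0.69 ≤ Real.log p := by
        have := Real.log_two_gt_d9
        nlinarith
      have h4 : ((Nat.log 2 p : ℝ) * 0.69) ^ 2 ≤ Real.log p ^ 2 := by gcongr
      calc (Real.log p ^ 2)⁻¹ ≤ (((Nat.log 2 p : ℝ) * 0.69) ^ 2)⁻¹ := inv_anti₀ (by positivity) h4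
        _ ≤ 3 * (1 / (Nat.log 2 p : ℝ) ^ 2) := by
          rw [mul_pow, mul_inv, mul_comm, one_div]
          gcongr
          norm_num)
  rw [tsum_mul_left] at h
  refine le_trans (le_of_eq ?_) (h.trans (le_of_eq (by ring)))
  refine Finset.sum_congr rfl fun p hp => ?_
  have hp0 : (0 : ℝ) < p := by exact_mod_cast (hs p hp).pos
  have : 0 < Real.log p := Real.log_pos (by exact_mod_cast (hs p hp).one_lt)
  field_simp

theorem sum_prime_log_le (z : ℝ) (hz : 2 ≤ z) :
    ∑ p ∈ primesIoc 0 z, (1 : ℝ) * Real.log p ≤ Real.log 4 * z := by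
  have := Chebyshev.theta_le_log4_mul_x (show 0 ≤ z by linarith)
  refine le_trans (le_of_eq ?_) this
  simp [primesIoc, Chebyshev.theta]

theorem norm_expMult_le (a : ℕ → ℂ) (n : ℕ) :
    ‖expMult a n‖ ≤ n.factorization.prod fun p k => ‖a p‖ ^ k := by
  rcases eq_or_ne n 0 with rfl | hn
  · simp
  rw [expMult_apply _ hn, Finsupp.prod, Finsupp.prod, norm_prod]
  refine Finset.prod_le_prod (fun _ _ => norm_nonneg _) fun p _ => ?_
  rw [norm_div, norm_pow]
  refine div_le_self (by positivity) ?_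
  rw [Complex.norm_natCast]
  exact_mod_cast Nat.succ_le_of_lt (Nat.factorial_pos _)

/-! ### Mertens' second theorem, up to a bounded error -/

/-- With a(p) = p^{-1-σ}, exp(∑ a(p)) is a sum of terms at most n^{-1-σ}, hence at most 1 + 1/σ by
comparison with an integral. For σ = 1/log w, replacing p^{-1-σ} by 1/p costs only σ ∑ log p / p =
O(1). -/
theorem exists_sum_prime_inv_le : ∃ C : ℝ, ∀ w : ℝ, 2 ≤ w →
    ∑ p ∈ primesIoc 0 w, 1 / (p : ℝ) ≤ Real.log (Real.log w) + C := by
  refine ⟨Real.log 4 + 24 * Real.log 4, fun w hw => ?_⟩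
  have hs : ∀ p ∈ primesIoc 0 w, p.Prime := fun p hp => (mem_primesIoc.1 hp).1
  have hl : Real.log 2 ≤ Real.log w := Real.log_le_log (by norm_num) hw
  have hl0 : 0.69 < Real.log 2 := by linarith [Real.log_two_gt_d9]
  have hl1 : 0 < Real.log w := by linarith
  set σ := 1 / Real.log w with hσ
  have hσ0 : 0 < σ := by positivity
  have h1 := sum_prime_log_div_le (f := fun _ => 1) (fun _ => zero_le_one) sum_prime_log_le hs hw
    (fun p hp => (mem_primesIoc.1 hp).2.2)
  have h2 : ∑ p ∈ primesIoc 0 w, (p : ℝ) ^ (-(1 + σ)) ≤ Real.log (1 + 1 / σ) := by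
    rw [Real.le_log_iff_exp_le (by positivity)]
    set a : ℕ → ℂ := fun p => if p ∈ primesIoc 0 w then (((p : ℝ) ^ (-(1 + σ)) : ℝ) : ℂ) else 0
      with ha
    have h3 := hasSum_norm_expMult (a := a) hs (fun p _ hp => by simp [ha, hp])
    have h4 : ∑ p ∈ primesIoc 0 w, ‖a p‖ = ∑ p ∈ primesIoc 0 w, (p : ℝ) ^ (-(1 + σ)) := by
      refine Finset.sum_congr rfl fun p hp => ?_
      simp only [ha, hp, if_true]
      rw [Complex.norm_real, Real.norm_of_nonneg (by positivity)]
    rw [h4] at h3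
    have h5 : ∀ n : ℕ, 1 ≤ n → ‖expMult a n‖ ≤ (n : ℝ) ^ (-(1 + σ)) := by
      intro n hn
      refine (norm_expMult_le a n).trans ?_
      have : (n : ℝ) ^ (-(1 + σ)) = n.factorization.prod fun p k => ((p : ℝ) ^ (-(1 + σ))) ^ k := by
        conv_lhs => rw [← Nat.prod_factorization_pow_eq_self (show n ≠ 0 by omega)]
        rw [Finsupp.prod, Nat.cast_prod, ← Real.finsetProd_rpow _ _ fun p _ => by positivity]
        refine Finset.prod_congr rfl fun p _ => ?_
        push_cast
        rw [← Real.rpow_natCast, ← Real.rpow_mul (by positivity), mul_comm,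
          Real.rpow_mul (by positivity), Real.rpow_natCast]
      rw [this]
      refine Finset.prod_le_prod (fun _ _ => by positivity) fun p _ => ?_
      refine pow_le_pow_left₀ (norm_nonneg _) ?_ _
      simp only [ha]
      split_ifs
      · rw [Complex.norm_real, Real.norm_of_nonneg (by positivity)]
      · simp; positivity
    refine le_of_tendsto' (h3.tendsto_sum_nat.comp (Filter.tendsto_add_atTop_nat 2)) fun N => ?_
    simp only [Function.comp]
    rw [Finset.range_eq_Ico, Finset.sum_eq_sum_Ico_succ_bot (by omega),
      Finset.sum_eq_sum_Ico_succ_bot (by omega)]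
    simp only [ArithmeticFunction.map_zero, norm_zero, zero_add, expMult_one, norm_one]
    gcongr
    refine (Finset.sum_le_sum fun n hn => h5 n (by
      have := (Finset.mem_Ico.1 hn).1; omega)).trans ?_
    have h6 : AntitoneOn (fun x : ℝ => x ^ (-(1 + σ))) (Set.Icc ((1 : ℕ) : ℝ) ((N + 1 : ℕ) : ℝ)) := by
      intro x hx y hy hxy
      have : (1 : ℝ) ≤ x := by simpa using hx.1
      exact Real.rpow_le_rpow_of_nonpos (by linarith) hxy (by linarith)
    have h7 := h6.sum_le_integral_Ico (by omega)
    have h8 : ∑ n ∈ Finset.Ico (1 + 1) (N + 2), (n : ℝ) ^ (-(1 + σ)) =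
        ∑ i ∈ Finset.Ico 1 (N + 1), ((i + 1 : ℕ) : ℝ) ^ (-(1 + σ)) := by
      rw [← Finset.sum_Ico_add' (fun n : ℕ => (n : ℝ) ^ (-(1 + σ)))]
    rw [h8]
    refine h7.trans ?_
    rw [intervalIntegral.integral_of_le (by push_cast; linarith [(Nat.cast_nonneg N : (0:ℝ) ≤ N)])]
    calc _ ≤ ∫ x in Set.Ioi ((1 : ℕ) : ℝ), x ^ (-(1 + σ)) := by
          refine setIntegral_mono_set (integrableOn_Ioi_rpow_of_lt (by linarith) (by norm_num)) ?_
            (Set.Ioc_subset_Ioi_self.eventuallyLE)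
          filter_upwards [ae_restrict_mem measurableSet_Ioi] with x hx
          have : (1 : ℝ) < x := by simpa using hx
          simp only [Pi.zero_apply]; positivity
      _ = 1 / σ := by
          rw [integral_Ioi_rpow_of_lt (by linarith) (by norm_num)]
          simp
  have h9 : ∑ p ∈ primesIoc 0 w, 1 / (p : ℝ) ≤ ∑ p ∈ primesIoc 0 w, (p : ℝ) ^ (-(1 + σ)) +
      σ * ∑ p ∈ primesIoc 0 w, 1 * Real.log p / p := by
    rw [Finset.mul_sum, ← Finset.sum_add_distrib]
    refine Finset.sum_le_sum fun p hp => ?_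
    have hp0 : (0 : ℝ) < p := by exact_mod_cast (hs p hp).pos
    rw [neg_add, Real.rpow_add hp0, Real.rpow_neg_one]
    have : 1 - σ * Real.log p ≤ (p : ℝ) ^ (-σ) := by
      rw [Real.rpow_def_of_pos hp0]
      have := Real.add_one_le_exp (Real.log p * -σ)
      linarith
    have h10 : 0 < (p : ℝ)⁻¹ := by positivity
    rw [one_div, div_eq_mul_inv]
    nlinarith
  have h11 : Real.log (1 + 1 / σ) ≤ Real.log (Real.log w) + Real.log 4 := by
    rw [← Real.log_mul hl1.ne' (by norm_num), hσ, one_div_one_div]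
    exact Real.log_le_log (by positivity) (by linarith)
  have h12 : σ * ∑ p ∈ primesIoc 0 w, 1 * Real.log p / p ≤ 24 * Real.log 4 := by
    calc _ ≤ σ * (24 * Real.log 4 * Real.log w) := by gcongr
      _ = _ := by rw [hσ]; field_simp
  linarith

/-- Every n ≤ x is a product of primes p ≤ x, so the harmonic sum lies below ∏ (1 - 1/p)^{-1}. Each
factor is at most exp(1/p + 2/p²), and the squares converge. -/
theorem exists_le_sum_prime_inv : ∃ C : ℝ, ∀ x : ℝ, 2 ≤ x →
    Real.log (Real.log x) - C ≤ ∑ p ∈ primesIoc 0 x, 1 / (p : ℝ) := by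
  refine ⟨∑' n : ℕ, 2 * (1 / (n : ℝ) ^ 2), fun x hx => ?_⟩
  have hsum : Summable fun n : ℕ => 2 * (1 / (n : ℝ) ^ 2) :=
    (Real.summable_one_div_nat_pow.2 (by norm_num)).mul_left 2
  have hl1 : 0 < Real.log x := Real.log_pos (by linarith)
  set N := ⌊x⌋₊ with hN
  let F : ℕ →* ℝ := ⟨⟨fun n => (n : ℝ)⁻¹, by simp⟩, fun m n => by simp [mul_comm]⟩
  have hFp : ∀ {p : ℕ}, p.Prime → ‖F p‖ < 1 := by
    intro p hp
    have : (1 : ℝ) < p := by exact_mod_cast hp.one_lt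
    change ‖((p : ℝ)⁻¹)‖ < 1
    rw [norm_inv, Real.norm_of_nonneg (by positivity)]
    exact inv_lt_one_of_one_lt₀ this
  have key := EulerProduct.summable_and_hasSum_smoothNumbers_prod_primesBelow_geometric hFp (N + 1)
  have hset : (N + 1).primesBelow = primesIoc 0 x := by
    ext p
    simp only [Nat.mem_primesBelow, primesIoc, Finset.mem_filter, Finset.mem_Ioc, Nat.floor_zero]
    constructor
    · rintro ⟨h1, h2⟩; exact ⟨⟨h2.pos, by omega⟩, h2⟩
    · rintro ⟨⟨h1, h2⟩, h3⟩; exact ⟨by omega, h3⟩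
  rw [hset] at key
  have h1 : Real.log x ≤ ∏ p ∈ primesIoc 0 x, (1 - F p)⁻¹ := by
    have hsub : ∀ n ∈ Finset.Icc 1 N, n ∈ (N + 1).smoothNumbers := by
      intro n hn
      obtain ⟨hn1, hn2⟩ := Finset.mem_Icc.1 hn
      rw [Nat.mem_smoothNumbers']
      intro p hp hpn
      exact lt_of_le_of_lt (Nat.le_of_dvd hn1 hpn) (by omega)
    have h2 : ∑ n ∈ Finset.Icc 1 N, F n ≤ ∏ p ∈ primesIoc 0 x, (1 - F p)⁻¹ := by
      have h3 : HasSum ((fun n => F n) ∘ ((↑) : (N + 1).smoothNumbers → ℕ)) _ := key.2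
      have h4 := hasSum_subtype_iff_indicator.1 h3
      refine le_trans (le_of_eq ?_) (sum_le_hasSum (Finset.Icc 1 N) (fun n _ => ?_) h4)
      · refine Finset.sum_congr rfl fun n hn => ?_
        rw [Set.indicator_of_mem (hsub n hn)]
      · refine Set.indicator_nonneg (fun n _ => ?_) n
        change 0 ≤ (n : ℝ)⁻¹
        positivity
    refine le_trans ?_ h2
    have h5 := log_add_one_le_harmonic N
    refine le_trans (Real.log_le_log (by linarith) ?_) (h5.trans (le_of_eq ?_))
    · rw [hN]; push_cast; exact (Nat.lt_floor_add_one x).le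
    · rw [harmonic_eq_sum_Icc]; push_cast; rfl
  have h6 : ∏ p ∈ primesIoc 0 x, (1 - F p)⁻¹ ≤
      Real.exp (∑ p ∈ primesIoc 0 x, (1 / (p : ℝ) + 2 * (1 / (p : ℝ) ^ 2))) := by
    rw [Real.exp_sum]
    refine Finset.prod_le_prod (fun p hp => ?_) fun p hp => ?_
    · have := hFp (mem_primesIoc.1 hp).1
      have := (abs_lt.1 this).2
      exact inv_nonneg.2 (by linarith)
    · have hp2 : (2 : ℝ) ≤ p := by exact_mod_cast (mem_primesIoc.1 hp).1.two_le
      change (1 - (p : ℝ)⁻¹)⁻¹ ≤ _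
      refine le_trans ?_ (Real.add_one_le_exp _)
      have : 0 < 1 - (p : ℝ)⁻¹ := by
        have := inv_lt_one_of_one_lt₀ (show (1 : ℝ) < p by linarith)
        linarith
      rw [inv_le_iff_one_le_mul₀ this]
      have hp0 : (p : ℝ) ≠ 0 := by linarith
      have h7 : (p : ℝ)⁻¹ ≤ 1 / 2 := by
        rw [one_div]; exact inv_anti₀ (by norm_num) hp2
      have h8 : 0 < (p : ℝ)⁻¹ := by positivity
      rw [one_div, one_div, ← inv_pow]
      set y := (p : ℝ)⁻¹
      nlinarith [mul_pos h8 h8]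
  have h9 := Real.log_le_log hl1 (h1.trans h6)
  rw [Real.log_exp, Finset.sum_add_distrib] at h9
  have h10 := hsum.sum_le_tsum (primesIoc 0 x) fun n _ => by positivity
  linarith

theorem primesIoc_union {u v w : ℝ} (huv : u ≤ v) (hvw : v ≤ w) :
    primesIoc u w = primesIoc u v ∪ primesIoc v w ∧ Disjoint (primesIoc u v) (primesIoc v w) := by
  constructor
  · ext p
    simp only [Finset.mem_union, mem_primesIoc]
    constructor
    · rintro ⟨h1, h2, h3⟩
      rcases le_or_gt (p : ℝ) v with h | h
      · exact Or.inl ⟨h1, h2, h⟩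
      · exact Or.inr ⟨h1, h, h3⟩
    · rintro (⟨h1, h2, h3⟩ | ⟨h1, h2, h3⟩)
      · exact ⟨h1, h2, h3.trans hvw⟩
      · exact ⟨h1, lt_of_le_of_lt huv h2, h3⟩
  · rw [Finset.disjoint_left]
    intro p h1 h2
    exact absurd (mem_primesIoc.1 h1).2.2 (not_le.2 (mem_primesIoc.1 h2).2.1)

theorem sum_primesIoc_add {u v w : ℝ} (huv : u ≤ v) (hvw : v ≤ w) (f : ℕ → ℝ) :
    ∑ p ∈ primesIoc u w, f p = ∑ p ∈ primesIoc u v, f p + ∑ p ∈ primesIoc v w, f p := by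
  rw [(primesIoc_union huv hvw).1, Finset.sum_union (primesIoc_union huv hvw).2]

/-- The lower bound in Mertens' second theorem. -/
theorem exists_le_sum_prime_inv_Ioc : ∃ C : ℝ, 0 ≤ C ∧ ∀ w x : ℝ, 2 ≤ w → w ≤ x →
    Real.log (Real.log x / Real.log w) - C ≤ ∑ p ∈ primesIoc w x, 1 / (p : ℝ) := by
  obtain ⟨C, hC⟩ := exists_sum_prime_inv_le
  obtain ⟨D, hD⟩ := exists_le_sum_prime_inv
  refine ⟨max (C + D) 0, le_max_right _ _, fun w x hw hx => ?_⟩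
  have h1 := hC w hw
  have h2 := hD x (hw.trans hx)
  have hw0 : 0 < Real.log w := Real.log_pos (by linarith)
  have hx0 : 0 < Real.log x := Real.log_pos (by linarith)
  rw [sum_primesIoc_add (by linarith : (0 : ℝ) ≤ w) hx] at h2
  rw [Real.log_div hx0.ne' hw0.ne']
  linarith [le_max_left (C + D) 0]

/-! ### Balancing two bounds over dyadic scales -/

/-- One bound grows at rate β and the other decays at rate c. They meet at j log 2 = l/(c+β) with
common value exp(-lc/(c+β)), and on either side the smaller one falls geometrically with ratio
2^{-min(β, c)}. -/
theorem exists_sum_min_geometric_le {β c : ℝ} (hβ : 0 < β) (hc : 0 < c) :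
    ∃ C : ℝ, 0 < C ∧ ∀ l : ℝ, 0 ≤ l → ∀ N : ℕ,
      ∑ j ∈ Finset.range N, min (Real.exp (-l + β * (j * Real.log 2)))
        (Real.exp (-(c * (j * Real.log 2)))) ≤ C * Real.exp (-(l * c / (c + β))) := by
  set m := min β c with hm
  have hm0 : 0 < m := lt_min hβ hc
  have hl2 : 0 < Real.log 2 := Real.log_pos (by norm_num)
  set q := Real.exp (-(m * Real.log 2)) with hq
  have hq0 : 0 < q := Real.exp_pos _
  have hq1 : q < 1 := by
    rw [hq, ← Real.exp_zero]; exact Real.exp_lt_exp.2 (by nlinarith [mul_pos hm0 hl2])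
  have hgeom : ∀ n : ℕ, ∑ i ∈ Finset.range n, q ^ i ≤ (1 - q)⁻¹ := fun n =>
    (Summable.sum_le_tsum _ (fun i _ => by positivity)
      (summable_geometric_of_lt_one hq0.le hq1)).trans_eq (tsum_geometric_of_lt_one hq0.le hq1)
  have h1q : 0 < (1 - q)⁻¹ := inv_pos.2 (by linarith)
  refine ⟨2 * (1 - q)⁻¹, by positivity, fun l hl N => ?_⟩
  set μ := l / (c + β) with hμ
  have hμ0 : 0 ≤ μ := by positivity
  have hlμ : l = μ * (c + β) := by rw [hμ]; field_simp
  -- The last index not beyond the crossing point: the growing bound is used up to J, the decaying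
  -- one from J + 1 on.
  set J := ⌊μ / Real.log 2⌋₊ with hJ
  have hJ1 : J * Real.log 2 ≤ μ := by
    rw [← le_div_iff₀ hl2]; exact Nat.floor_le (by positivity)
  have hJ2 : μ < (J + 1) * Real.log 2 := by
    rw [← div_lt_iff₀ hl2]; exact Nat.lt_floor_add_one _
  have hterm : ∀ j : ℕ, min (Real.exp (-l + β * (j * Real.log 2)))
        (Real.exp (-(c * (j * Real.log 2)))) ≤
      Real.exp (-(μ * c)) * ((if j < J + 1 then q ^ (J - j) else 0) +
        if J + 1 ≤ j then q ^ (j - (J + 1)) else 0) := by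
    intro j
    by_cases hj : j < J + 1
    · rw [if_pos hj, if_neg (by omega), add_zero]
      refine (min_le_left _ _).trans ?_
      rw [hq, ← Real.exp_nat_mul, ← Real.exp_add]
      apply Real.exp_le_exp.2
      have h1 : ((J - j : ℕ) : ℝ) = J - j := by rw [Nat.cast_sub (by omega)]
      rw [h1, hlμ]
      have h2 : 0 ≤ ((J : ℝ) - j) * Real.log 2 := by
        have : (j : ℝ) ≤ J := by exact_mod_cast Nat.lt_succ_iff.1 hj
        have : 0 ≤ (J : ℝ) - j := by linarith
        positivity
      have h3 : m ≤ β := min_le_left _ _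
      nlinarith [mul_le_mul_of_nonneg_right h3 h2]
    · rw [if_neg hj, if_pos (by omega), zero_add]
      refine (min_le_right _ _).trans ?_
      rw [hq, ← Real.exp_nat_mul, ← Real.exp_add]
      apply Real.exp_le_exp.2
      have h1 : ((j - (J + 1) : ℕ) : ℝ) = j - (J + 1) := by
        rw [Nat.cast_sub (by omega)]; push_cast; ring
      rw [h1]
      have h2 : 0 ≤ ((j : ℝ) - (J + 1)) * Real.log 2 := by
        have : ((J + 1 : ℕ) : ℝ) ≤ j := by exact_mod_cast Nat.not_lt.1 hj
        push_cast at this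
        have : 0 ≤ (j : ℝ) - (J + 1) := by linarith
        positivity
      have h3 : m ≤ c := min_le_right _ _
      nlinarith [mul_le_mul_of_nonneg_right h3 h2]
  refine (Finset.sum_le_sum fun j _ => hterm j).trans ?_
  rw [← Finset.mul_sum, Finset.sum_add_distrib, show l * c / (c + β) = μ * c by rw [hμ]; ring,
    mul_comm]
  gcongr
  rw [two_mul]
  gcongr
  · rw [← Finset.sum_filter]
    calc _ ≤ ∑ j ∈ Finset.range (J + 1), q ^ (J - j) := by
          refine Finset.sum_le_sum_of_subset_of_nonneg ?_ fun j _ _ => by positivity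
          intro j hj
          exact Finset.mem_range.2 (Finset.mem_filter.1 hj).2
      _ = ∑ j ∈ Finset.range (J + 1), q ^ j := by
          rw [← Finset.sum_range_reflect (fun j => q ^ j) (J + 1)]
          rfl
      _ ≤ _ := hgeom _
  · rw [← Finset.sum_filter]
    calc _ ≤ ∑ j ∈ Finset.Ico (J + 1) N, q ^ (j - (J + 1)) := by
          refine Finset.sum_le_sum_of_subset_of_nonneg ?_ fun j _ _ => by positivity
          intro j hj
          rw [Finset.mem_filter, Finset.mem_range] at hj
          exact Finset.mem_Ico.2 ⟨hj.2, hj.1⟩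
      _ = ∑ i ∈ Finset.range (N - (J + 1)), q ^ i := by
          rw [Finset.sum_Ico_eq_sum_range]
          refine Finset.sum_congr rfl fun i _ => ?_
          rw [Nat.add_sub_cancel_left]
      _ ≤ _ := hgeom _

/-! ### Mean squares of Dirichlet polynomials over primes -/

theorem natCast_cpow_neg_eq {n : ℕ} (hn : 0 < n) (u t : ℝ) :
    (n : ℂ) ^ (-(u + t * Complex.I)) =
      ((n : ℝ) ^ (-u) : ℝ) * Complex.exp ((t * (-Real.log n) : ℝ) * Complex.I) := by
  have hn0 : (n : ℂ) ≠ 0 := by exact_mod_cast hn.ne'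
  have hn1 : (0 : ℝ) < n := by exact_mod_cast hn
  rw [neg_add, Complex.cpow_add _ _ hn0, Complex.ofReal_cpow hn1.le]
  congr 1
  · push_cast; rfl
  · rw [Complex.cpow_def_of_ne_zero hn0]
    push_cast
    congr 1; ring

/-- The mean-square bound for the Dirichlet polynomial `∑ a(p) log p / p ^ (1 + σ + it)`. -/
theorem integral_normSq_prime_sum_le {a : ℕ → ℂ} {A : ℝ}
    (hA : ∀ z : ℝ, 2 ≤ z → ∑ p ∈ primesIoc 0 z, ‖a p‖ * Real.log p ≤ A * z) {s : Finset ℕ}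
    (hs : ∀ p ∈ s, p.Prime) {σ u : ℝ} (h0 : 0 < σ) (h2 : σ ≤ 2) (hu : 1 ≤ u) :
    Integrable (fun t : ℝ => ‖∑ p ∈ s, a p * (Real.log p : ℂ) *
      (p : ℂ) ^ (-(((1 + σ : ℝ) : ℂ) + t * Complex.I))‖ ^ 2 * (u ^ 2 + t ^ 2)⁻¹) ∧
    ∫ t : ℝ, ‖∑ p ∈ s, a p * (Real.log p : ℂ) *
      (p : ℂ) ^ (-(((1 + σ : ℝ) : ℂ) + t * Complex.I))‖ ^ 2 * (u ^ 2 + t ^ 2)⁻¹ ≤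
        π / u * (16 * A ^ 2 / σ) := by
  have hu0 : 0 < u := by linarith
  have hA0 : 0 ≤ A := by
    have := hA 2 le_rfl
    have h2 : 0 ≤ ∑ p ∈ primesIoc 0 2, ‖a p‖ * Real.log p :=
      Finset.sum_nonneg fun p _ => mul_nonneg (norm_nonneg _) (Real.log_natCast_nonneg p)
    linarith
  set c : ℕ → ℂ := fun p => a p * (Real.log p : ℂ) * ((p : ℝ) ^ (-(1 + σ)) : ℝ) with hc
  have hrw : ∀ t : ℝ, ∑ p ∈ s, a p * (Real.log p : ℂ) *
      (p : ℂ) ^ (-(((1 + σ : ℝ) : ℂ) + t * Complex.I)) =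
      ∑ p ∈ s, c p * Complex.exp ((t * (-Real.log p) : ℝ) * Complex.I) := by
    intro t
    refine Finset.sum_congr rfl fun p hp => ?_
    rw [natCast_cpow_neg_eq (hs p hp).pos, hc, ← mul_assoc]
  simp only [hrw]
  obtain ⟨hi, he⟩ := integral_normSq_sum_mul_lorentz hu0 s c (fun p => -Real.log p)
  refine ⟨hi, ?_⟩
  set α : ℕ → ℝ := fun p => ‖a p‖ * Real.log p * (p : ℝ) ^ (-(1 + σ)) with hα
  have hα0 : ∀ p, 0 ≤ α p := fun p => by
    have := Real.log_natCast_nonneg p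
    simp only [hα]; positivity
  have hcn : ∀ p, ‖c p‖ = α p := fun p => by
    simp only [hc, hα]
    rw [norm_mul, norm_mul, Complex.norm_real, Complex.norm_real,
      Real.norm_of_nonneg (Real.log_natCast_nonneg p), Real.norm_of_nonneg (by positivity)]
  have hsumα : ∑ p ∈ s, α p ≤ 8 * A / σ :=
    sum_prime_log_mul_rpow_le (fun p => norm_nonneg (a p)) hA hs h0 h2
  -- For u ≥ 1 the kernel exp(-u|log p - log q|) is at most min(p, q)/max(p, q). The two triangular
  -- halves of this majorant are summed separately.
  set T : ℕ → ℕ → ℝ := fun p q => if p ≤ q then (p : ℝ) / q else 0 with hT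
  have hT0 : ∀ p q, 0 ≤ T p q := fun p q => by simp only [hT]; split_ifs <;> positivity
  have hker : ∀ p ∈ s, ∀ q ∈ s, Real.exp (-(u * |-Real.log p - -Real.log q|)) ≤
      T p q + T q p := by
    intro p hp q hq
    have hp0 : (0 : ℝ) < p := by exact_mod_cast (hs p hp).pos
    have hq0 : (0 : ℝ) < q := by exact_mod_cast (hs q hq).pos
    have h1 : Real.exp (-(u * |-Real.log p - -Real.log q|)) ≤
        Real.exp (-|-Real.log p - -Real.log q|) := by
      apply Real.exp_le_exp.2
      nlinarith [abs_nonneg (-Real.log p - -Real.log q)]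
    refine h1.trans ?_
    rcases le_total p q with h | h
    · have hl := Real.log_le_log hp0 (show (p : ℝ) ≤ q by exact_mod_cast h)
      rw [abs_of_nonneg (by linarith), show -(-Real.log p - -Real.log q) =
        Real.log p - Real.log q by ring, Real.exp_sub, Real.exp_log hp0, Real.exp_log hq0]
      have := hT0 q p
      have h3 : T p q = p / q := if_pos h
      linarith
    · have hl := Real.log_le_log hq0 (show (q : ℝ) ≤ p by exact_mod_cast h)
      rw [abs_of_nonpos (by linarith), show -(-(-Real.log p - -Real.log q)) =
        Real.log q - Real.log p by ring, Real.exp_sub, Real.exp_log hp0, Real.exp_log hq0]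
      have := hT0 p q
      have h3 : T q p = q / p := if_pos h
      linarith
  -- A Schur-type row bound: α p · p is at most ‖a p‖ log p, so Chebyshev up to q pays exactly for
  -- the division by q. Hence only one factor 1/σ survives in the mean square.
  have hrow : ∀ q ∈ s, ∑ p ∈ s, α p * T p q ≤ A := by
    intro q hq
    have hq2 : (2 : ℝ) ≤ q := by exact_mod_cast (hs q hq).two_le
    have h1 : ∀ p ∈ s, α p * T p q ≤ if p ≤ q then ‖a p‖ * Real.log p / q else 0 := by
      intro p hp
      have hp1 : (1 : ℝ) ≤ p := by exact_mod_cast (hs p hp).one_lt.le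
      simp only [hα, hT]
      split_ifs with h
      · have h3 : (p : ℝ) ^ (-(1 + σ)) * p ≤ 1 := by
          rw [← Real.rpow_add_one (by linarith)]
          exact Real.rpow_le_one_of_one_le_of_nonpos hp1 (by linarith)
        have h4 : 0 ≤ ‖a p‖ * Real.log p / q := by
          have := Real.log_natCast_nonneg p
          positivity
        calc _ = ‖a p‖ * Real.log p / q * ((p : ℝ) ^ (-(1 + σ)) * p) := by ring
          _ ≤ ‖a p‖ * Real.log p / q * 1 := by gcongr
          _ = _ := mul_one _
      · simp
    refine (Finset.sum_le_sum h1).trans ?_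
    rw [← Finset.sum_filter, ← Finset.sum_div, div_le_iff₀ (by linarith)]
    refine le_trans (Finset.sum_le_sum_of_subset_of_nonneg ?_ fun p _ _ => ?_) (hA q hq2)
    · intro p hp
      obtain ⟨hp1, hp2⟩ := Finset.mem_filter.1 hp
      exact mem_primesIoc.2 ⟨hs p hp1, by exact_mod_cast (hs p hp1).pos, by exact_mod_cast hp2⟩
    · exact mul_nonneg (norm_nonneg _) (Real.log_natCast_nonneg p)
  have hhalf : ∑ q ∈ s, ∑ p ∈ s, α q * (α p * T p q) ≤ A * (8 * A / σ) := by
    simp only [← Finset.mul_sum]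
    calc _ ≤ ∑ q ∈ s, α q * A := by
          refine Finset.sum_le_sum fun q hq => mul_le_mul_of_nonneg_left (hrow q hq) (hα0 q)
      _ = A * ∑ q ∈ s, α q := by rw [← Finset.sum_mul, mul_comm]
      _ ≤ _ := by gcongr
  have hhalf' : ∑ p ∈ s, ∑ q ∈ s, α q * (α p * T p q) ≤ A * (8 * A / σ) := by
    rw [Finset.sum_comm]; exact hhalf
  have hpos : 0 ≤ ∫ t : ℝ, ‖∑ n ∈ s, c n * Complex.exp ((t * (-Real.log n) : ℝ) * Complex.I)‖ ^ 2 *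
      (u ^ 2 + t ^ 2)⁻¹ := integral_nonneg fun t => by positivity
  rw [← Real.norm_of_nonneg hpos, ← Complex.norm_real, he]
  refine (norm_sum_le _ _).trans ((Finset.sum_le_sum fun p _ => norm_sum_le _ _).trans ?_)
  calc _ ≤ ∑ p ∈ s, ∑ q ∈ s, π / u * (α q * (α p * T p q) + α p * (α q * T q p)) := by
        refine Finset.sum_le_sum fun p hp => Finset.sum_le_sum fun q hq => ?_
        rw [norm_mul, norm_mul, RCLike.norm_conj, hcn, hcn, Complex.norm_real,
          Real.norm_of_nonneg (by positivity)]
        calc _ ≤ α p * α q * (π / u * (T p q + T q p)) := by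
              have := hα0 p; have := hα0 q
              have := hker p hp q hq
              gcongr
          _ = _ := by ring
    _ = π / u * (∑ p ∈ s, ∑ q ∈ s, α q * (α p * T p q) +
          ∑ p ∈ s, ∑ q ∈ s, α p * (α q * T q p)) := by
        rw [← Finset.sum_add_distrib, Finset.mul_sum]
        refine Finset.sum_congr rfl fun p _ => ?_
        rw [← Finset.sum_add_distrib, Finset.mul_sum]
    _ ≤ π / u * (A * (8 * A / σ) + A * (8 * A / σ)) := by gcongr
    _ = _ := by ring

/-- For |t| > T the kernel 1/(1 + t²) is at most twice the wider kernel with u = max(1, T), and the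
prime mean square against that kernel is smaller by a factor u ≥ T. This is the source of T^{-1/2}
once square roots are taken. -/
theorem integral_normSq_prime_sum_mul_le {a : ℕ → ℂ} {A : ℝ}
    (hA : ∀ z : ℝ, 2 ≤ z → ∑ p ∈ primesIoc 0 z, ‖a p‖ * Real.log p ≤ A * z) {s : Finset ℕ}
    (hs : ∀ p ∈ s, p.Prime) {σ T : ℝ} (h0 : 0 < σ) (h2 : σ ≤ 2) (hT : 0 < T) {H : ℝ → ℂ}
    {d₁ d₂ : ℝ} (hd₁ : 0 ≤ d₁) (hd₂ : 0 ≤ d₂) (hH₁ : ∀ t, |t| ≤ T → ‖H t‖ ≤ d₁)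
    (hH₂ : ∀ t, ‖H t‖ ≤ d₂) :
    ∫ t : ℝ, ‖(∑ p ∈ s, a p * (Real.log p : ℂ) *
      (p : ℂ) ^ (-(((1 + σ : ℝ) : ℂ) + t * Complex.I))) * H t‖ ^ 2 * ((1 + σ) ^ 2 + t ^ 2)⁻¹ ≤
        32 * π * A ^ 2 / σ * (d₁ + d₂ * T ^ (-(1 / 2) : ℝ)) ^ 2 := by
  set u := max 1 T with hu
  have hu1 : 1 ≤ u := le_max_left _ _
  obtain ⟨i1, e1⟩ := integral_normSq_prime_sum_le hA hs h0 h2 le_rfl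
  obtain ⟨i2, e2⟩ := integral_normSq_prime_sum_le hA hs h0 h2 hu1
  set F : ℝ → ℂ := fun t => ∑ p ∈ s, a p * (Real.log p : ℂ) *
      (p : ℂ) ^ (-(((1 + σ : ℝ) : ℂ) + t * Complex.I)) with hF
  have hpt : ∀ t : ℝ, ‖F t * H t‖ ^ 2 * ((1 + σ) ^ 2 + t ^ 2)⁻¹ ≤
      d₁ ^ 2 * (‖F t‖ ^ 2 * (1 ^ 2 + t ^ 2)⁻¹) +
        2 * d₂ ^ 2 * (‖F t‖ ^ 2 * (u ^ 2 + t ^ 2)⁻¹) := by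
    intro t
    have h3 : ((1 + σ) ^ 2 + t ^ 2)⁻¹ ≤ (1 ^ 2 + t ^ 2)⁻¹ := by
      apply inv_anti₀ (by positivity)
      nlinarith
    rw [norm_mul, mul_pow]
    rcases le_or_gt |t| T with ht | ht
    · have h4 := pow_le_pow_left₀ (norm_nonneg _) (hH₁ t ht) 2
      calc _ ≤ ‖F t‖ ^ 2 * d₁ ^ 2 * (1 ^ 2 + t ^ 2)⁻¹ := by gcongr
        _ = d₁ ^ 2 * (‖F t‖ ^ 2 * (1 ^ 2 + t ^ 2)⁻¹) + 0 := by ring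
        _ ≤ _ := by gcongr; positivity
    · have h4 := pow_le_pow_left₀ (norm_nonneg _) (hH₂ t) 2
      have h5 : (1 ^ 2 + t ^ 2)⁻¹ ≤ 2 * (u ^ 2 + t ^ 2)⁻¹ := by
        rw [inv_le_iff_one_le_mul₀ (by positivity), mul_assoc, ← div_eq_inv_mul, ← mul_div_assoc,
          le_div_iff₀ (by positivity)]
        have : u ^ 2 ≤ 1 + t ^ 2 := by
          rcases max_choice 1 T with h | h
          · rw [hu, h]; nlinarith [sq_nonneg t]
          · rw [hu, h, ← sq_abs t]
            nlinarith
        nlinarith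
      calc _ ≤ ‖F t‖ ^ 2 * d₂ ^ 2 * (2 * (u ^ 2 + t ^ 2)⁻¹) := by
            have := h3.trans h5
            gcongr
        _ = 0 + 2 * d₂ ^ 2 * (‖F t‖ ^ 2 * (u ^ 2 + t ^ 2)⁻¹) := by ring
        _ ≤ _ := by gcongr; positivity
  refine (integral_mono_of_nonneg (ae_of_all _ fun t => by positivity)
    ((i1.const_mul (d₁ ^ 2)).add (i2.const_mul (2 * d₂ ^ 2))) (ae_of_all _ hpt)).trans ?_
  simp only [Pi.add_apply]
  rw [integral_add (i1.const_mul _) (i2.const_mul _), integral_const_mul, integral_const_mul]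
  have hT2 : (T ^ (-(1 / 2) : ℝ)) ^ 2 = T⁻¹ := by
    rw [← Real.rpow_natCast, ← Real.rpow_mul hT.le]; norm_num
    exact Real.rpow_neg_one T
  have huT : u⁻¹ ≤ T⁻¹ := inv_anti₀ hT (le_max_right _ _)
  have hr0 : 0 ≤ T ^ (-(1 / 2) : ℝ) := by positivity
  have hB : 0 ≤ 16 * A ^ 2 / σ := by positivity
  calc _ ≤ d₁ ^ 2 * (π / 1 * (16 * A ^ 2 / σ)) + 2 * d₂ ^ 2 * (π / u * (16 * A ^ 2 / σ)) := by
        gcongr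
    _ = π * (16 * A ^ 2 / σ) * (d₁ ^ 2 + 2 * d₂ ^ 2 * u⁻¹) := by ring
    _ ≤ π * (16 * A ^ 2 / σ) * (2 * (d₁ + d₂ * T ^ (-(1 / 2) : ℝ)) ^ 2) := by
        gcongr
        have h6 : d₂ ^ 2 * u⁻¹ ≤ d₂ ^ 2 * (T ^ (-(1 / 2) : ℝ)) ^ 2 := by
          rw [hT2]; gcongr
        nlinarith [mul_nonneg hd₁ (mul_nonneg hd₂ hr0)]
    _ = _ := by ring

/-! ### Size of the truncated Dirichlet series to the right of the line Re s = 1 -/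

/-- The restriction of `g` to the primes up to `x`. -/
noncomputable def truncPrimes (g : ℕ → ℂ) (x : ℝ) (p : ℕ) : ℂ :=
  if p ∈ primesIoc 0 x then g p else 0

theorem truncPrimes_of_mem {g : ℕ → ℂ} {x : ℝ} {p : ℕ} (hp : p ∈ primesIoc 0 x) :
    truncPrimes g x p = g p := if_pos hp

theorem truncPrimes_of_notMem {g : ℕ → ℂ} {x : ℝ} {p : ℕ} (hp : p ∉ primesIoc 0 x) :
    truncPrimes g x p = 0 := if_neg hp

/-- The conditions on the values of `g` at the primes that enter the mean-value estimate. -/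
structure PrimeBounds (g : ℕ → ℂ) (δ A β A₄ c c₁ Y x : ℝ) : Prop where
  short : ∀ z y : ℝ, 2 ≤ z → z ^ (1 - δ) ≤ y → y ≤ z →
    ∑ p ∈ primesIoc (z - y) z, ‖g p‖ * Real.log p ≤ A * y
  upper : ∀ u v : ℝ, 2 ≤ u → u ≤ v →
    ∑ p ∈ primesIoc u v, ‖g p‖ / p ≤ β * Real.log (Real.log v / Real.log u) + A₄
  lower : ∀ w : ℝ, Y ≤ w → w ≤ x → -c₁ ≤ ∑ p ∈ primesIoc w x, (‖g p‖ - c) / p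
  pos : 0 < δ

namespace PrimeBounds

variable {g : ℕ → ℂ} {δ A β A₄ c c₁ Y x : ℝ}

theorem chebyshev (h : PrimeBounds g δ A β A₄ c c₁ Y x) (z : ℝ) (hz : 2 ≤ z) :
    ∑ p ∈ primesIoc 0 z, ‖g p‖ * Real.log p ≤ A * z := by
  have := h.short z z hz (by
    conv_rhs => rw [← Real.rpow_one z]
    exact Real.rpow_le_rpow_of_exponent_le (by linarith) (by linarith [h.pos])) le_rfl
  simpa using this

theorem const_nonneg (h : PrimeBounds g δ A β A₄ c c₁ Y x) : 0 ≤ A := by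
  have := h.chebyshev 2 le_rfl
  have h2 : 0 ≤ ∑ p ∈ primesIoc 0 2, ‖g p‖ * Real.log p :=
    Finset.sum_nonneg fun p _ => mul_nonneg (norm_nonneg _) (Real.log_natCast_nonneg p)
  linarith

/-- A shift by σ acts like a cut at w = exp(1/σ). Below w, p^{-σ} differs from 1 by at most σ log p;
above w, 1 ≤ σ log p. Chebyshev bounds the two errors by 24A and 8A. -/
theorem norm_cexp_le (h : PrimeBounds g δ A β A₄ c c₁ Y x) {σ : ℝ} (h0 : 0 < σ) (h1 : σ ≤ 1)
    (hx : Real.exp (1 / σ) ≤ x) (t : ℝ) :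
    ‖Complex.exp (∑ p ∈ primesIoc 0 x,
      g p * (p : ℂ) ^ (-(((1 + σ : ℝ) : ℂ) + t * Complex.I)))‖ ≤
    Real.exp (32 * A + ∑ p ∈ primesIoc 0 (Real.exp (1 / σ)),
      (g p * (p : ℂ) ^ (((-t : ℝ) : ℂ) * Complex.I)).re / p) := by
  set w := Real.exp (1 / σ) with hw
  have hw2 : 2 ≤ w := by
    have h3 : (1 : ℝ) ≤ 1 / σ := by rw [le_div_iff₀ h0]; linarith
    have := Real.add_one_le_exp (1 / σ)
    linarith
  have hlw : Real.log w = 1 / σ := Real.log_exp _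
  have hs : ∀ u v : ℝ, ∀ p ∈ primesIoc u v, p.Prime := fun u v p hp => (mem_primesIoc.1 hp).1
  rw [Complex.norm_exp, Complex.re_sum]
  apply Real.exp_le_exp.2
  set ρ : ℕ → ℝ := fun p => (g p * (p : ℂ) ^ (((-t : ℝ) : ℂ) * Complex.I)).re with hρ
  have hterm : ∀ p : ℕ, p.Prime → (g p * (p : ℂ) ^ (-(((1 + σ : ℝ) : ℂ) + t * Complex.I))).re =
      ρ p * (p : ℝ) ^ (-(1 + σ)) := by
    intro p hp
    have hp0 : (p : ℂ) ≠ 0 := by exact_mod_cast hp.ne_zero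
    have e : (p : ℂ) ^ (-(((1 + σ : ℝ) : ℂ) + t * Complex.I)) =
        (p : ℂ) ^ (((-t : ℝ) : ℂ) * Complex.I) * ((p : ℝ) ^ (-(1 + σ)) : ℝ) := by
      rw [Complex.ofReal_cpow (by positivity), ← Complex.ofReal_natCast,
        ← Complex.cpow_add _ _ (by simpa using hp0)]
      congr 1; push_cast; ring
    rw [e, ← mul_assoc, Complex.re_mul_ofReal]
  have hρle : ∀ p : ℕ, p.Prime → |ρ p| ≤ ‖g p‖ := by
    intro p hp
    refine (Complex.abs_re_le_norm _).trans ?_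
    rw [norm_mul, Complex.norm_natCast_cpow_of_pos hp.pos]
    simp
  rw [Finset.sum_congr rfl fun p hp => hterm p (hs _ _ p hp),
    sum_primesIoc_add (by linarith : (0 : ℝ) ≤ w) hx]
  have hlow : ∑ p ∈ primesIoc 0 w, ρ p * (p : ℝ) ^ (-(1 + σ)) ≤
      ∑ p ∈ primesIoc 0 w, ρ p / p + σ * ∑ p ∈ primesIoc 0 w, ‖g p‖ * Real.log p / p := by
    rw [Finset.mul_sum, ← Finset.sum_add_distrib]
    refine Finset.sum_le_sum fun p hp => ?_
    have hpp := hs _ _ p hp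
    have hp0 : (0 : ℝ) < p := by exact_mod_cast hpp.pos
    rw [neg_add, Real.rpow_add hp0, Real.rpow_neg_one]
    have e1 : 1 - σ * Real.log p ≤ (p : ℝ) ^ (-σ) := by
      rw [Real.rpow_def_of_pos hp0]
      have := Real.add_one_le_exp (Real.log p * -σ)
      linarith
    have e2 : (p : ℝ) ^ (-σ) ≤ 1 := Real.rpow_le_one_of_one_le_of_nonpos
      (by exact_mod_cast hpp.one_lt.le) (by linarith)
    have e3 : -ρ p * (1 - (p : ℝ) ^ (-σ)) ≤ ‖g p‖ * (σ * Real.log p) := by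
      have e4 : -ρ p ≤ ‖g p‖ := (neg_le_abs _).trans (hρle p hpp)
      calc _ ≤ ‖g p‖ * (1 - (p : ℝ) ^ (-σ)) := by
            apply mul_le_mul_of_nonneg_right e4; linarith
        _ ≤ _ := by
            apply mul_le_mul_of_nonneg_left _ (norm_nonneg _); linarith
    have h10 : 0 < (p : ℝ)⁻¹ := by positivity
    have e5 := mul_le_mul_of_nonneg_right e3 h10.le
    rw [div_eq_mul_inv, div_eq_mul_inv]
    nlinarith
  have hhigh : ∑ p ∈ primesIoc w x, ρ p * (p : ℝ) ^ (-(1 + σ)) ≤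
      σ * ∑ p ∈ primesIoc w x, ‖g p‖ * Real.log p * (p : ℝ) ^ (-(1 + σ)) := by
    rw [Finset.mul_sum]
    refine Finset.sum_le_sum fun p hp => ?_
    have hpp := hs _ _ p hp
    have hl : Real.log w ≤ Real.log p :=
      Real.log_le_log (by linarith) (mem_primesIoc.1 hp).2.1.le
    have h3 : 1 ≤ σ * Real.log p := by
      rw [hlw] at hl
      calc (1 : ℝ) = σ * (1 / σ) := by field_simp
        _ ≤ _ := by gcongr
    have h4 : ρ p ≤ ‖g p‖ := (le_abs_self _).trans (hρle p hpp)
    have h5 : ‖g p‖ ≤ σ * (‖g p‖ * Real.log p) := by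
      nlinarith [norm_nonneg (g p)]
    calc _ ≤ σ * (‖g p‖ * Real.log p) * (p : ℝ) ^ (-(1 + σ)) := by
          gcongr; exact h4.trans h5
      _ = _ := by ring
  have hB1 := sum_prime_log_div_le (fun p => norm_nonneg (g p)) h.chebyshev (hs 0 w) hw2
    (fun p hp => (mem_primesIoc.1 hp).2.2)
  have hB2 := sum_prime_log_mul_rpow_le (fun p => norm_nonneg (g p)) h.chebyshev (hs w x) h0
    (by linarith)
  have hC1 : σ * ∑ p ∈ primesIoc 0 w, ‖g p‖ * Real.log p / p ≤ 24 * A := by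
    calc _ ≤ σ * (24 * A * Real.log w) := by gcongr
      _ = _ := by rw [hlw]; field_simp
  have hC2 : σ * ∑ p ∈ primesIoc w x, ‖g p‖ * Real.log p * (p : ℝ) ^ (-(1 + σ)) ≤ 8 * A := by
    calc _ ≤ σ * (8 * A / σ) := by gcongr
      _ = _ := by field_simp
  linarith

/-- The primes in (exp(1/σ), x] are lost from the exponent. By the lower condition and Mertens they
carry at least c log(σ log x) - O(1) of the sum of |g(p)|/p, so this is a saving over the trivial
bound, valid for every t. -/
theorem norm_cexp_le_of_lower (h : PrimeBounds g δ A β A₄ c c₁ Y x) (hc : 0 ≤ c) {C : ℝ}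
    (hC : ∀ w x : ℝ, 2 ≤ w → w ≤ x →
      Real.log (Real.log x / Real.log w) - C ≤ ∑ p ∈ primesIoc w x, 1 / (p : ℝ))
    {σ : ℝ} (h0 : 0 < σ) (h1 : σ ≤ 1)
    (hx : Real.exp (1 / σ) ≤ x) (hY : Y ≤ Real.exp (1 / σ)) (t : ℝ) :
    ‖Complex.exp (∑ p ∈ primesIoc 0 x,
      g p * (p : ℂ) ^ (-(((1 + σ : ℝ) : ℂ) + t * Complex.I)))‖ ≤
    Real.exp (32 * A + c₁ + c * C) * Real.exp (∑ p ∈ primesIoc 0 x, ‖g p‖ / p) *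
      Real.exp (-(c * Real.log (σ * Real.log x))) := by
  refine (h.norm_cexp_le h0 h1 hx t).trans ?_
  rw [← Real.exp_add, ← Real.exp_add]
  apply Real.exp_le_exp.2
  set w := Real.exp (1 / σ) with hw
  have hw2 : 2 ≤ w := by
    have h3 : (1 : ℝ) ≤ 1 / σ := by rw [le_div_iff₀ h0]; linarith
    have := Real.add_one_le_exp (1 / σ)
    linarith
  have hlw : Real.log w = 1 / σ := Real.log_exp _
  have h2 : ∑ p ∈ primesIoc 0 w, (g p * (p : ℂ) ^ (((-t : ℝ) : ℂ) * Complex.I)).re / p ≤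
      ∑ p ∈ primesIoc 0 w, ‖g p‖ / p := by
    refine Finset.sum_le_sum fun p hp => ?_
    gcongr
    refine (Complex.re_le_norm _).trans ?_
    rw [norm_mul, Complex.norm_natCast_cpow_of_pos (mem_primesIoc.1 hp).1.pos]
    simp
  have h3 := h.lower w hY hx
  have h4 := hC w x hw2 hx
  have h5 := sum_primesIoc_add (by linarith : (0 : ℝ) ≤ w) hx (fun p => ‖g p‖ / p)
  have h6 : ∑ p ∈ primesIoc w x, (‖g p‖ - c) / p =
      ∑ p ∈ primesIoc w x, ‖g p‖ / p - c * ∑ p ∈ primesIoc w x, 1 / (p : ℝ) := by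
    rw [Finset.mul_sum, ← Finset.sum_sub_distrib]
    refine Finset.sum_congr rfl fun p _ => by ring
  rw [hlw, div_div_eq_mul_div, div_one, mul_comm (Real.log x)] at h4
  have h7 := mul_le_mul_of_nonneg_left h4 hc
  linarith

/-- Let R be the sum of |g(p)|/p over w < p ≤ x, with w = exp(1/σ). Cutting the twisted sum at w can
lose 2R of the saving l, but the main sum has then also been cut at w and has shrunk by R. The net
loss R is at most β log(σ log x) + A₄. -/
theorem norm_cexp_le_of_twist (h : PrimeBounds g δ A β A₄ c c₁ Y x) {σ : ℝ} (h0 : 0 < σ)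
    (h1 : σ ≤ 1) (hx : Real.exp (1 / σ) ≤ x) (hY0 : 0 ≤ Y) (hY : Y ≤ Real.exp (1 / σ)) {t l : ℝ}
    (hl : l ≤ ∑ p ∈ primesIoc Y x,
      (‖g p‖ - (g p * (p : ℂ) ^ (((-t : ℝ) : ℂ) * Complex.I)).re) / p) :
    ‖Complex.exp (∑ p ∈ primesIoc 0 x,
      g p * (p : ℂ) ^ (-(((1 + σ : ℝ) : ℂ) + t * Complex.I)))‖ ≤
    Real.exp (32 * A + A₄) * Real.exp (∑ p ∈ primesIoc 0 x, ‖g p‖ / p) *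
      Real.exp (-l + β * Real.log (σ * Real.log x)) := by
  refine (h.norm_cexp_le h0 h1 hx t).trans ?_
  rw [← Real.exp_add, ← Real.exp_add]
  apply Real.exp_le_exp.2
  set w := Real.exp (1 / σ) with hw
  have hw2 : 2 ≤ w := by
    have h3 : (1 : ℝ) ≤ 1 / σ := by rw [le_div_iff₀ h0]; linarith
    have := Real.add_one_le_exp (1 / σ)
    linarith
  have hlw : Real.log w = 1 / σ := Real.log_exp _
  set ρ : ℕ → ℝ := fun p => (g p * (p : ℂ) ^ (((-t : ℝ) : ℂ) * Complex.I)).re with hρ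
  have hρle : ∀ p : ℕ, p.Prime → |ρ p| ≤ ‖g p‖ := by
    intro p hp
    refine (Complex.abs_re_le_norm _).trans ?_
    rw [norm_mul, Complex.norm_natCast_cpow_of_pos hp.pos]
    simp
  have h2 : ∑ p ∈ primesIoc 0 Y, ρ p / p ≤ ∑ p ∈ primesIoc 0 Y, ‖g p‖ / p := by
    refine Finset.sum_le_sum fun p hp => ?_
    gcongr
    exact (le_abs_self _).trans (hρle p (mem_primesIoc.1 hp).1)
  have h3 : ∑ p ∈ primesIoc w x, (‖g p‖ - ρ p) / p ≤
      ∑ p ∈ primesIoc w x, (‖g p‖ / p + ‖g p‖ / p) := by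
    refine Finset.sum_le_sum fun p hp => ?_
    rw [← add_div]
    gcongr
    linarith [(neg_le_abs _).trans (hρle p (mem_primesIoc.1 hp).1)]
  rw [Finset.sum_add_distrib] at h3
  have h4 := h.upper w x hw2 hx
  rw [hlw, div_div_eq_mul_div, div_one, mul_comm (Real.log x)] at h4
  have hadd := fun f => sum_primesIoc_add (by linarith : (0 : ℝ) ≤ w) hx f
  have hadd' := fun f => sum_primesIoc_add hY0 hY f
  have h5 := hadd fun p => ‖g p‖ / p
  have h6 := hadd' fun p => ‖g p‖ / p
  have h7 := hadd' fun p => ρ p / p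
  have h8 := sum_primesIoc_add hY hx fun p => (‖g p‖ - ρ p) / p
  have h9 : ∑ p ∈ primesIoc Y w, (‖g p‖ - ρ p) / p =
      ∑ p ∈ primesIoc Y w, ‖g p‖ / p - ∑ p ∈ primesIoc Y w, ρ p / p := by
    rw [← Finset.sum_sub_distrib]
    refine Finset.sum_congr rfl fun p _ => by ring
  change _ + ∑ p ∈ primesIoc 0 w, ρ p / p ≤ _
  change l ≤ ∑ p ∈ primesIoc Y x, (‖g p‖ - ρ p) / p at hl
  linarith

end PrimeBounds

/-! ### The mean of the log-weighted partial sums -/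

theorem measurable_partialSum (f : ℕ → ℂ) : Measurable (partialSum f) :=
  (measurable_of_countable fun N : ℕ => ∑ n ∈ Finset.Icc 1 N, f n).comp Nat.measurable_floor

theorem norm_partialSum_le (f : ℕ → ℂ) {v X : ℝ} (hv : v ≤ X) :
    ‖partialSum f v‖ ≤ ∑ n ∈ Finset.Icc 1 ⌊X⌋₊, ‖f n‖ := by
  refine (norm_sum_le _ _).trans (Finset.sum_le_sum_of_subset_of_nonneg ?_ fun _ _ _ =>
    norm_nonneg _)
  exact Finset.Icc_subset_Icc_right (Nat.floor_mono hv)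

theorem integrableOn_norm_partialSum_mul (f : ℕ → ℂ) {k : ℝ → ℝ} {X₁ X : ℝ}
    (hk : IntegrableOn k (Set.Ioc X₁ X)) :
    IntegrableOn (fun v => ‖partialSum f v‖ * k v) (Set.Ioc X₁ X) := by
  refine Integrable.bdd_mul (c := ∑ n ∈ Finset.Icc 1 ⌊X⌋₊, ‖f n‖) hk
    (measurable_partialSum f).norm.aestronglyMeasurable ?_
  filter_upwards [ae_restrict_mem measurableSet_Ioc] with v hv
  rw [norm_norm]
  exact norm_partialSum_le f hv.2

theorem integrableOn_Ioc_of_continuousOn {k : ℝ → ℝ} {X₁ X : ℝ}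
    (hk : ContinuousOn k (Set.Icc X₁ X)) : IntegrableOn k (Set.Ioc X₁ X) :=
  (hk.integrableOn_Icc).mono_set Set.Ioc_subset_Icc_self

theorem continuousOn_inv_sq_mul_log {X₁ X : ℝ} (h : 1 < X₁) :
    ContinuousOn (fun v : ℝ => (v ^ 2 * Real.log v)⁻¹) (Set.Icc X₁ X) := by
  refine ContinuousOn.inv₀ ?_ fun v hv => ?_
  · refine ContinuousOn.mul (by fun_prop) (Real.continuousOn_log.mono fun v hv => ?_)
    have : 0 < v := by linarith [hv.1]
    exact this.ne'
  · have h1 : 1 < v := by linarith [hv.1]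
    have := Real.log_pos h1
    positivity

theorem hasSum_expMult_log_cpow (g : ℕ → ℂ) (x : ℝ) (s : ℂ) :
    HasSum (fun n : ℕ => expMult (truncPrimes g x) n * (Real.log n : ℂ) * (n : ℂ) ^ s)
      ((∑ p ∈ primesIoc 0 x, g p * (Real.log p : ℂ) * (p : ℂ) ^ s) *
        Complex.exp (∑ p ∈ primesIoc 0 x, g p * (p : ℂ) ^ s)) ∧
    Summable (fun n : ℕ => ‖expMult (truncPrimes g x) n * (n : ℂ) ^ s‖ * Real.log n) := by
  have hs : ∀ p ∈ primesIoc 0 x, p.Prime := fun p hp => (mem_primesIoc.1 hp).1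
  have ha : ∀ p, p.Prime → p ∉ primesIoc 0 x → truncPrimes g x p * (p : ℂ) ^ s = 0 :=
    fun p _ hp => by rw [truncPrimes_of_notMem hp, zero_mul]
  constructor
  · have := hasSum_expMult_mul_log hs ha
    convert! this using 1
    · funext n
      rw [← expMult_mul_cpow]; ring
    · congr 1
      · refine Finset.sum_congr rfl fun p hp => ?_
        rw [truncPrimes_of_mem hp]; ring
      · congr 1
        refine Finset.sum_congr rfl fun p hp => ?_
        rw [truncPrimes_of_mem hp]
  · have := summable_norm_expMult_mul_log hs ha
    simpa only [← expMult_mul_cpow] using this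

/-- On e^{l/2} < v ≤ e^l with σ = 1/l, log v is of size l and v^{-2σ} is bounded below by e^{-2}.
Cauchy–Schwarz then combines the Plancherel bound O(l D²) with ∫ dv/v = l/2, and the weight 1/log v
removes the factor l. -/
theorem integral_log_partialSum_block_le {g : ℕ → ℂ} {A x l T d₁ d₂ : ℝ}
    (hA : ∀ z : ℝ, 2 ≤ z → ∑ p ∈ primesIoc 0 z, ‖g p‖ * Real.log p ≤ A * z)
    (hl : 1 ≤ l) (hT : 0 < T) (hd₁ : 0 ≤ d₁) (hd₂ : 0 < d₂)
    (hH₁ : ∀ t : ℝ, |t| ≤ T → ‖Complex.exp (∑ p ∈ primesIoc 0 x,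
      g p * (p : ℂ) ^ (-(((1 + 1 / l : ℝ) : ℂ) + t * Complex.I)))‖ ≤ d₁)
    (hH₂ : ∀ t : ℝ, ‖Complex.exp (∑ p ∈ primesIoc 0 x,
      g p * (p : ℂ) ^ (-(((1 + 1 / l : ℝ) : ℂ) + t * Complex.I)))‖ ≤ d₂) :
    ∫ v in Set.Ioc (Real.exp (l / 2)) (Real.exp l),
      ‖partialSum (fun n => expMult (truncPrimes g x) n * (Real.log n : ℂ)) v‖ *
        (v ^ 2 * Real.log v)⁻¹ ≤
      (16 * Real.exp 2 * A ^ 2 + 1) * (d₁ + d₂ * T ^ (-(1 / 2) : ℝ)) := by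
  have hl0 : 0 < l := by linarith
  set σ := 1 / l with hσ
  have hσ0 : 0 < σ := by positivity
  have hσ1 : σ ≤ 1 := by rw [hσ, div_le_one hl0]; exact hl
  set D := d₁ + d₂ * T ^ (-(1 / 2) : ℝ) with hD
  have hD0 : 0 < D := by
    have : 0 < T ^ (-(1 / 2) : ℝ) := by positivity
    positivity
  have hs : ∀ p ∈ primesIoc 0 x, p.Prime := fun p hp => (mem_primesIoc.1 hp).1
  set b : ℕ → ℂ := fun n => expMult (truncPrimes g x) n * (Real.log n : ℂ) with hb
  have hu : 0 < 1 + σ := by linarith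
  obtain ⟨i1, e1⟩ := integral_normSq_partialSum_le hu (b := b) (by simp [hb]) (by
      refine (hasSum_expMult_log_cpow g x (((-(1 + σ) : ℝ)) : ℂ)).2.congr fun n => ?_
      simp only [hb]
      rcases Nat.eq_zero_or_pos n with rfl | hn
      · simp
      rw [norm_mul, norm_mul, Complex.norm_natCast_cpow_of_pos hn, Complex.ofReal_re,
        Complex.norm_real, Real.norm_of_nonneg (Real.log_natCast_nonneg n)]
      ring)
    (fun t => (hasSum_expMult_log_cpow g x (-(((1 + σ : ℝ) : ℂ) + t * Complex.I))).1)
    (Real.exp l)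
  have e2 := integral_normSq_prime_sum_mul_le hA hs hσ0 (by linarith) hT hd₁ hd₂.le hH₁ hH₂
  have e3 : ∫ v in Set.Ioc 1 (Real.exp l), ‖partialSum b v‖ ^ 2 * v ^ (-2 * (1 + σ) - 1) ≤
      16 * A ^ 2 * l * D ^ 2 := by
    refine e1.trans ((mul_le_mul_of_nonneg_left e2 (by positivity)).trans (le_of_eq ?_))
    rw [← hD, hσ]
    field_simp
    ring
  have hexp1 : 1 ≤ Real.exp (l / 2) := Real.one_le_exp (by positivity)
  have hexp1' : 1 < Real.exp (l / 2) := Real.one_lt_exp_iff.2 (by positivity)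
  have hsub : Set.Ioc (Real.exp (l / 2)) (Real.exp l) ⊆ Set.Ioc 1 (Real.exp l) :=
    Set.Ioc_subset_Ioc_left hexp1
  have e4 : ∫ v in Set.Ioc (Real.exp (l / 2)) (Real.exp l),
      ‖partialSum b v‖ ^ 2 * v ^ (-2 * (1 + σ) - 1) ≤ 16 * A ^ 2 * l * D ^ 2 := by
    refine le_trans (setIntegral_mono_set i1 ?_ hsub.eventuallyLE) e3
    filter_upwards [ae_restrict_mem measurableSet_Ioc] with v hv
    have : (0 : ℝ) < v := by linarith [hv.1]
    simp only [Pi.zero_apply]; positivity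
  have i5 : IntegrableOn (fun v : ℝ => v⁻¹) (Set.Ioc (Real.exp (l / 2)) (Real.exp l)) := by
    refine integrableOn_Ioc_of_continuousOn (ContinuousOn.inv₀ continuousOn_id fun v hv => ?_)
    have : (0 : ℝ) < v := by linarith [hv.1]
    exact this.ne'
  have e5 : ∫ v in Set.Ioc (Real.exp (l / 2)) (Real.exp l), v⁻¹ = l / 2 := by
    rw [← intervalIntegral.integral_of_le (Real.exp_le_exp.2 (by linarith)),
      integral_inv_of_pos (Real.exp_pos _) (Real.exp_pos _), ← Real.exp_sub, Real.log_exp]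
    ring
  have i1' := i1.mono_set hsub
  calc _ ≤ ∫ v in Set.Ioc (Real.exp (l / 2)) (Real.exp l),
        (Real.exp 2 / (l * D) * (‖partialSum b v‖ ^ 2 * v ^ (-2 * (1 + σ) - 1)) +
          D / l * v⁻¹) := by
        refine setIntegral_mono_on (integrableOn_norm_partialSum_mul _
          (integrableOn_Ioc_of_continuousOn (continuousOn_inv_sq_mul_log hexp1')))
          ((i1'.const_mul _).add (i5.const_mul _)) measurableSet_Ioc fun v hv => ?_
        have hv1 : 1 < v := lt_of_lt_of_le hexp1' hv.1.le
        have hv0 : 0 < v := by linarith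
        set m := ‖partialSum b v‖ with hm
        have hm0 : 0 ≤ m := norm_nonneg _
        have hlog : l / 2 ≤ Real.log v := by
          rw [← Real.log_exp (l / 2)]; exact Real.log_le_log (Real.exp_pos _) hv.1.le
        have hlog2 : Real.log v ≤ l := by
          rw [← Real.log_exp l]; exact Real.log_le_log hv0 hv.2
        have f1 : (v ^ 2 * Real.log v)⁻¹ ≤ 2 / l * (v⁻¹) ^ 2 := by
          rw [mul_inv, mul_comm, inv_pow]
          gcongr
          rw [← inv_div]
          exact inv_anti₀ (by positivity) hlog
        have f2 : (v⁻¹) ^ 3 ≤ Real.exp 2 * v ^ (-2 * (1 + σ) - 1) := by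
          have : v ^ (-2 * (1 + σ) - 1) = (v⁻¹) ^ 3 * v ^ (-2 * σ) := by
            rw [show -2 * (1 + σ) - 1 = -3 + -2 * σ by ring, Real.rpow_add hv0, inv_pow,
              ← Real.rpow_natCast, ← Real.rpow_neg hv0.le]
            norm_num
          rw [this]
          have f3 : 1 ≤ Real.exp 2 * v ^ (-2 * σ) := by
            rw [Real.rpow_def_of_pos hv0, ← Real.exp_add]
            apply Real.one_le_exp
            have : Real.log v * σ ≤ 1 := by
              rw [hσ, mul_one_div, div_le_one hl0]; exact hlog2
            linarith
          calc (v⁻¹) ^ 3 = (v⁻¹) ^ 3 * 1 := (mul_one _).symm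
            _ ≤ (v⁻¹) ^ 3 * (Real.exp 2 * v ^ (-2 * σ)) := by gcongr
            _ = _ := by ring
        -- Cauchy–Schwarz in pointwise form: the arithmetic-geometric mean inequality with the
        -- balancing weight D.
        have f4 : 2 * (m * (v⁻¹) ^ 2) ≤ D⁻¹ * (m ^ 2 * (v⁻¹) ^ 3) + D * v⁻¹ := by
          have f5 : D⁻¹ * (m ^ 2 * (v⁻¹) ^ 3) + D * v⁻¹ - 2 * (m * (v⁻¹) ^ 2) =
              v⁻¹ * D⁻¹ * (m * v⁻¹ - D) ^ 2 := by field_simp; ring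
          have : 0 ≤ v⁻¹ * D⁻¹ * (m * v⁻¹ - D) ^ 2 := by positivity
          linarith
        calc m * (v ^ 2 * Real.log v)⁻¹ ≤ m * (2 / l * (v⁻¹) ^ 2) := by gcongr
          _ = 1 / l * (2 * (m * (v⁻¹) ^ 2)) := by ring
          _ ≤ 1 / l * (D⁻¹ * (m ^ 2 * (Real.exp 2 * v ^ (-2 * (1 + σ) - 1))) + D * v⁻¹) := by
              refine mul_le_mul_of_nonneg_left (f4.trans ?_) (by positivity)
              gcongr
          _ = _ := by field_simp
    _ = Real.exp 2 / (l * D) * (∫ v in Set.Ioc (Real.exp (l / 2)) (Real.exp l),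
          ‖partialSum b v‖ ^ 2 * v ^ (-2 * (1 + σ) - 1)) + D / l * (l / 2) := by
        rw [integral_add (i1'.const_mul _) (i5.const_mul _), integral_const_mul,
          integral_const_mul, e5]
    _ ≤ Real.exp 2 / (l * D) * (16 * A ^ 2 * l * D ^ 2) + D / l * (l / 2) := by gcongr
    _ = (16 * Real.exp 2 * A ^ 2 + 1 / 2) * D := by field_simp
    _ ≤ _ := by gcongr; norm_num

/-- The range is cut at the points exp(L/2^j) with L = log x, so that σ log x = 2^j on the j-th
block. For |t| ≤ T both bounds on the series are available and their minimum sums to exp(-lc/(c+β));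
for other t the decaying bound alone has a bounded sum, multiplied by T^{-1/2}. -/
theorem exists_integral_log_partialSum_le {β c : ℝ} (hβ : 0 < β) (hc : 0 < c) (δ A A₄ c₁ : ℝ) :
    ∃ K : ℝ, 0 < K ∧ ∀ (g : ℕ → ℂ) (Y Y₁ x T l : ℝ), PrimeBounds g δ A β A₄ c c₁ Y x →
      0 ≤ Y → Y ≤ Y₁ → Real.exp 1 ≤ Y₁ → Y₁ ≤ x → 0 < T → 0 ≤ l →
      (∀ t : ℝ, |t| ≤ T → l ≤ ∑ p ∈ primesIoc Y x,
        (‖g p‖ - (g p * (p : ℂ) ^ ((t : ℂ) * Complex.I)).re) / p) →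
      ∫ v in Set.Ioc Y₁ x,
        ‖partialSum (fun n => expMult (truncPrimes g x) n * (Real.log n : ℂ)) v‖ *
          (v ^ 2 * Real.log v)⁻¹ ≤
        K * Real.exp (∑ p ∈ primesIoc 0 x, ‖g p‖ / p) *
          (Real.exp (-(l * c / (c + β))) + T ^ (-(1 / 2) : ℝ)) := by
  obtain ⟨C, hC0, hC⟩ := exists_le_sum_prime_inv_Ioc
  obtain ⟨C', hC'0, hC'⟩ := exists_sum_min_geometric_le hβ hc
  set K₀ := Real.exp (32 * A + c₁ + c * C) + Real.exp (32 * A + A₄) with hK₀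
  have hK₀pos : 0 < K₀ := by positivity
  refine ⟨(16 * Real.exp 2 * A ^ 2 + 1) * K₀ * C', by positivity, ?_⟩
  intro g Y Y₁ x T l h hY0 hY hY₁ hx hT hl htw
  set P := Real.exp (∑ p ∈ primesIoc 0 x, ‖g p‖ / p) with hP
  have hP0 : 0 < P := Real.exp_pos _
  have hY₁0 : 0 < Y₁ := (Real.exp_pos 1).trans_le hY₁
  have hlogY : 1 ≤ Real.log Y₁ := by
    rw [← Real.log_exp 1]; exact Real.log_le_log (Real.exp_pos _) hY₁
  set L := Real.log x with hL
  have hLY : Real.log Y₁ ≤ L := Real.log_le_log hY₁0 hx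
  have hL0 : 0 < L := by linarith
  have hl2 : 0 < Real.log 2 := Real.log_pos (by norm_num)
  have hexpL : Real.exp L = x := Real.exp_log (by linarith)
  set e₁ : ℕ → ℝ := fun j => min (Real.exp (-l + β * (j * Real.log 2)))
        (Real.exp (-(c * (j * Real.log 2)))) with he₁
  set e₂ : ℕ → ℝ := fun j => Real.exp (-(c * (j * Real.log 2))) with he₂
  set r := T ^ (-(1 / 2) : ℝ) with hr
  have hr0 : 0 < r := by positivity
  set f : ℝ → ℝ := fun v =>
    ‖partialSum (fun n => expMult (truncPrimes g x) n * (Real.log n : ℂ)) v‖ *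
          (v ^ 2 * Real.log v)⁻¹ with hf
  have hblock : ∀ j : ℕ, Real.log Y₁ ≤ L / 2 ^ j →
      ∫ v in Set.Ioc (Real.exp (L / 2 ^ (j + 1))) (Real.exp (L / 2 ^ j)), f v ≤
      (16 * Real.exp 2 * A ^ 2 + 1) * (K₀ * P * e₁ j + K₀ * P * e₂ j * r) := by
    intro j hj
    set m := L / 2 ^ j with hm
    have hm1 : 1 ≤ m := hlogY.trans hj
    have hm0 : 0 < m := by linarith
    have h2 : L / 2 ^ (j + 1) = m / 2 := by rw [hm, pow_succ]; field_simp
    rw [h2]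
    have hσ0 : 0 < 1 / m := by positivity
    have hσ1 : 1 / m ≤ 1 := by rw [div_le_one hm0]; exact hm1
    have hxm : Real.exp (1 / (1 / m)) ≤ x := by
      rw [one_div_one_div, ← hexpL]
      apply Real.exp_le_exp.2
      rw [hm]
      exact div_le_self hL0.le (one_le_pow₀ (by norm_num))
    have hYm : Y ≤ Real.exp (1 / (1 / m)) := by
      rw [one_div_one_div]
      refine hY.trans ?_
      rw [← Real.exp_log hY₁0]
      exact Real.exp_le_exp.2 hj
    have hlog : Real.log (1 / m * Real.log x) = j * Real.log 2 := by
      rw [← hL, hm, ← Real.log_pow]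
      congr 1
      field_simp
    have hlow : ∀ t : ℝ, ‖Complex.exp (∑ p ∈ primesIoc 0 x,
        g p * (p : ℂ) ^ (-(((1 + 1 / m : ℝ) : ℂ) + t * Complex.I)))‖ ≤ K₀ * P * e₂ j := by
      intro t
      have := h.norm_cexp_le_of_lower hc.le hC hσ0 hσ1 hxm hYm t
      rw [hlog] at this
      refine this.trans ?_
      simp only [he₂]
      gcongr
      rw [hK₀]
      linarith [Real.exp_pos (32 * A + A₄)]
    refine integral_log_partialSum_block_le h.chebyshev hm1 hT (by positivity) (by positivity)
      (fun t ht => ?_) hlow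
    -- The exponent in p^{-(1+σ+it)} twists by -t; the range |t| ≤ T is symmetric.
    have h3 := h.norm_cexp_le_of_twist hσ0 hσ1 hxm hY0 hYm (htw (-t) (by rwa [abs_neg]))
    rw [hlog] at h3
    have h4 : ‖Complex.exp (∑ p ∈ primesIoc 0 x,
        g p * (p : ℂ) ^ (-(((1 + 1 / m : ℝ) : ℂ) + t * Complex.I)))‖ ≤
        K₀ * P * Real.exp (-l + β * (j * Real.log 2)) := by
      refine h3.trans ?_
      gcongr
      rw [hK₀]
      linarith [Real.exp_pos (32 * A + c₁ + c * C)]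
    simp only [he₁]
    rcases min_choice (Real.exp (-l + β * (j * Real.log 2)))
      (Real.exp (-(c * (j * Real.log 2)))) with h5 | h5
    · rw [h5]; exact h4
    · rw [h5]; exact hlow t
  have hexN : ∃ N : ℕ, L / 2 ^ N ≤ Real.log Y₁ := by
    obtain ⟨N, hN⟩ := pow_unbounded_of_one_lt L (one_lt_two)
    refine ⟨N, ?_⟩
    rw [div_le_iff₀ (by positivity)]
    have : (0 : ℝ) < 2 ^ N := by positivity
    nlinarith
  classical
  -- The first scale at or below Y₁. Every block used has its upper end at least Y₁, as required by
  -- Y ≤ exp(1/σ) and σ ≤ 1.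
  set N := Nat.find hexN with hN
  have hN1 : L / 2 ^ N ≤ Real.log Y₁ := Nat.find_spec hexN
  have hN2 : ∀ j < N, Real.log Y₁ ≤ L / 2 ^ j := fun j hj => (not_le.1 (Nat.find_min hexN hj)).le
  have hf0 : ∀ v, 1 ≤ v → 0 ≤ f v := fun v hv => by
    have := Real.log_nonneg hv
    simp only [hf]; positivity
  have hint : ∀ a b : ℝ, 0 < a → IntegrableOn f (Set.Ioc (Real.exp a) b) := fun a b ha =>
    integrableOn_norm_partialSum_mul _ (integrableOn_Ioc_of_continuousOn
      (continuousOn_inv_sq_mul_log (Real.one_lt_exp_iff.2 ha)))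
  have hsum : ∀ M ≤ N, ∫ v in Set.Ioc (Real.exp (L / 2 ^ M)) x, f v ≤
      ∑ j ∈ Finset.range M, (16 * Real.exp 2 * A ^ 2 + 1) *
        (K₀ * P * e₁ j + K₀ * P * e₂ j * r) := by
    intro M
    induction M with
    | zero => intro _; simp [hexpL]
    | succ M ih =>
      intro hM
      have h6 : Real.exp (L / 2 ^ (M + 1)) ≤ Real.exp (L / 2 ^ M) := by
        apply Real.exp_le_exp.2
        exact div_le_div_of_nonneg_left hL0.le (by positivity)
          (pow_le_pow_right₀ (by norm_num) (by omega))
      have h7 : Real.exp (L / 2 ^ M) ≤ x := by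
        conv_rhs => rw [← hexpL]
        exact Real.exp_le_exp.2 (div_le_self hL0.le (one_le_pow₀ (by norm_num)))
      rw [← Set.Ioc_union_Ioc_eq_Ioc h6 h7, setIntegral_union (Set.Ioc_disjoint_Ioc_of_le le_rfl)
        measurableSet_Ioc (hint _ _ (by positivity)) (hint _ _ (by positivity)),
        Finset.sum_range_succ, add_comm]
      exact add_le_add (ih (by omega)) (hblock M (hN2 M (by omega)))
  have hmono : ∫ v in Set.Ioc Y₁ x, f v ≤ ∫ v in Set.Ioc (Real.exp (L / 2 ^ N)) x, f v := by
    refine setIntegral_mono_set (hint _ _ (by positivity)) ?_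
      (Set.Ioc_subset_Ioc_left ?_).eventuallyLE
    · filter_upwards [ae_restrict_mem measurableSet_Ioc] with v hv
      exact hf0 v ((Real.one_le_exp (by positivity)).trans hv.1.le)
    · rw [← Real.exp_log hY₁0]
      exact Real.exp_le_exp.2 hN1
  refine hmono.trans ((hsum N le_rfl).trans ?_)
  have hg1 := hC' l hl N
  -- For l = 0 the minimum is always the decaying term, so the same lemma bounds the sum of e₂.
  have hg2 := hC' 0 le_rfl N
  have hg3 : ∑ j ∈ Finset.range N, e₂ j ≤ C' := by
    refine le_trans (le_of_eq ?_) (hg2.trans (le_of_eq (by simp)))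
    refine Finset.sum_congr rfl fun j _ => ?_
    rw [min_eq_right]
    apply Real.exp_le_exp.2
    have : 0 ≤ (j : ℝ) * Real.log 2 := by positivity
    nlinarith [mul_nonneg hβ.le this, mul_nonneg hc.le this]
  rw [← Finset.mul_sum, Finset.sum_add_distrib, ← Finset.mul_sum, ← Finset.sum_mul,
    ← Finset.mul_sum]
  calc _ ≤ (16 * Real.exp 2 * A ^ 2 + 1) *
        (K₀ * P * (C' * Real.exp (-(l * c / (c + β)))) + K₀ * P * C' * r) := by gcongr
    _ = _ := by ring

/-! ### Removing the logarithm by partial summation -/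

theorem integrableOn_inv_Ioc {X₁ X : ℝ} (h : 0 < X₁) :
    IntegrableOn (fun v : ℝ => v⁻¹) (Set.Ioc X₁ X) :=
  integrableOn_Ioc_of_continuousOn (ContinuousOn.inv₀ continuousOn_id fun v hv => by
    have : (0 : ℝ) < v := by linarith [hv.1]
    exact this.ne')

theorem integrableOn_inv_sq_Ioc {X₁ X : ℝ} (h : 0 < X₁) :
    IntegrableOn (fun v : ℝ => (v ^ 2)⁻¹) (Set.Ioc X₁ X) :=
  integrableOn_Ioc_of_continuousOn (ContinuousOn.inv₀ (by fun_prop) fun v hv => by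
    have : (0 : ℝ) < v := by linarith [hv.1]
    positivity)

/-- Partial summation against the logarithm. -/
theorem log_mul_partialSum_eq (f : ArithmeticFunction ℂ) (v : ℝ) (hv : 1 ≤ v) :
    (Real.log v : ℂ) * partialSum f v = partialSum (fun n => f n * (Real.log n : ℂ)) v +
      ∫ w in Set.Ioc 1 v, ((w⁻¹ : ℝ) : ℂ) * partialSum f w := by
  have hd : ∀ t ∈ Set.Icc 1 v, HasDerivAt (fun y : ℝ => ((Real.log y : ℝ) : ℂ)) ((t⁻¹ : ℝ) : ℂ) t :=
    fun t ht => (Real.hasDerivAt_log (by linarith [ht.1])).ofReal_comp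
  have h := sum_mul_eq_sub_integral_mul₀ (f := fun y : ℝ => ((Real.log y : ℝ) : ℂ)) (c := f)
    (by simp) v (fun t ht => (hd t ht).differentiableAt) (by
      refine (ContinuousOn.integrableOn_Icc (f := fun t : ℝ => ((t⁻¹ : ℝ) : ℂ)) ?_).congr_fun
        (fun t ht => ((hd t ht).deriv).symm) measurableSet_Icc
      refine Complex.continuous_ofReal.comp_continuousOn
        (ContinuousOn.inv₀ continuousOn_id fun t ht => ?_)
      have : (0 : ℝ) < t := by linarith [ht.1]
      exact this.ne')
  have hz : ∀ F : ℕ → ℂ, F 0 = 0 → ∀ N : ℕ, ∑ k ∈ Finset.Icc 0 N, F k =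
      ∑ k ∈ Finset.Icc 1 N, F k := by
    intro F hF N
    rw [← Finset.add_sum_Ioc_eq_sum_Icc (Nat.zero_le N), hF, zero_add]
    rfl
  rw [hz _ (by simp), hz _ (by simp)] at h
  have h2 : ∫ t in Set.Ioc 1 v, deriv (fun y : ℝ => ((Real.log y : ℝ) : ℂ)) t *
      ∑ k ∈ Finset.Icc 0 ⌊t⌋₊, f k = ∫ w in Set.Ioc 1 v, ((w⁻¹ : ℝ) : ℂ) * partialSum f w := by
    refine setIntegral_congr_fun measurableSet_Ioc fun t ht => ?_
    rw [(hd t ⟨ht.1.le, ht.2⟩).deriv, hz _ (by simp)]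
    rfl
  rw [h2] at h
  have h3 : partialSum (fun n => f n * (Real.log n : ℂ)) v =
      ∑ k ∈ Finset.Icc 1 ⌊v⌋₊, ((Real.log k : ℝ) : ℂ) * f k :=
    Finset.sum_congr rfl fun k _ => mul_comm _ _
  rw [h3, h]
  unfold partialSum
  ring

theorem log_mul_norm_partialSum_le (f : ArithmeticFunction ℂ) (v : ℝ) (hv : 1 ≤ v) :
    Real.log v * ‖partialSum f v‖ ≤ ‖partialSum (fun n => f n * (Real.log n : ℂ)) v‖ +
      ∫ w in Set.Ioc 1 v, ‖partialSum f w‖ * w⁻¹ := by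
  have h := congrArg norm (log_mul_partialSum_eq f v hv)
  rw [norm_mul, Complex.norm_real, Real.norm_of_nonneg (Real.log_nonneg hv)] at h
  rw [h]
  refine (norm_add_le _ _).trans ?_
  gcongr
  refine (norm_integral_le_integral_norm _).trans (le_of_eq ?_)
  refine setIntegral_congr_fun measurableSet_Ioc fun w hw => ?_
  have : 0 < w := by linarith [hw.1]
  rw [norm_mul, Complex.norm_real, Real.norm_of_nonneg (by positivity), mul_comm]

/-- After |S(v)| is replaced by the sum of |f(n)| over n ≤ v, partial summation evaluates the
integral, and the boundary term has a favourable sign. -/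
theorem integral_norm_partialSum_le (f : ArithmeticFunction ℂ) (X : ℝ) (hX : 1 ≤ X) :
    ∫ v in Set.Ioc 1 X, ‖partialSum f v‖ * (v ^ 2)⁻¹ ≤ ∑ n ∈ Finset.Icc 1 ⌊X⌋₊, ‖f n‖ / n := by
  have hd : ∀ t ∈ Set.Icc 1 X, HasDerivAt (fun y : ℝ => y⁻¹) (-(t ^ 2)⁻¹) t :=
    fun t ht => hasDerivAt_inv (by linarith [ht.1])
  have hz : ∀ F : ℕ → ℝ, F 0 = 0 → ∀ N : ℕ, ∑ k ∈ Finset.Icc 0 N, F k =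
      ∑ k ∈ Finset.Icc 1 N, F k := by
    intro F hF N
    rw [← Finset.add_sum_Ioc_eq_sum_Icc (Nat.zero_le N), hF, zero_add]
    rfl
  have h := sum_mul_eq_sub_integral_mul₀ (𝕜 := ℝ) (f := fun y : ℝ => y⁻¹) (c := fun n => ‖f n‖)
    (by simp) X (fun t ht => (hd t ht).differentiableAt) (by
      refine (ContinuousOn.integrableOn_Icc (f := fun t : ℝ => -(t ^ 2)⁻¹) ?_).congr_fun
        (fun t ht => ((hd t ht).deriv).symm) measurableSet_Icc
      refine ContinuousOn.neg (ContinuousOn.inv₀ (by fun_prop) fun t ht => ?_)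
      have : (0 : ℝ) < t := by linarith [ht.1]
      positivity)
  have h2 : ∫ t in Set.Ioc 1 X, deriv (fun y : ℝ => y⁻¹) t * ∑ k ∈ Finset.Icc 0 ⌊t⌋₊, ‖f k‖ =
      -∫ t in Set.Ioc 1 X, (∑ k ∈ Finset.Icc 1 ⌊t⌋₊, ‖f k‖) * (t ^ 2)⁻¹ := by
    rw [← integral_neg]
    refine setIntegral_congr_fun measurableSet_Ioc fun t ht => ?_
    rw [(hd t ⟨ht.1.le, ht.2⟩).deriv, hz _ (by simp)]
    ring
  rw [h2, sub_neg_eq_add, hz _ (by simp), hz _ (by simp)] at h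
  have h3 : ∑ n ∈ Finset.Icc 1 ⌊X⌋₊, ‖f n‖ / n = ∑ k ∈ Finset.Icc 1 ⌊X⌋₊, (k : ℝ)⁻¹ * ‖f k‖ :=
    Finset.sum_congr rfl fun k _ => by ring
  rw [h3, h]
  have h4 : 0 ≤ X⁻¹ * ∑ k ∈ Finset.Icc 1 ⌊X⌋₊, ‖f k‖ := by positivity
  have h5 : ∫ v in Set.Ioc 1 X, ‖partialSum f v‖ * (v ^ 2)⁻¹ ≤
      ∫ t in Set.Ioc 1 X, (∑ k ∈ Finset.Icc 1 ⌊t⌋₊, ‖f k‖) * (t ^ 2)⁻¹ := by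
    refine setIntegral_mono_on (integrableOn_norm_partialSum_mul _
      (integrableOn_inv_sq_Ioc one_pos)) ?_ measurableSet_Ioc fun v hv => ?_
    · refine (integrableOn_norm_partialSum_mul (fun n => ((‖f n‖ : ℝ) : ℂ))
        (integrableOn_inv_sq_Ioc one_pos)).congr_fun (fun t _ => ?_) measurableSet_Ioc
      simp only [partialSum]
      rw [← Complex.ofReal_sum, Complex.norm_real, Real.norm_of_nonneg (by positivity)]
    · gcongr
      exact norm_sum_le _ _
  linarith

/-- Interchanging the order of integration over a triangle. -/
theorem integral_integral_mul_inv_sq_le {φ : ℝ → ℝ} {X : ℝ} (hφ0 : ∀ w, 1 < w → 0 ≤ φ w)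
    (hφ : IntegrableOn φ (Set.Ioc 1 X)) :
    IntegrableOn (fun v : ℝ => (∫ w in Set.Ioc 1 v, φ w) * (v ^ 2)⁻¹) (Set.Ioc 1 X) ∧
    ∫ v in Set.Ioc 1 X, (∫ w in Set.Ioc 1 v, φ w) * (v ^ 2)⁻¹ ≤
      ∫ w in Set.Ioc 1 X, φ w * w⁻¹ := by
  set μ := (volume : Measure ℝ).restrict (Set.Ioc 1 X) with hμ
  -- The integrand on the triangle w ≤ v. With w fixed, integrating v^{-2} over v ≥ w leaves 1/w.
  set Ψ : ℝ → ℝ → ℝ := fun v w => Set.indicator {q : ℝ × ℝ | q.2 ≤ q.1}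
    (fun q => (q.1 ^ 2)⁻¹ * φ q.2) (v, w) with hΨ
  have hint : Integrable (Function.uncurry Ψ) (μ.prod μ) := by
    have h1 : Integrable (fun q : ℝ × ℝ => (q.1 ^ 2)⁻¹ * φ q.2) (μ.prod μ) :=
      Integrable.mul_prod (f := fun v : ℝ => (v ^ 2)⁻¹) (integrableOn_inv_sq_Ioc one_pos) hφ
    exact h1.indicator (measurableSet_le measurable_snd measurable_fst)
  have hL : ∀ v ∈ Set.Ioc 1 X, ∫ w, Ψ v w ∂μ = (∫ w in Set.Ioc 1 v, φ w) * (v ^ 2)⁻¹ := by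
    intro v hv
    have h2 : ∀ w, Ψ v w = (Set.Iic v).indicator (fun w => (v ^ 2)⁻¹ * φ w) w := by
      intro w
      simp only [hΨ, Set.indicator_apply, Set.mem_ofPred_eq, Set.mem_Iic]
    simp only [h2]
    rw [integral_indicator measurableSet_Iic, hμ, Measure.restrict_restrict measurableSet_Iic,
      integral_const_mul, mul_comm]
    congr 3
    ext w
    simp only [Set.mem_inter_iff, Set.mem_Iic, Set.mem_Ioc]
    exact ⟨fun ⟨h3, h4⟩ => ⟨h4.1, h3⟩, fun ⟨h3, h4⟩ => ⟨h4, h3, h4.trans hv.2⟩⟩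
  constructor
  · refine IntegrableOn.congr_fun (f := fun v => ∫ w, Ψ v w ∂μ) ?_ hL measurableSet_Ioc
    exact hint.integral_prod_left
  · rw [← setIntegral_congr_fun measurableSet_Ioc hL]
    change ∫ v, ∫ w, Ψ v w ∂μ ∂μ ≤ _
    rw [integral_integral_swap hint]
    refine setIntegral_mono_on hint.integral_prod_right ?_ measurableSet_Ioc fun w hw => ?_
    · refine Integrable.mono' hφ (hφ.aestronglyMeasurable.mul
        (integrableOn_inv_Ioc one_pos).aestronglyMeasurable) ?_
      filter_upwards [ae_restrict_mem measurableSet_Ioc] with w hw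
      have h3 := hφ0 w hw.1
      have h4 : 0 < w := by linarith [hw.1]
      rw [Real.norm_of_nonneg (by positivity)]
      exact mul_le_of_le_one_right h3 (inv_le_one_of_one_le₀ hw.1.le)
    · have hw0 : 0 < w := by linarith [hw.1]
      have h2 : ∀ v, Ψ v w = φ w * (Set.Ici w).indicator (fun v => (v ^ 2)⁻¹) v := by
        intro v
        simp only [hΨ, Set.indicator_apply, Set.mem_ofPred_eq, Set.mem_Ici]
        split_ifs <;> ring
      simp only [h2]
      rw [integral_const_mul]
      refine mul_le_mul_of_nonneg_left ?_ (hφ0 w hw.1)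
      rw [integral_indicator measurableSet_Ici, hμ, Measure.restrict_restrict measurableSet_Ici]
      have h5 : Set.EqOn (fun t : ℝ => t ^ (-2 : ℝ)) (fun v => (v ^ 2)⁻¹) (Set.Ici w) := by
        intro v hv
        have : 0 < v := hw0.trans_le hv
        simp only
        rw [Real.rpow_neg this.le]
        norm_num
      have h6 : IntegrableOn (fun v : ℝ => (v ^ 2)⁻¹) (Set.Ici w) := by
        refine IntegrableOn.congr_fun ?_ h5 measurableSet_Ici
        rw [integrableOn_Ici_iff_integrableOn_Ioi]
        exact integrableOn_Ioi_rpow_of_lt (by norm_num) hw0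
      calc _ ≤ ∫ v in Set.Ici w, (v ^ 2)⁻¹ :=
            setIntegral_mono_set h6 (ae_of_all _ fun v => by simp only [Pi.zero_apply]; positivity)
              Set.inter_subset_left.eventuallyLE
        _ = w⁻¹ := by
            rw [← setIntegral_congr_fun measurableSet_Ici h5, integral_Ici_eq_integral_Ioi,
              integral_Ioi_rpow_of_lt (by norm_num) hw0]
            norm_num [Real.rpow_neg_one]

/-- The absorption step: the mean of `|S(v)|` is controlled by the mean of the log-weighted sums. -/
theorem integral_norm_partialSum_le_of_log (f : ArithmeticFunction ℂ) {Y X : ℝ}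
    (hY : Real.exp 2 ≤ Y) (hX : Y ≤ X) :
    ∫ v in Set.Ioc 1 X, ‖partialSum f v‖ * (v ^ 2)⁻¹ ≤
      2 * (∑ n ∈ Finset.Icc 1 ⌊Y⌋₊, ‖f n‖ / n +
        ∫ v in Set.Ioc Y X, ‖partialSum (fun n => f n * (Real.log n : ℂ)) v‖ *
          (v ^ 2 * Real.log v)⁻¹) := by
  have he : (1 : ℝ) < Real.exp 2 := Real.one_lt_exp_iff.2 (by norm_num)
  have hY1 : 1 < Y := he.trans_le hY
  have hY0 : 0 < Y := by linarith
  have hiS : ∀ a b : ℝ, 0 < a →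
      IntegrableOn (fun v => ‖partialSum f v‖ * (v ^ 2)⁻¹) (Set.Ioc a b) := fun a b ha =>
    integrableOn_norm_partialSum_mul _ (integrableOn_inv_sq_Ioc ha)
  have hiM := integrableOn_norm_partialSum_mul (fun n => f n * (Real.log n : ℂ))
    (integrableOn_Ioc_of_continuousOn (continuousOn_inv_sq_mul_log (X := X) hY1))
  obtain ⟨hiV, hV⟩ := integral_integral_mul_inv_sq_le (φ := fun w => ‖partialSum f w‖ * w⁻¹)
    (X := X) (fun w hw => by have : 0 < w := by linarith
                             positivity)
    (integrableOn_norm_partialSum_mul _ (integrableOn_inv_Ioc one_pos))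
  have hV' : ∫ w in Set.Ioc 1 X, ‖partialSum f w‖ * w⁻¹ * w⁻¹ =
      ∫ v in Set.Ioc 1 X, ‖partialSum f v‖ * (v ^ 2)⁻¹ := by
    congr 1; funext w; rw [mul_assoc, ← mul_inv, sq]
  rw [hV'] at hV
  have hV0 : ∀ v : ℝ, 0 ≤ ∫ w in Set.Ioc 1 v, ‖partialSum f w‖ * w⁻¹ := fun v =>
    setIntegral_nonneg measurableSet_Ioc fun w hw => by
      have : 0 < w := by linarith [hw.1]
      positivity
  have hsubset : Set.Ioc Y X ⊆ Set.Ioc 1 X := Set.Ioc_subset_Ioc_left hY1.le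
  -- Dividing by log v ≥ 2, which holds since v > Y ≥ e², lets the iterated integral return with
  -- coefficient 1/2. After the interchange it is at most the left side of the lemma, and is
  -- absorbed there.
  have hhalf : ∫ v in Set.Ioc Y X, ‖partialSum f v‖ * (v ^ 2)⁻¹ ≤
      (∫ v in Set.Ioc Y X, ‖partialSum (fun n => f n * (Real.log n : ℂ)) v‖ *
          (v ^ 2 * Real.log v)⁻¹) +
        1 / 2 * ∫ v in Set.Ioc 1 X, (∫ w in Set.Ioc 1 v, ‖partialSum f w‖ * w⁻¹) * (v ^ 2)⁻¹ := by
    have h1 : ∫ v in Set.Ioc Y X, (∫ w in Set.Ioc 1 v, ‖partialSum f w‖ * w⁻¹) * (v ^ 2)⁻¹ ≤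
        ∫ v in Set.Ioc 1 X, (∫ w in Set.Ioc 1 v, ‖partialSum f w‖ * w⁻¹) * (v ^ 2)⁻¹ :=
      setIntegral_mono_set hiV (ae_of_all _ fun v => mul_nonneg (hV0 v) (by positivity))
        hsubset.eventuallyLE
    have h2 := mul_le_mul_of_nonneg_left h1 (show (0 : ℝ) ≤ 1 / 2 by norm_num)
    refine le_trans ?_ (add_le_add_right h2 _)
    rw [← integral_const_mul, ← integral_add hiM ((hiV.mono_set hsubset).const_mul _)]
    refine setIntegral_mono_on (hiS _ _ hY0)
      (hiM.add ((hiV.mono_set hsubset).const_mul _)) measurableSet_Ioc fun v hv => ?_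
    have hv1 : 1 < v := hY1.trans hv.1
    have hv0 : 0 < v := by linarith
    have hlog : 2 ≤ Real.log v := by
      rw [← Real.log_exp 2]
      exact Real.log_le_log (Real.exp_pos _) (hY.trans hv.1.le)
    have h3 := log_mul_norm_partialSum_le f v hv1.le
    have hl0 : 0 < Real.log v := by linarith
    have hr : (Real.log v)⁻¹ ≤ 1 / 2 := by rw [one_div]; exact inv_anti₀ (by norm_num) hlog
    set m := ‖partialSum (fun n => f n * (Real.log n : ℂ)) v‖
    set I := ∫ w in Set.Ioc 1 v, ‖partialSum f w‖ * w⁻¹ with hI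
    have hI0 : 0 ≤ I := hV0 v
    calc ‖partialSum f v‖ * (v ^ 2)⁻¹ =
          (Real.log v * ‖partialSum f v‖) * ((v ^ 2)⁻¹ * (Real.log v)⁻¹) := by field_simp
      _ ≤ (m + I) * ((v ^ 2)⁻¹ * (Real.log v)⁻¹) := by gcongr
      _ = m * (v ^ 2 * Real.log v)⁻¹ + (Real.log v)⁻¹ * (I * (v ^ 2)⁻¹) := by
          rw [mul_inv]; ring
      _ ≤ _ := by gcongr
  have hsplit : ∫ v in Set.Ioc 1 X, ‖partialSum f v‖ * (v ^ 2)⁻¹ =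
      (∫ v in Set.Ioc 1 Y, ‖partialSum f v‖ * (v ^ 2)⁻¹) +
        ∫ v in Set.Ioc Y X, ‖partialSum f v‖ * (v ^ 2)⁻¹ := by
    rw [← Set.Ioc_union_Ioc_eq_Ioc hY1.le hX, setIntegral_union
      (Set.Ioc_disjoint_Ioc_of_le le_rfl) measurableSet_Ioc (hiS _ _ one_pos) (hiS _ _ hY0)]
  have h4 := integral_norm_partialSum_le f Y hY1.le
  linarith

/-! ### Lower bound for the error factor -/

theorem norm_integral_natCast_cpow_le {p : ℕ} (hp : 1 < p) :
    ‖∫ t in (0 : ℝ)..1, (p : ℂ) ^ ((t : ℂ) * Complex.I)‖ ≤ 2 / Real.log p := by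
  have hl : 0 < Real.log p := Real.log_pos (by exact_mod_cast hp)
  have hp0 : (p : ℂ) ≠ 0 := by exact_mod_cast (by omega : p ≠ 0)
  have hlc : Complex.log (p : ℂ) = (Real.log p : ℝ) := by
    rw [← Complex.ofReal_natCast, ← Complex.ofReal_log (Nat.cast_nonneg p)]
  have h1 : ∀ t : ℝ, (p : ℂ) ^ ((t : ℂ) * Complex.I) =
      Complex.exp (((Real.log p : ℝ) * Complex.I) * t) := by
    intro t
    rw [Complex.cpow_def_of_ne_zero hp0, hlc]
    congr 1; ring
  have hne : ((Real.log p : ℝ) : ℂ) * Complex.I ≠ 0 :=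
    mul_ne_zero (by exact_mod_cast hl.ne') Complex.I_ne_zero
  simp only [h1]
  rw [integral_exp_mul_complex hne, norm_div, norm_mul, Complex.norm_I, mul_one,
    Complex.norm_real, Real.norm_of_nonneg hl.le]
  gcongr
  refine (norm_sub_le _ _).trans ?_
  rw [show ((Real.log p : ℝ) : ℂ) * Complex.I * ((1 : ℝ) : ℂ) = ((Real.log p : ℝ) : ℂ) * Complex.I by
    simp, Complex.norm_exp_ofReal_mul_I]
  norm_num

namespace PrimeBounds

variable {g : ℕ → ℂ} {δ A β A₄ c c₁ Y x : ℝ}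

/-- A minimum is at most an average. Over 0 ≤ t ≤ 1 the oscillation of p^{it} leaves O(1/log p), and
the sum of |g(p)|/(p log p) is bounded by Chebyshev. -/
theorem le_sum_of_le_twist (h : PrimeBounds g δ A β A₄ c c₁ Y x) {l : ℝ}
    (hl : ∀ t : ℝ, |t| ≤ 1 → l ≤ ∑ p ∈ primesIoc Y x,
        (‖g p‖ - (g p * (p : ℂ) ^ ((t : ℂ) * Complex.I)).re) / p) :
    l ≤ ∑ p ∈ primesIoc Y x, ‖g p‖ / p + 12 * A * ∑' k : ℕ, 1 / (k : ℝ) ^ 2 := by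
  have hs : ∀ p ∈ primesIoc Y x, p.Prime := fun p hp => (mem_primesIoc.1 hp).1
  have hcont : ∀ p ∈ primesIoc Y x, Continuous fun t : ℝ => (p : ℂ) ^ ((t : ℂ) * Complex.I) := by
    intro p hp
    refine Continuous.const_cpow (by fun_prop) (Or.inl ?_)
    exact_mod_cast (hs p hp).ne_zero
  have hcont2 : ∀ p ∈ primesIoc Y x, Continuous fun t : ℝ =>
      (‖g p‖ - (g p * (p : ℂ) ^ ((t : ℂ) * Complex.I)).re) / p := fun p hp =>
    (continuous_const.sub (Complex.continuous_re.comp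
      (continuous_const.mul (hcont p hp)))).div_const _
  have h1 : l ≤ ∫ t in (0 : ℝ)..1, ∑ p ∈ primesIoc Y x,
        (‖g p‖ - (g p * (p : ℂ) ^ ((t : ℂ) * Complex.I)).re) / p := by
    have := intervalIntegral.integral_mono_on (μ := volume) (a := 0) (b := 1) (f := fun _ => l)
      (by norm_num) intervalIntegrable_const ((continuous_finsetSum _ hcont2).intervalIntegrable 0 1)
      (fun t ht => hl t (by rw [abs_of_nonneg ht.1]; exact ht.2))
    simpa using this
  rw [intervalIntegral.integral_finsetSum fun p hp => (hcont2 p hp).intervalIntegrable 0 1] at h1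
  have h2 : ∀ p ∈ primesIoc Y x, ∫ t in (0 : ℝ)..1,
        (‖g p‖ - (g p * (p : ℂ) ^ ((t : ℂ) * Complex.I)).re) / p ≤
      ‖g p‖ / p + 2 * (‖g p‖ / (p * Real.log p)) := by
    intro p hp
    have hp0 : (0 : ℝ) < p := by exact_mod_cast (hs p hp).pos
    have hi : IntervalIntegrable (fun t : ℝ => g p * (p : ℂ) ^ ((t : ℂ) * Complex.I)) volume 0 1 :=
      (continuous_const.mul (hcont p hp)).intervalIntegrable 0 1
    have hire : IntervalIntegrable (fun t : ℝ => (g p * (p : ℂ) ^ ((t : ℂ) * Complex.I)).re)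
        volume 0 1 :=
      (Complex.continuous_re.comp (continuous_const.mul (hcont p hp))).intervalIntegrable 0 1
    rw [intervalIntegral.integral_div, intervalIntegral.integral_sub intervalIntegrable_const hire]
    have h3 : ∫ t in (0 : ℝ)..1, (g p * (p : ℂ) ^ ((t : ℂ) * Complex.I)).re =
        (g p * ∫ t in (0 : ℝ)..1, (p : ℂ) ^ ((t : ℂ) * Complex.I)).re := by
      rw [← intervalIntegral.integral_const_mul]
      exact Complex.reCLM.intervalIntegral_comp_comm hi
    rw [h3]
    have h4 : -(g p * ∫ t in (0 : ℝ)..1, (p : ℂ) ^ ((t : ℂ) * Complex.I)).re ≤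
        ‖g p‖ * (2 / Real.log p) := by
      refine (neg_le_abs _).trans ((Complex.abs_re_le_norm _).trans ?_)
      rw [norm_mul]
      gcongr
      exact norm_integral_natCast_cpow_le (hs p hp).one_lt
    have h5 : 2 * (‖g p‖ / (p * Real.log p)) = ‖g p‖ * (2 / Real.log p) / p := by
      have : 0 < Real.log p := Real.log_pos (by exact_mod_cast (hs p hp).one_lt)
      field_simp
    rw [h5, ← add_div]
    gcongr
    simp only [intervalIntegral.integral_const, sub_zero, smul_eq_mul, one_mul]
    linarith
  have h6 := h1.trans (Finset.sum_le_sum h2)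
  rw [Finset.sum_add_distrib, ← Finset.mul_sum] at h6
  have h7 := sum_prime_div_log_le (fun p => norm_nonneg (g p)) h.chebyshev hs
  linarith

/-- Makes the smallest primes harmless. The threshold 8 exceeds e², which is what the absorption
step requires of its starting point. -/
theorem sum_le_of_le_eight (h : PrimeBounds g δ A β A₄ c c₁ Y x) {s : Finset ℕ}
    (hs : ∀ p ∈ s, p.Prime) (hs8 : ∀ p ∈ s, (p : ℝ) ≤ 8) :
    ∑ p ∈ s, ‖g p‖ / p ≤ 144 * A := by
  have h1 := sum_prime_log_div_le (fun p => norm_nonneg (g p)) h.chebyshev hs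
    (by norm_num : (2 : ℝ) ≤ 8) hs8
  have h2 : Real.log 8 = 3 * Real.log 2 := by
    rw [show (8 : ℝ) = 2 ^ 3 by norm_num, Real.log_pow]; norm_num
  have hl2 : 0 < Real.log 2 := Real.log_pos (by norm_num)
  have h3 : Real.log 2 * ∑ p ∈ s, ‖g p‖ / p ≤ ∑ p ∈ s, ‖g p‖ * Real.log p / p := by
    rw [Finset.mul_sum]
    refine Finset.sum_le_sum fun p hp => ?_
    have : Real.log 2 ≤ Real.log p :=
      Real.log_le_log (by norm_num) (by exact_mod_cast (hs p hp).two_le)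
    rw [mul_comm, div_mul_eq_mul_div]
    gcongr
  rw [h2] at h1
  have h4 := h.const_nonneg
  have h5 : Real.log 2 * ∑ p ∈ s, ‖g p‖ / p ≤ Real.log 2 * (72 * A) := by
    refine (h3.trans h1).trans (le_of_eq (by ring))
  have := le_of_mul_le_mul_left h5 hl2
  linarith

theorem sum_le_log (h : PrimeBounds g δ A β A₄ c c₁ Y x) (hβ : 0 ≤ β) (hA₄ : 0 ≤ A₄)
    (hx : 1 ≤ x) :
    ∑ p ∈ primesIoc Y x, ‖g p‖ / p ≤ β * Real.log (1 + Real.log x) + (144 * A + β + A₄) := by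
  have hA := h.const_nonneg
  have hlx : 0 ≤ Real.log x := Real.log_nonneg hx
  have hll : 0 ≤ Real.log (1 + Real.log x) := Real.log_nonneg (by linarith)
  rcases le_or_gt x 2 with h2 | h2
  · have := h.sum_le_of_le_eight (s := primesIoc Y x) (fun p hp => (mem_primesIoc.1 hp).1)
      (fun p hp => by linarith [(mem_primesIoc.1 hp).2.2])
    have := mul_nonneg hβ hll
    linarith
  · have h3 : ∑ p ∈ primesIoc Y x, ‖g p‖ / p ≤ ∑ p ∈ primesIoc 0 x, ‖g p‖ / p := by
      refine Finset.sum_le_sum_of_subset_of_nonneg (fun p hp => ?_) fun p _ _ => by positivity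
      have h4 := mem_primesIoc.1 hp
      exact mem_primesIoc.2 ⟨h4.1, by exact_mod_cast h4.1.pos, h4.2.2⟩
    rw [sum_primesIoc_add (by norm_num : (0 : ℝ) ≤ 2) h2.le] at h3
    have h5 := h.sum_le_of_le_eight (s := primesIoc 0 2) (fun p hp => (mem_primesIoc.1 hp).1)
      (fun p hp => by linarith [(mem_primesIoc.1 hp).2.2])
    have h6 := h.upper 2 x le_rfl h2.le
    have hl2 : 0.69 < Real.log 2 := by linarith [Real.log_two_gt_d9]
    have hlx0 : 0 < Real.log x := Real.log_pos (by linarith)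
    have h7 : Real.log (Real.log x / Real.log 2) ≤ Real.log (1 + Real.log x) + 1 := by
      have h8 : Real.log x / Real.log 2 ≤ (1 + Real.log x) * Real.exp 1 := by
        rw [div_le_iff₀ (by linarith)]
        have := Real.add_one_le_exp (1 : ℝ)
        have h9 : 1 ≤ Real.exp 1 * Real.log 2 := by nlinarith
        nlinarith
      have := Real.log_le_log (by positivity) h8
      rwa [Real.log_mul (by positivity) (Real.exp_pos 1).ne', Real.log_exp] at this
    have h10 := mul_le_mul_of_nonneg_left h7 hβ
    linarith

end PrimeBounds

theorem one_le_rpow_neg_half {T : ℝ} (hT : 0 < T) (hT1 : T < 1) : 1 ≤ T ^ (-(1 / 2) : ℝ) :=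
  Real.one_le_rpow_of_pos_of_le_one_of_nonpos hT hT1.le (by norm_num)

/-- The error factor is at least a fixed negative power of the logarithm. -/
theorem PrimeBounds.rpow_le_error {g : ℕ → ℂ} {δ A β A₄ c c₁ Y x : ℝ}
    (h : PrimeBounds g δ A β A₄ c c₁ Y x) (hβ : 0 < β) (hc : 0 < c) (hA₄ : 0 ≤ A₄)
    (hx : 1 ≤ x) {T l : ℝ} (hT : 0 < T)
    (htw : ∀ t : ℝ, |t| ≤ T → l ≤ ∑ p ∈ primesIoc Y x,
        (‖g p‖ - (g p * (p : ℂ) ^ ((t : ℂ) * Complex.I)).re) / p) :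
    (1 + Real.log x) ^ (-(c * β / (c + β))) ≤
      Real.exp (144 * A + β + A₄ + 12 * A * ∑' k : ℕ, 1 / (k : ℝ) ^ 2) *
        (Real.exp (-(l * c / (c + β))) + T ^ (-(1 / 2) : ℝ)) := by
  have hA := h.const_nonneg
  have hlx : 0 ≤ Real.log x := Real.log_nonneg hx
  set C := 144 * A + β + A₄ + 12 * A * ∑' k : ℕ, 1 / (k : ℝ) ^ 2 with hC
  have hC0 : 0 ≤ C := by
    have : 0 ≤ ∑' k : ℕ, 1 / (k : ℝ) ^ 2 := tsum_nonneg fun k => by positivity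
    positivity
  have hr : 0 ≤ T ^ (-(1 / 2) : ℝ) := by positivity
  -- The average over [0, 1] is available only for T ≥ 1; for T < 1 the term T^{-1/2} alone is at
  -- least 1.
  rcases lt_or_ge T 1 with hT1 | hT1
  · have h1 := one_le_rpow_neg_half hT hT1
    have h2 : (1 + Real.log x) ^ (-(c * β / (c + β))) ≤ 1 :=
      Real.rpow_le_one_of_one_le_of_nonpos (by linarith) (by
        have : 0 ≤ c * β / (c + β) := by positivity
        linarith)
    have h3 : 1 ≤ Real.exp C := Real.one_le_exp hC0
    have h4 := Real.exp_pos (-(l * c / (c + β)))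
    nlinarith
  · have h1 := h.le_sum_of_le_twist (fun t ht => htw t (ht.trans hT1))
    have h2 := h.sum_le_log hβ.le hA₄ hx
    have h3 : l ≤ β * Real.log (1 + Real.log x) + C := by linarith
    have h4 : (1 + Real.log x) ^ (-(c * β / (c + β))) ≤
        Real.exp C * Real.exp (-(l * c / (c + β))) := by
      rw [Real.rpow_def_of_pos (by linarith), ← Real.exp_add]
      apply Real.exp_le_exp.2
      set κ := c / (c + β) with hκ
      have hκ0 : 0 ≤ κ := by positivity
      have hκ1 : κ ≤ 1 := by rw [hκ, div_le_one (by positivity)]; linarith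
      rw [show c * β / (c + β) = β * κ by rw [hκ]; ring, show l * c / (c + β) = l * κ by
        rw [hκ]; ring]
      nlinarith [mul_le_mul_of_nonneg_right h3 hκ0, mul_le_mul_of_nonneg_left hκ1 hC0]
    refine h4.trans ?_
    gcongr
    linarith

/-! ### The mean of the partial sums -/

/-- An integer n ≤ V has no prime factor above V, so truncating at V instead of x changes nothing,
and nonnegativity allows the sum to be completed to the full Euler product. -/
theorem sum_norm_expMult_div_le (g : ℕ → ℂ) {V x : ℝ} (hV : V ≤ x) :
    ∑ n ∈ Finset.Icc 1 ⌊V⌋₊, ‖expMult (truncPrimes g x) n‖ / n ≤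
      Real.exp (∑ p ∈ primesIoc 0 V, ‖g p‖ / p) := by
  have hs : ∀ p ∈ primesIoc 0 V, p.Prime := fun p hp => (mem_primesIoc.1 hp).1
  have h1 := hasSum_norm_expMult (a := fun p => truncPrimes g V p * (p : ℂ) ^ (-1 : ℂ)) hs
    (fun p _ hp => by rw [truncPrimes_of_notMem hp, zero_mul])
  have h2 : ∑ p ∈ primesIoc 0 V, ‖truncPrimes g V p * (p : ℂ) ^ (-1 : ℂ)‖ =
      ∑ p ∈ primesIoc 0 V, ‖g p‖ / p := by
    refine Finset.sum_congr rfl fun p hp => ?_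
    rw [truncPrimes_of_mem hp, norm_mul, Complex.cpow_neg_one, norm_inv, Complex.norm_natCast]
    rfl
  rw [h2] at h1
  refine le_trans (le_of_eq ?_) (sum_le_hasSum (Finset.Icc 1 ⌊V⌋₊) (fun _ _ => norm_nonneg _) h1)
  refine Finset.sum_congr rfl fun n hn => ?_
  obtain ⟨hn1, hn2⟩ := Finset.mem_Icc.1 hn
  rw [← expMult_mul_cpow, norm_mul, Complex.cpow_neg_one, norm_inv, Complex.norm_natCast,
    div_eq_mul_inv]
  congr 2
  refine expMult_congr fun p hp => ?_
  have hpp := Nat.prime_of_mem_primeFactors hp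
  have hpn : (p : ℝ) ≤ V := by
    have h3 : p ≤ ⌊V⌋₊ := (Nat.le_of_dvd hn1 (Nat.dvd_of_mem_primeFactors hp)).trans hn2
    exact (Nat.le_floor_iff' hpp.ne_zero).1 h3
  have hp0 : (0 : ℝ) < p := by exact_mod_cast hpp.pos
  rw [truncPrimes_of_mem (mem_primesIoc.2 ⟨hpp, hp0, hpn.trans hV⟩),
    truncPrimes_of_mem (mem_primesIoc.2 ⟨hpp, hp0, hpn⟩)]

theorem norm_partialSum_expMult_le (g : ℕ → ℂ) {u x : ℝ} (hu0 : 0 ≤ u) (hu : u ≤ x) :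
    ‖partialSum (expMult (truncPrimes g x)) u‖ ≤
      u * Real.exp (∑ p ∈ primesIoc 0 x, ‖g p‖ / p) := by
  have h1 := sum_norm_expMult_div_le g (le_refl x)
  calc _ ≤ ∑ n ∈ Finset.Icc 1 ⌊u⌋₊, ‖expMult (truncPrimes g x) n‖ := norm_sum_le _ _
    _ ≤ ∑ n ∈ Finset.Icc 1 ⌊u⌋₊, u * (‖expMult (truncPrimes g x) n‖ / n) := by
        refine Finset.sum_le_sum fun n hn => ?_
        obtain ⟨hn1, hn2⟩ := Finset.mem_Icc.1 hn
        have hn0 : (0 : ℝ) < n := by exact_mod_cast hn1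
        have : (n : ℝ) ≤ u := (Nat.le_floor_iff hu0).1 hn2
        rw [mul_div_assoc', le_div_iff₀ hn0, mul_comm]
        gcongr
    _ ≤ ∑ n ∈ Finset.Icc 1 ⌊x⌋₊, u * (‖expMult (truncPrimes g x) n‖ / n) := by
        refine Finset.sum_le_sum_of_subset_of_nonneg
          (Finset.Icc_subset_Icc_right (Nat.floor_mono hu)) fun _ _ _ => by positivity
    _ = u * ∑ n ∈ Finset.Icc 1 ⌊x⌋₊, ‖expMult (truncPrimes g x) n‖ / n := by rw [Finset.mul_sum]
    _ ≤ _ := by gcongr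

/-- Besides the log-weighted integral, absorption leaves an initial segment of size exp(∑_{p ≤ Y₁}
|g(p)|/p). For T ≥ 1 this is O(P e^{-l}), because l is at most the sum of |g(p)|/p over Y < p ≤ x
plus O(1), and c/(c+β) ≤ 1. For T < 1 the error factor exceeds 1 and nothing is needed. -/
theorem exists_integral_norm_partialSum_le {β c : ℝ} (hβ : 0 < β) (hc : 0 < c) (δ : ℝ) {A A₄ : ℝ}
    (hA : 0 ≤ A) (c₁ : ℝ) :
    ∃ K : ℝ, 0 < K ∧ ∀ (g : ℕ → ℂ) (Y x T l : ℝ), PrimeBounds g δ A β A₄ c c₁ Y x →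
      0 ≤ Y → Y ≤ x → 8 ≤ x → 0 < T → 0 ≤ l →
      (∀ t : ℝ, |t| ≤ T → l ≤ ∑ p ∈ primesIoc Y x,
        (‖g p‖ - (g p * (p : ℂ) ^ ((t : ℂ) * Complex.I)).re) / p) →
      ∫ v in Set.Ioc 1 x, ‖partialSum (expMult (truncPrimes g x)) v‖ * (v ^ 2)⁻¹ ≤
        K * Real.exp (∑ p ∈ primesIoc 0 x, ‖g p‖ / p) *
          (Real.exp (-(l * c / (c + β))) + T ^ (-(1 / 2) : ℝ)) := by
  obtain ⟨K, hK0, hK⟩ := exists_integral_log_partialSum_le hβ hc δ A A₄ c₁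
  set C := 144 * A + 12 * A * ∑' k : ℕ, 1 / (k : ℝ) ^ 2 with hC
  have hC0 : 0 ≤ C := by
    have : 0 ≤ ∑' k : ℕ, 1 / (k : ℝ) ^ 2 := tsum_nonneg fun k => by positivity
    positivity
  refine ⟨2 * (Real.exp C + K), by positivity, ?_⟩
  intro g Y x T l h hY0 hY hx hT hl htw
  have he8 : Real.exp 2 ≤ 8 := by
    have h1 : Real.exp 2 = Real.exp 1 * Real.exp 1 := by rw [← Real.exp_add]; norm_num
    have := Real.exp_one_lt_d9
    have := Real.exp_pos 1
    rw [h1]; nlinarith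
  set Y₁ := max Y 8 with hY₁
  have hY₁8 : 8 ≤ Y₁ := le_max_right _ _
  have hY₁x : Y₁ ≤ x := max_le hY hx
  have h1 := integral_norm_partialSum_le_of_log (expMult (truncPrimes g x)) (he8.trans hY₁8) hY₁x
  have h2 := hK g Y Y₁ x T l h hY0 (le_max_left _ _)
    ((Real.exp_le_exp.2 (by norm_num)).trans (he8.trans hY₁8)) hY₁x hT hl htw
  have h3 := sum_norm_expMult_div_le g hY₁x
  set P := Real.exp (∑ p ∈ primesIoc 0 x, ‖g p‖ / p) with hP
  set E := Real.exp (-(l * c / (c + β))) + T ^ (-(1 / 2) : ℝ) with hE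
  have hr : 0 ≤ T ^ (-(1 / 2) : ℝ) := by positivity
  have hadd := sum_primesIoc_add (by linarith : (0 : ℝ) ≤ Y₁) hY₁x fun p => ‖g p‖ / p
  have h4 : Real.exp (∑ p ∈ primesIoc 0 Y₁, ‖g p‖ / p) ≤ Real.exp C * P * E := by
    rcases lt_or_ge T 1 with hT1 | hT1
    · have e1 := one_le_rpow_neg_half hT hT1
      have e2 : 1 ≤ E := by rw [hE]; linarith [Real.exp_pos (-(l * c / (c + β)))]
      have e3 : Real.exp (∑ p ∈ primesIoc 0 Y₁, ‖g p‖ / p) ≤ P := by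
        apply Real.exp_le_exp.2
        have : 0 ≤ ∑ p ∈ primesIoc Y₁ x, ‖g p‖ / p := Finset.sum_nonneg fun p _ => by positivity
        linarith
      have e4 : 1 ≤ Real.exp C := Real.one_le_exp hC0
      calc _ ≤ P := e3
        _ = 1 * P * 1 := by ring
        _ ≤ _ := by gcongr
    · have e1 := h.le_sum_of_le_twist (fun t ht => htw t (ht.trans hT1))
      have e2 := sum_primesIoc_add (le_max_left Y 8) hY₁x fun p => ‖g p‖ / p
      have e3 : ∑ p ∈ primesIoc Y Y₁, ‖g p‖ / p ≤ 144 * A := by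
        refine h.sum_le_of_le_eight (fun p hp => (mem_primesIoc.1 hp).1) fun p hp => ?_
        obtain ⟨-, f1, f2⟩ := mem_primesIoc.1 hp
        rcases max_choice Y 8 with f3 | f3
        · rw [hY₁, f3] at f2; exact absurd f1 (not_lt.2 f2)
        · rwa [hY₁, f3] at f2
      have e4 : Real.exp (∑ p ∈ primesIoc 0 Y₁, ‖g p‖ / p) ≤
          Real.exp C * P * Real.exp (-(l * c / (c + β))) := by
        rw [hP, ← Real.exp_add, ← Real.exp_add]
        apply Real.exp_le_exp.2
        have e5 : l * c / (c + β) ≤ l := by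
          rw [div_le_iff₀ (by positivity)]
          nlinarith [mul_nonneg hl hβ.le]
        linarith
      refine e4.trans ?_
      gcongr
      rw [hE]; linarith
  linarith

/-! ### From the mean to a point: averaging over short windows -/

theorem partialSum_of_lt_one (f : ℕ → ℂ) {v : ℝ} (hv : v < 1) : partialSum f v = 0 := by
  unfold partialSum
  rw [Nat.floor_eq_zero.2 hv]
  simp

theorem norm_partialSum_le_add (f : ℕ → ℂ) {s v t u : ℝ} (ht0 : 0 ≤ t) (ht : t < v) (hvs : v ≤ s)
    (hsu : s ≤ u) :
    ‖partialSum f s‖ ≤ ‖partialSum f v‖ +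
      ∑ n ∈ Finset.Icc 1 ⌊u⌋₊, if t < (n : ℝ) ∧ (n : ℝ) ≤ s then ‖f n‖ else 0 := by
  have hv0 : 0 ≤ v := ht0.trans ht.le
  have h1 : partialSum f s = partialSum f v + ∑ n ∈ Finset.Ioc ⌊v⌋₊ ⌊s⌋₊, f n := by
    unfold partialSum
    have := Nat.floor_mono hvs
    rw [← Finset.sum_union]
    · congr 1
      ext n; simp only [Finset.mem_union, Finset.mem_Icc, Finset.mem_Ioc]; omega
    · rw [Finset.disjoint_left]
      intro n; simp only [Finset.mem_Icc, Finset.mem_Ioc]; omega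
  rw [h1]
  refine (norm_add_le _ _).trans ?_
  gcongr
  refine (norm_sum_le _ _).trans ?_
  rw [← Finset.sum_filter]
  refine Finset.sum_le_sum_of_subset_of_nonneg (fun n hn => ?_) fun _ _ _ => norm_nonneg _
  obtain ⟨h2, h3⟩ := Finset.mem_Ioc.1 hn
  have h4 : (n : ℝ) ≤ s := (Nat.le_floor_iff (hv0.trans hvs)).1 h3
  have h5 : v < n := (Nat.floor_lt hv0).1 h2
  exact Finset.mem_filter.2 ⟨Finset.mem_Icc.2 ⟨by omega, h3.trans (Nat.floor_mono hsu)⟩,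
    ht.trans h5, h4⟩

/-- A value of `|S|` is at most its mean over a short interval, up to a short sum. -/
theorem mul_norm_partialSum_le_integral (f : ℕ → ℂ) {θ s u : ℝ} (hθ0 : 0 < θ) (hθ1 : θ ≤ 1)
    (hs0 : 0 < s) (hsu : s ≤ u) :
    θ * s * ‖partialSum f s‖ ≤ (∫ v in Set.Ioc 1 u,
        ‖partialSum f v‖ * (Set.Ioc (s * (1 - θ)) s).indicator (fun _ => (1 : ℝ)) v) +
      θ * s * ∑ n ∈ Finset.Icc 1 ⌊u⌋₊,
        if s * (1 - θ) < (n : ℝ) ∧ (n : ℝ) ≤ s then ‖f n‖ else 0 := by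
  set R := ∑ n ∈ Finset.Icc 1 ⌊u⌋₊,
        if s * (1 - θ) < (n : ℝ) ∧ (n : ℝ) ≤ s then ‖f n‖ else 0 with hR
  set W := Set.Ioc (s * (1 - θ)) s with hW
  have hvol : (volume.real W) = θ * s := by
    rw [hW, Real.volume_real_Ioc_of_le (by nlinarith)]; ring
  have hWfin : volume W ≠ ⊤ := by rw [hW]; exact measure_Ioc_lt_top.ne
  have hlow0 : 0 ≤ s * (1 - θ) := mul_nonneg hs0.le (by linarith)
  have hSint : IntegrableOn (fun v => ‖partialSum f v‖) W := by
    have := integrableOn_norm_partialSum_mul f (k := fun _ => (1 : ℝ)) (X₁ := s * (1 - θ)) (X := s)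
      (by simp)
    simpa using this
  have h1 : ∫ v in W, ‖partialSum f v‖ = ∫ v in Set.Ioc 1 u,
        ‖partialSum f v‖ * W.indicator (fun _ => (1 : ℝ)) v := by
    rw [← integral_indicator (by rw [hW]; exact measurableSet_Ioc),
      ← integral_indicator measurableSet_Ioc]
    refine integral_congr_ae ?_
    -- A window may reach below 1, where the partial sum vanishes; only the null set {1} has to be
    -- removed.
    have : ({1} : Set ℝ)ᶜ ∈ ae (volume : Measure ℝ) := compl_mem_ae_iff.2 (by simp)
    filter_upwards [this] with v hv
    simp only [Set.indicator_apply]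
    by_cases hvW : v ∈ W
    · have hvu : v ≤ u := hvW.2.trans hsu
      by_cases hv1 : 1 < v
      · rw [if_pos hvW, if_pos ⟨hv1, hvu⟩]; simp [hvW]
      · have hv2 : v < 1 := lt_of_le_of_ne (not_lt.1 hv1) hv
        rw [if_pos hvW, if_neg fun h => hv1 h.1, partialSum_of_lt_one f hv2, norm_zero]
    · simp [hvW]
  rw [← h1]
  have h2 : ∫ v in W, ‖partialSum f s‖ ≤ ∫ v in W, (‖partialSum f v‖ + R) := by
    refine setIntegral_mono_on (integrableOn_const hWfin)
      (hSint.add (integrableOn_const hWfin)) (by rw [hW]; exact measurableSet_Ioc) fun v hv => ?_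
    exact norm_partialSum_le_add f hlow0 hv.1 hv.2 hsu
  rw [integral_add hSint (integrableOn_const hWfin), setIntegral_const, setIntegral_const, hvol,
    smul_eq_mul, smul_eq_mul] at h2
  exact h2

namespace PrimeBounds

variable {g : ℕ → ℂ} {δ A β A₄ c c₁ Y x : ℝ}

/-- For y ≥ z, θ⁻¹ ≤ z^δ makes the window length θy at least y^{1-δ}, so the short-interval
condition applies. For y < z the window contains no prime above z. -/
theorem sum_window_le (h : PrimeBounds g δ A β A₄ c c₁ Y x) {θ z : ℝ} (hθ0 : 0 < θ) (hθ1 : θ ≤ 1)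
    (hz : 2 ≤ z) (hzθ : θ⁻¹ ≤ z ^ δ) (u : ℝ) {y : ℝ} (hy : 0 < y) :
    ∑ p ∈ primesIoc z u, (if y * (1 - θ) < (p : ℝ) ∧ (p : ℝ) ≤ y then ‖g p‖ * Real.log p else 0) ≤
      A * (θ * y) := by
  have hA := h.const_nonneg
  rcases lt_or_ge y z with hyz | hyz
  · rw [Finset.sum_eq_zero]
    · positivity
    · intro p hp
      rw [if_neg]
      rintro ⟨-, h2⟩
      linarith [(mem_primesIoc.1 hp).2.1]
  · have hy2 : 2 ≤ y := hz.trans hyz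
    have h1 : y ^ (1 - δ) ≤ θ * y := by
      have h2 : θ⁻¹ ≤ y ^ δ := hzθ.trans (Real.rpow_le_rpow (by linarith) hyz h.pos.le)
      rw [Real.rpow_sub (by linarith), Real.rpow_one, div_le_iff₀ (by positivity)]
      have h3 : 1 ≤ θ * y ^ δ := by
        calc (1 : ℝ) = θ * θ⁻¹ := by field_simp
          _ ≤ _ := by gcongr
      nlinarith
    refine le_trans ?_ (h.short y (θ * y) hy2 h1 (by nlinarith))
    rw [← Finset.sum_filter]
    refine Finset.sum_le_sum_of_subset_of_nonneg (fun p hp => ?_) fun p _ _ =>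
      mul_nonneg (norm_nonneg _) (Real.log_natCast_nonneg p)
    obtain ⟨h4, h5, h6⟩ := Finset.mem_filter.1 hp
    exact mem_primesIoc.2 ⟨(mem_primesIoc.1 h4).1, by linarith, h6⟩

/-- Each |S(u/p)| is at most its mean over a window of relative length θ just below u/p, plus the
terms f(n) in that window. The relation between p and v, or p and n, is symmetric up to endpoints,
so after interchange the primes lie in a window just below u/v or u/n, whose weight O(θu/v) cancels
the normalisation 1/θ in the first case and keeps the factor θ in the second. -/
theorem sum_large_primes_le (h : PrimeBounds g δ A β A₄ c c₁ Y x) {θ z : ℝ} (hθ0 : 0 < θ)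
    (hθ1 : θ ≤ 1) (hz : 2 ≤ z) (hzθ : θ⁻¹ ≤ z ^ δ) {u : ℝ} (hu : 1 ≤ u) (f : ℕ → ℂ) :
    ∑ p ∈ primesIoc z u, ‖g p‖ * Real.log p * ‖partialSum f (u / p)‖ ≤
      A * u * (∫ v in Set.Ioc 1 u, ‖partialSum f v‖ * (v ^ 2)⁻¹) +
        A * (θ * u) * ∑ n ∈ Finset.Icc 1 ⌊u⌋₊, ‖f n‖ / n := by
  have hu0 : 0 < u := by linarith
  have hs : ∀ p ∈ primesIoc z u, p.Prime := fun p hp => (mem_primesIoc.1 hp).1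
  have hfl : ∀ p : ℕ, 0 ≤ ‖g p‖ * Real.log p := fun p =>
    mul_nonneg (norm_nonneg _) (Real.log_natCast_nonneg p)
  set W : ℕ → Set ℝ := fun p => Set.Ioc (u / p * (1 - θ)) (u / p) with hW
  have hWm : ∀ p, MeasurableSet (W p) := fun p => measurableSet_Ioc
  have hiW : ∀ p, IntegrableOn (fun v => ‖partialSum f v‖ *
      (W p).indicator (fun _ => (1 : ℝ)) v) (Set.Ioc 1 u) := fun p =>
    integrableOn_norm_partialSum_mul f
      ((show IntegrableOn (fun _ => (1 : ℝ)) (Set.Ioc 1 u) by simp).indicator (hWm p))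
  set R : ℕ → ℝ := fun p => ∑ n ∈ Finset.Icc 1 ⌊u⌋₊,
    if u / p * (1 - θ) < (n : ℝ) ∧ (n : ℝ) ≤ u / p then ‖f n‖ else 0 with hR
  have hterm : ∀ p ∈ primesIoc z u, ‖g p‖ * Real.log p * ‖partialSum f (u / p)‖ ≤
      (‖g p‖ * Real.log p * p / (θ * u)) * (∫ v in Set.Ioc 1 u, ‖partialSum f v‖ *
        (W p).indicator (fun _ => (1 : ℝ)) v) + ‖g p‖ * Real.log p * R p := by
    intro p hp
    have hp0 : (0 : ℝ) < p := by exact_mod_cast (hs p hp).pos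
    have h1 := mul_norm_partialSum_le_integral f hθ0 hθ1 (s := u / p) (u := u) (by positivity)
      (div_le_self hu0.le (by exact_mod_cast (hs p hp).one_lt.le))
    have h2 : 0 ≤ ‖g p‖ * Real.log p * p / (θ * u) := by have := hfl p; positivity
    have h3 := mul_le_mul_of_nonneg_left h1 h2
    calc _ = ‖g p‖ * Real.log p * p / (θ * u) * (θ * (u / p) * ‖partialSum f (u / p)‖) := by
          field_simp
      _ ≤ _ := h3
      _ = _ := by rw [mul_add]; congr 1; simp only [hR]; field_simp
  refine (Finset.sum_le_sum hterm).trans ?_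
  rw [Finset.sum_add_distrib]
  refine add_le_add ?_ ?_
  · simp only [← integral_const_mul]
    rw [← integral_finsetSum _ fun p _ => (hiW p).const_mul _]
    refine setIntegral_mono_on (integrable_finsetSum _ fun p _ => (hiW p).const_mul _)
      ((integrableOn_norm_partialSum_mul f (integrableOn_inv_sq_Ioc one_pos)).const_mul _)
      measurableSet_Ioc fun v hv => ?_
    have hv0 : 0 < v := by linarith [hv.1]
    have h4 := h.sum_window_le hθ0 hθ1 hz hzθ u (y := u / v) (by positivity)
    have h5 : ∀ p ∈ primesIoc z u, ‖g p‖ * Real.log p * p / (θ * u) *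
        (‖partialSum f v‖ * (W p).indicator (fun _ => (1 : ℝ)) v) ≤
        ‖partialSum f v‖ / (θ * v) * (if u / v * (1 - θ) < (p : ℝ) ∧ (p : ℝ) ≤ u / v then
          ‖g p‖ * Real.log p else 0) := by
      intro p hp
      have hp0 : (0 : ℝ) < p := by exact_mod_cast (hs p hp).pos
      have hfp := hfl p
      simp only [Set.indicator_apply, hW, Set.mem_Ioc]
      by_cases hvW : u / p * (1 - θ) < v ∧ v ≤ u / p
      · obtain ⟨h6, h7⟩ := hvW
        have h8 : (p : ℝ) ≤ u / v := by
          rw [le_div_iff₀ hv0]; rw [le_div_iff₀ hp0] at h7; linarith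
        have h9 : u / v * (1 - θ) < p := by
          rw [div_mul_eq_mul_div, div_lt_iff₀ hv0]
          rw [div_mul_eq_mul_div, div_lt_iff₀ hp0] at h6; linarith
        rw [if_pos ⟨h6, h7⟩, if_pos ⟨h9, h8⟩, mul_one]
        have h10 : (p : ℝ) / u ≤ v⁻¹ := by
          rw [div_le_iff₀ hu0, inv_mul_eq_div]; exact h8
        calc _ = ‖g p‖ * Real.log p * ‖partialSum f v‖ / θ * (p / u) := by field_simp
          _ ≤ ‖g p‖ * Real.log p * ‖partialSum f v‖ / θ * v⁻¹ := by gcongr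
          _ = _ := by field_simp
      · rw [if_neg hvW, mul_zero, mul_zero]
        have : 0 ≤ (if u / v * (1 - θ) < (p : ℝ) ∧ (p : ℝ) ≤ u / v then
          ‖g p‖ * Real.log p else 0) := by split_ifs; exacts [hfp, le_rfl]
        positivity
    refine (Finset.sum_le_sum h5).trans ?_
    rw [← Finset.mul_sum]
    calc _ ≤ ‖partialSum f v‖ / (θ * v) * (A * (θ * (u / v))) := by gcongr
      _ = _ := by field_simp
  · have h4 : ∑ p ∈ primesIoc z u, ‖g p‖ * Real.log p * R p = ∑ n ∈ Finset.Icc 1 ⌊u⌋₊,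
        ‖f n‖ * ∑ p ∈ primesIoc z u, (if u / n * (1 - θ) < (p : ℝ) ∧ (p : ℝ) ≤ u / n then
          ‖g p‖ * Real.log p else 0) := by
      simp only [hR, Finset.mul_sum]
      rw [Finset.sum_comm]
      refine Finset.sum_congr rfl fun n hn => Finset.sum_congr rfl fun p hp => ?_
      have hp0 : (0 : ℝ) < p := by exact_mod_cast (hs p hp).pos
      have hn0 : (0 : ℝ) < n := by exact_mod_cast (Finset.mem_Icc.1 hn).1
      have h5 : (u / p * (1 - θ) < (n : ℝ) ∧ (n : ℝ) ≤ u / p) ↔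
          (u / n * (1 - θ) < (p : ℝ) ∧ (p : ℝ) ≤ u / n) := by
        rw [div_mul_eq_mul_div, div_mul_eq_mul_div, div_lt_iff₀ hp0, div_lt_iff₀ hn0,
          le_div_iff₀ hp0, le_div_iff₀ hn0, mul_comm (n : ℝ)]
      simp only [h5]
      split_ifs <;> ring
    rw [h4, Finset.mul_sum]
    refine Finset.sum_le_sum fun n hn => ?_
    have hn0 : (0 : ℝ) < n := by exact_mod_cast (Finset.mem_Icc.1 hn).1
    have h5 := h.sum_window_le hθ0 hθ1 hz hzθ u (y := u / n) (by positivity)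
    calc _ ≤ ‖f n‖ * (A * (θ * (u / n))) := by gcongr
      _ = _ := by field_simp

/-- Partial summation and the prime recursion for h(n) log n express log u · S(u) through the values
S(u/p). The primes above z are spent on the mean of |S|; those up to z remain for an induction. -/
theorem log_mul_norm_partialSum_expMult_le (h : PrimeBounds g δ A β A₄ c c₁ Y x) {θ z : ℝ}
    (hθ0 : 0 < θ) (hθ1 : θ ≤ 1) (hz : 2 ≤ z) (hzθ : θ⁻¹ ≤ z ^ δ) {u : ℝ} (hu : 1 ≤ u)
    (hux : u ≤ x) :
    Real.log u * ‖partialSum (expMult (truncPrimes g x)) u‖ ≤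
      (1 + A) * u * (∫ v in Set.Ioc 1 x,
        ‖partialSum (expMult (truncPrimes g x)) v‖ * (v ^ 2)⁻¹) +
      A * (θ * u) * Real.exp (∑ p ∈ primesIoc 0 x, ‖g p‖ / p) +
      ∑ p ∈ primesIoc 0 z, ‖g p‖ * Real.log p *
        ‖partialSum (expMult (truncPrimes g x)) (u / p)‖ := by
  have hA := h.const_nonneg
  set f := expMult (truncPrimes g x) with hf
  have hfl : ∀ p : ℕ, 0 ≤ ‖g p‖ * Real.log p := fun p =>
    mul_nonneg (norm_nonneg _) (Real.log_natCast_nonneg p)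
  have h1 := log_mul_norm_partialSum_le f u hu
  have hint : ∀ X, IntegrableOn (fun v => ‖partialSum f v‖ * (v ^ 2)⁻¹) (Set.Ioc 1 X) := fun X =>
    integrableOn_norm_partialSum_mul f (integrableOn_inv_sq_Ioc one_pos)
  have hI : ∫ v in Set.Ioc 1 u, ‖partialSum f v‖ * (v ^ 2)⁻¹ ≤
      ∫ v in Set.Ioc 1 x, ‖partialSum f v‖ * (v ^ 2)⁻¹ :=
    setIntegral_mono_set (hint x) (ae_of_all _ fun v => by simp only [Pi.zero_apply]; positivity)
      (Set.Ioc_subset_Ioc_right hux).eventuallyLE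
  have h2 : ∫ w in Set.Ioc 1 u, ‖partialSum f w‖ * w⁻¹ ≤
      u * ∫ v in Set.Ioc 1 x, ‖partialSum f v‖ * (v ^ 2)⁻¹ := by
    refine le_trans ?_ (mul_le_mul_of_nonneg_left hI (by linarith))
    rw [← integral_const_mul]
    refine setIntegral_mono_on (integrableOn_norm_partialSum_mul f (integrableOn_inv_Ioc one_pos))
      ((hint u).const_mul _) measurableSet_Ioc fun v hv => ?_
    have hv0 : 0 < v := by linarith [hv.1]
    have : v⁻¹ ≤ u * (v ^ 2)⁻¹ := by
      rw [sq, mul_inv, ← mul_assoc]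
      have : 1 ≤ u * v⁻¹ := by rw [← div_eq_mul_inv, one_le_div hv0]; exact hv.2
      have h3 : 0 < v⁻¹ := by positivity
      nlinarith
    calc _ ≤ ‖partialSum f v‖ * (u * (v ^ 2)⁻¹) := by gcongr
      _ = _ := by ring
  have h3 : ‖partialSum (fun n => f n * (Real.log n : ℂ)) u‖ ≤
      ∑ p ∈ primesIoc 0 u, ‖g p‖ * Real.log p * ‖partialSum f (u / p)‖ := by
    rw [hf, partialSum_expMult_mul_log]
    refine (norm_sum_le _ _).trans (le_of_eq ?_)
    refine Finset.sum_congr rfl fun p hp => ?_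
    have hp' := mem_primesIoc.1 hp
    rw [norm_mul, norm_mul, truncPrimes_of_mem (mem_primesIoc.2 ⟨hp'.1, hp'.2.1, hp'.2.2.trans hux⟩),
      Complex.norm_real, Real.norm_of_nonneg (Real.log_natCast_nonneg p)]
  have h4 : ∑ p ∈ primesIoc 0 u, ‖g p‖ * Real.log p * ‖partialSum f (u / p)‖ ≤
      ∑ p ∈ primesIoc 0 z, ‖g p‖ * Real.log p * ‖partialSum f (u / p)‖ +
      ∑ p ∈ primesIoc z u, ‖g p‖ * Real.log p * ‖partialSum f (u / p)‖ := by
    have h5 : ∀ p, 0 ≤ ‖g p‖ * Real.log p * ‖partialSum f (u / p)‖ := fun p =>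
      mul_nonneg (hfl p) (norm_nonneg _)
    rcases le_total z u with hzu | hzu
    · exact (sum_primesIoc_add (by linarith) hzu _).le
    · have h6 : ∑ p ∈ primesIoc 0 u, ‖g p‖ * Real.log p * ‖partialSum f (u / p)‖ ≤
          ∑ p ∈ primesIoc 0 z, ‖g p‖ * Real.log p * ‖partialSum f (u / p)‖ := by
        refine Finset.sum_le_sum_of_subset_of_nonneg (fun p hp => ?_) fun p _ _ => h5 p
        have hp' := mem_primesIoc.1 hp
        exact mem_primesIoc.2 ⟨hp'.1, hp'.2.1, hp'.2.2.trans hzu⟩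
      have h7 := Finset.sum_nonneg fun p (_ : p ∈ primesIoc z u) => h5 p
      linarith
  have h5 := h.sum_large_primes_le hθ0 hθ1 hz hzθ hu f
  have h6 : ∑ n ∈ Finset.Icc 1 ⌊u⌋₊, ‖f n‖ / n ≤ Real.exp (∑ p ∈ primesIoc 0 x, ‖g p‖ / p) := by
    refine le_trans (Finset.sum_le_sum_of_subset_of_nonneg
      (Finset.Icc_subset_Icc_right (Nat.floor_mono hux)) fun _ _ _ => by positivity)
      (sum_norm_expMult_div_le g (le_refl x))
  have h7 : A * u * (∫ v in Set.Ioc 1 u, ‖partialSum f v‖ * (v ^ 2)⁻¹) ≤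
      A * u * ∫ v in Set.Ioc 1 x, ‖partialSum f v‖ * (v ^ 2)⁻¹ := by gcongr
  have h8 : A * (θ * u) * ∑ n ∈ Finset.Icc 1 ⌊u⌋₊, ‖f n‖ / n ≤
      A * (θ * u) * Real.exp (∑ p ∈ primesIoc 0 x, ‖g p‖ / p) := by gcongr
  linarith

/-- The contribution of the small primes under the inductive bound `D u (X / u) ^ ε`. -/
theorem sum_small_primes_le (h : PrimeBounds g δ A β A₄ c c₁ Y x) {z u X D ε : ℝ} (hz : 2 ≤ z)
    (hu : 1 ≤ u) (hX : 0 < X) (hD : 0 ≤ D) (hε : 0 ≤ ε) {f : ℕ → ℂ}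
    (hf : ∀ p : ℕ, p.Prime → 1 ≤ u / p →
      ‖partialSum f (u / p)‖ ≤ D * (u / p) * (X / (u / p)) ^ ε) :
    ∑ p ∈ primesIoc 0 z, ‖g p‖ * Real.log p * ‖partialSum f (u / p)‖ ≤
      D * u * (X / u) ^ ε * (z ^ ε * (24 * A * Real.log z)) := by
  have hu0 : 0 < u := by linarith
  have h1 : ∀ p ∈ primesIoc 0 z, ‖g p‖ * Real.log p * ‖partialSum f (u / p)‖ ≤
      D * u * (X / u) ^ ε * (z ^ ε * (‖g p‖ * Real.log p / p)) := by
    intro p hp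
    obtain ⟨hpp, hp0, hpz⟩ := mem_primesIoc.1 hp
    have hfl : 0 ≤ ‖g p‖ * Real.log p := mul_nonneg (norm_nonneg _) (Real.log_natCast_nonneg p)
    have h2 : ‖partialSum f (u / p)‖ ≤ D * (u / p) * ((X / u) ^ ε * z ^ ε) := by
      rcases le_or_gt 1 (u / p) with h3 | h3
      · refine (hf p hpp h3).trans ?_
        gcongr
        rw [← Real.mul_rpow (by positivity) (by positivity)]
        refine Real.rpow_le_rpow (by positivity) ?_ hε
        rw [div_div_eq_mul_div, mul_div_right_comm]
        gcongr
      · rw [partialSum_of_lt_one f h3, norm_zero]; positivity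
    calc _ ≤ ‖g p‖ * Real.log p * (D * (u / p) * ((X / u) ^ ε * z ^ ε)) := by gcongr
      _ = _ := by field_simp
  refine (Finset.sum_le_sum h1).trans ?_
  rw [← Finset.mul_sum, ← Finset.mul_sum]
  gcongr
  exact sum_prime_log_div_le (fun p => norm_nonneg (g p)) h.chebyshev
    (fun p hp => (mem_primesIoc.1 hp).1) hz (fun p hp => (mem_primesIoc.1 hp).2.2)

end PrimeBounds

/-! ### The induction on small primes and the choice of parameters -/

/-- With y = 1 + log x these give, in order: z ≥ 2; r^ε large enough for the trivial bound to start
the induction; and small primes using at most half of log r. -/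
theorem eventually_log_conditions {κ ε : ℝ} (hκ : 0 < κ) (hε : 0 < ε) (C B s : ℝ) (hC : 0 ≤ C)
    (hB : 0 ≤ B) :
    ∀ᶠ y : ℝ in Filter.atTop, 2 ≤ y ^ κ ∧ y ^ s * B ≤ Real.exp (ε * (y - 1)) ∧
      C * (y ^ (1 / 4 : ℝ) * Real.log y) ≤ (y - 1) / 2 := by
  have h1 := (tendsto_rpow_atTop hκ).eventually_ge_atTop 2
  have h2 := (isLittleO_rpow_exp_pos_mul_atTop s hε).bound
    (show 0 < Real.exp (-ε) / (B + 1) by positivity)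
  have h3 := (isLittleO_log_rpow_atTop (show (0 : ℝ) < 3 / 4 by norm_num)).bound
    (show 0 < 1 / (4 * (C + 1)) by positivity)
  filter_upwards [h1, h2, h3, Filter.eventually_ge_atTop 2] with y e1 e2 e3 e4
  have hy0 : 0 < y := by linarith
  refine ⟨e1, ?_, ?_⟩
  · rw [Real.norm_of_nonneg (by positivity), Real.norm_of_nonneg (by positivity)] at e2
    calc y ^ s * B ≤ (Real.exp (-ε) / (B + 1) * Real.exp (ε * y)) * (B + 1) := by
          gcongr; linarith
      _ = Real.exp (-ε) * Real.exp (ε * y) := by field_simp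
      _ = _ := by rw [← Real.exp_add]; congr 1; ring
  · have hl0 : 0 ≤ Real.log y := Real.log_nonneg (by linarith)
    rw [Real.norm_of_nonneg hl0, Real.norm_of_nonneg (by positivity)] at e3
    calc C * (y ^ (1 / 4 : ℝ) * Real.log y) ≤
          (C + 1) * (y ^ (1 / 4 : ℝ) * (1 / (4 * (C + 1)) * y ^ (3 / 4 : ℝ))) := by
          gcongr; linarith
      _ = (y ^ (1 / 4 : ℝ) * y ^ (3 / 4 : ℝ)) / 4 := by field_simp
      _ = y / 4 := by rw [← Real.rpow_add hy0]; norm_num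
      _ ≤ _ := by linarith

theorem floor_div_lt {u : ℝ} (hu : 1 ≤ u) {p : ℕ} (hp : 2 ≤ p) : ⌊u / p⌋₊ < ⌊u⌋₊ := by
  have hp2 : (2 : ℝ) ≤ p := by exact_mod_cast hp
  rw [Nat.floor_lt (by positivity)]
  have h1 : (1 : ℝ) ≤ ⌊u⌋₊ := by exact_mod_cast Nat.one_le_floor_iff u |>.2 hu
  have h2 := Nat.lt_floor_add_one u
  rw [div_lt_iff₀ (by linarith)]
  nlinarith

namespace PrimeBounds

variable {g : ℕ → ℂ} {δ A β A₄ c c₁ Y x : ℝ}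

/-- Strong induction on ⌊u⌋. When X/u ≥ r, the factor (X/u)^ε already covers the trivial bound.
Otherwise r² ≤ X forces u ≥ r, and log u ≥ log r outweighs both contributions: passing from u to u/p
with p ≤ z loses only z^ε, so the small primes take at most half of log r, and the mean and error
terms take the other half. At u = X the weight disappears. -/
theorem norm_partialSum_expMult_le_rpow (h : PrimeBounds g δ A β A₄ c c₁ Y x)
    {θ z D ε r X : ℝ} (hθ0 : 0 < θ) (hθ1 : θ ≤ 1) (hz2 : 2 ≤ z) (hzθ : θ⁻¹ ≤ z ^ δ) (hε0 : 0 ≤ ε)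
    (hr1 : 1 < r) (hrX : r * r ≤ X) (hXu : X ≤ x) (hD0 : 0 ≤ D)
    (hrε : Real.exp (∑ p ∈ primesIoc 0 x, ‖g p‖ / p) ≤ D * r ^ ε)
    (hsmall : z ^ ε * (24 * A * Real.log z) ≤ Real.log r / 2)
    (hlarge : (1 + A) * (∫ v in Set.Ioc 1 x, ‖partialSum (expMult (truncPrimes g x)) v‖ *
      (v ^ 2)⁻¹) + A * θ * Real.exp (∑ p ∈ primesIoc 0 x, ‖g p‖ / p) ≤ Real.log r / 2 * D) :
    ∀ u : ℝ, 1 ≤ u → u ≤ X →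
      ‖partialSum (expMult (truncPrimes g x)) u‖ ≤ D * u * (X / u) ^ ε := by
  have hr0 : 0 < r := by linarith
  have hX0 : 0 < X := by nlinarith [mul_pos hr0 hr0]
  have hlr : 0 < Real.log r := Real.log_pos hr1
  suffices main : ∀ n : ℕ, ∀ u : ℝ, ⌊u⌋₊ = n → 1 ≤ u → u ≤ X →
      ‖partialSum (expMult (truncPrimes g x)) u‖ ≤ D * u * (X / u) ^ ε from
    fun u => main _ u rfl
  intro n
  induction n using Nat.strong_induction_on with
  | _ n ih =>
    intro u hun hu1 huX
    have hu0 : 0 < u := by linarith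
    rcases le_or_gt r (X / u) with hru | hru
    · refine (norm_partialSum_expMult_le g hu0.le (huX.trans hXu)).trans ?_
      calc u * Real.exp (∑ p ∈ primesIoc 0 x, ‖g p‖ / p) ≤ u * (D * r ^ ε) := by gcongr
        _ ≤ u * (D * (X / u) ^ ε) := by gcongr
        _ = _ := by ring
    · have hur : r ≤ u := by
        rw [div_lt_iff₀ hu0] at hru
        by_contra hcon
        push Not at hcon
        nlinarith [mul_lt_mul_of_pos_left hcon hr0]
      have e1 := h.log_mul_norm_partialSum_expMult_le hθ0 hθ1 hz2 hzθ hu1 (huX.trans hXu)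
      have e2 := h.sum_small_primes_le (f := expMult (truncPrimes g x)) (D := D) (ε := ε)
        hz2 hu1 hX0 hD0 hε0
        (fun p hp hp1 => ih _ (hun ▸ floor_div_lt hu1 hp.two_le) _ rfl hp1
          ((div_le_self hu0.le (by exact_mod_cast hp.one_lt.le)).trans huX))
      have hXu1 : 1 ≤ (X / u) ^ ε := Real.one_le_rpow ((one_le_div hu0).2 huX) hε0
      have e4 := mul_le_mul_of_nonneg_left hlarge hu0.le
      have e5 : Real.log r * ‖partialSum (expMult (truncPrimes g x)) u‖ ≤
          Real.log u * ‖partialSum (expMult (truncPrimes g x)) u‖ := by gcongr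
      have e6 : u * (Real.log r / 2 * D) ≤ u * (Real.log r / 2 * D) * (X / u) ^ ε :=
        le_mul_of_one_le_right (by positivity) hXu1
      have e7 := mul_le_mul_of_nonneg_left hsmall
        (show 0 ≤ D * u * (X / u) ^ ε by positivity)
      refine le_of_mul_le_mul_left ?_ hlr
      linarith

end PrimeBounds

/-- The mean-value bound for the exponentially multiplicative function attached to `g`. -/
theorem exists_norm_partialSum_expMult_le {β c δ A A₄ : ℝ} (hβ : 0 < β) (hc : 0 < c) (hδ : 0 < δ)
    (hA : 0 ≤ A) (hA₄ : 0 ≤ A₄) (c₁ : ℝ) :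
    ∃ K x₀ : ℝ, 0 < K ∧ 8 ≤ x₀ ∧ ∀ (g : ℕ → ℂ) (Y x T l : ℝ), PrimeBounds g δ A β A₄ c c₁ Y x →
      0 ≤ Y → Y ≤ x → x₀ ≤ x → 0 < T → 0 ≤ l →
      (∀ t : ℝ, |t| ≤ T → l ≤ ∑ p ∈ primesIoc Y x,
        (‖g p‖ - (g p * (p : ℂ) ^ ((t : ℂ) * Complex.I)).re) / p) →
      ∀ X : ℝ, √x ≤ X → X ≤ x → ‖partialSum (expMult (truncPrimes g x)) X‖ ≤
        K * X * (Real.exp (∑ p ∈ primesIoc 0 x, ‖g p‖ / p) *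
          (Real.exp (-(l * c / (c + β))) + T ^ (-(1 / 2) : ℝ)) / Real.log x) := by
  obtain ⟨K₁, hK₁0, hK₁⟩ := exists_integral_norm_partialSum_le hβ hc δ hA (A₄ := A₄) c₁
  set C₁ := Real.exp (144 * A + β + A₄ + 12 * A * ∑' k : ℕ, 1 / (k : ℝ) ^ 2) with hC₁
  have hC₁0 : 0 < C₁ := Real.exp_pos _
  set α := c * β / (c + β) with hα
  have hα0 : 0 < α := by positivity
  set ε := δ / (4 * α) with hε
  have hε0 : 0 < ε := by positivity
  -- The 8 comes from r = x^{1/4}, for which log r / 2 = log x / 8; the +1 gives K ≥ 1, used to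
  -- start the induction.
  set K := 8 * ((1 + A) * K₁ + A * C₁) + 1 with hK
  have hK1 : 1 ≤ K := by
    have : 0 ≤ 8 * ((1 + A) * K₁ + A * C₁) := by positivity
    linarith
  have hev := eventually_log_conditions (κ := α / δ) (ε := ε / 4) (by positivity) (by positivity)
    (4 * (24 * A * (α / δ))) C₁ (1 + α) (by positivity) hC₁0.le
  have htend : Filter.Tendsto (fun x : ℝ => 1 + Real.log x) Filter.atTop Filter.atTop :=
    Filter.tendsto_atTop_add_const_left _ _ Real.tendsto_log_atTop
  obtain ⟨x₁, hx₁⟩ := Filter.eventually_atTop.1 (htend.eventually hev)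
  refine ⟨K, max x₁ 8, by linarith, le_max_right _ _, ?_⟩
  intro g Y x T l h hY0 hY hx hT hl htw X hXl hXu
  have hx8 : 8 ≤ x := (le_max_right _ _).trans hx
  obtain ⟨hz2, hexp, hlog⟩ := hx₁ x ((le_max_left _ _).trans hx)
  have hint := hK₁ g Y x T l h hY0 hY hx8 hT hl htw
  have hE := h.rpow_le_error hβ hc hA₄ (by linarith) hT htw
  set P := Real.exp (∑ p ∈ primesIoc 0 x, ‖g p‖ / p) with hP
  have hP0 : 0 < P := Real.exp_pos _
  set E := Real.exp (-(l * c / (c + β))) + T ^ (-(1 / 2) : ℝ) with hEdef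
  have hE0 : 0 < E := by
    have : 0 < T ^ (-(1 / 2) : ℝ) := by positivity
    positivity
  set L := Real.log x with hL
  have hL0 : 0 < L := Real.log_pos (by linarith)
  set y := 1 + L with hy
  have hy1 : 1 ≤ y := by linarith
  have hy0 : 0 < y := by linarith
  set z := y ^ (α / δ) with hz
  -- The window is as wide as the lower bound for the error factor permits, so that θP = O(PE); z is
  -- then determined by z^δ = θ⁻¹.
  set θ := y ^ (-α) with hθ
  have hθ0 : 0 < θ := by positivity
  have hθ1 : θ ≤ 1 := Real.rpow_le_one_of_one_le_of_nonpos hy1 (by linarith)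
  have hzθ : θ⁻¹ ≤ z ^ δ := by
    rw [hθ, hz, ← Real.rpow_mul hy0.le, Real.rpow_neg hy0.le, inv_inv, div_mul_cancel₀ _ hδ.ne']
  have hzε : z ^ ε = y ^ (1 / 4 : ℝ) := by
    rw [hz, ← Real.rpow_mul hy0.le]
    congr 1
    rw [hε]; field_simp
  have hlz : Real.log z = α / δ * Real.log y := Real.log_rpow hy0 _
  set D := K * (P * E / L) with hD
  have hD0 : 0 < D := by positivity
  set f := expMult (truncPrimes g x) with hf
  set r := x ^ (1 / 4 : ℝ) with hr
  have hx0 : 0 < x := by linarith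
  have hr0 : 0 < r := by positivity
  have hrX : r * r ≤ X := by
    refine le_trans (le_of_eq ?_) hXl
    rw [hr, ← Real.rpow_add hx0, Real.sqrt_eq_rpow]; norm_num
  have hX0 : 0 < X := by nlinarith [mul_pos hr0 hr0]
  have hrε : P ≤ D * r ^ ε := by
    have h1 : r ^ ε = Real.exp (ε / 4 * (y - 1)) := by
      rw [hr, ← Real.rpow_mul hx0.le, Real.rpow_def_of_pos hx0]
      congr 1
      rw [hy, ← hL]; ring
    have h2 : y ^ (1 + α) * C₁ ≤ r ^ ε := by rw [h1]; exact hexp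
    have h3 : y ^ (1 + α) * y ^ (-α) = y := by
      rw [← Real.rpow_add hy0]; simp
    have h4 : y ≤ y ^ (1 + α) * (C₁ * E) := by
      calc y = y ^ (1 + α) * y ^ (-α) := h3.symm
        _ ≤ _ := by gcongr
    have h5 : L ≤ E * r ^ ε := by
      have : y ^ (1 + α) * C₁ * E ≤ r ^ ε * E := by gcongr
      linarith
    calc P = P * 1 := (mul_one P).symm
      _ ≤ P * (E * r ^ ε / L) := by
          gcongr; rwa [one_le_div hL0]
      _ = 1 * (P * E / L) * r ^ ε := by ring
      _ ≤ _ := by rw [hD]; gcongr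
  have hlogr : Real.log r = L / 4 := by rw [hr, Real.log_rpow hx0]; ring
  have hr1 : 1 < r := Real.one_lt_rpow (by linarith) (by norm_num)
  have hsmall : z ^ ε * (24 * A * Real.log z) ≤ Real.log r / 2 := by
    have : 4 * (z ^ ε * (24 * A * Real.log z)) ≤ L / 2 := by
      rw [hzε, hlz]
      refine le_trans (le_of_eq (by ring)) (hlog.trans (le_of_eq ?_))
      rw [hy]; ring
    rw [hlogr]; linarith
  have hlarge : (1 + A) * (∫ v in Set.Ioc 1 x, ‖partialSum f v‖ * (v ^ 2)⁻¹) + A * θ * P ≤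
      Real.log r / 2 * D := by
    have hDL : D * L = K * (P * E) := by rw [hD]; field_simp
    have f1 : (1 + A) * (∫ v in Set.Ioc 1 x, ‖partialSum f v‖ * (v ^ 2)⁻¹) ≤
        (1 + A) * (K₁ * P * E) := by gcongr
    have f2 : A * θ * P ≤ A * (C₁ * E) * P := by gcongr
    have f3 : (8 * ((1 + A) * K₁ + A * C₁)) * (P * E) ≤ K * (P * E) := by
      gcongr; rw [hK]; linarith
    rw [hlogr]
    linarith
  have hX1 : 1 ≤ X := by
    refine le_trans ?_ hXl
    rw [Real.one_le_sqrt]; linarith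
  have := h.norm_partialSum_expMult_le_rpow hθ0 hθ1 hz2 hzθ hε0.le hr1 hrX hXu hD0.le hrε hsmall
    hlarge X hX1 le_rfl
  rw [div_self hX0.ne', Real.one_rpow, mul_one] at this
  refine this.trans (le_of_eq ?_)
  rw [hD]; ring

/-! ### The quotient of g by its exponentially multiplicative part -/

theorem mul_le_prod_factorization {r : ArithmeticFunction ℂ} (hr : r.IsMultiplicative)
    {W : ℕ → ℝ} (hW0 : ∀ n, 0 ≤ W n) (hW1 : W 1 ≤ 1)
    (hW : ∀ m n, m ≠ 0 → n ≠ 0 → W (m * n) ≤ W m * W n) (n : ℕ) (hn : n ≠ 0) :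
    ‖r n‖ * W n ≤ n.factorization.prod fun p k => ‖r (p ^ k)‖ * W (p ^ k) := by
  induction n using Nat.recOnPosPrimePosCoprime with
  | prime_pow p k hp hk =>
    rw [hp.factorization_pow, Finsupp.prod, Finsupp.support_single _ hk.ne']
    simp
  | zero => exact absurd rfl hn
  | one => simpa [hr.map_one] using hW1
  | coprime a b ha hb hab iha ihb =>
    have ha0 : a ≠ 0 := by omega
    have hb0 : b ≠ 0 := by omega
    rw [Nat.factorization_mul_of_coprime hab,
      Finsupp.prod_add_index_of_disjoint (Nat.Coprime.disjoint_primeFactors hab),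
      hr.map_mul_of_coprime hab, norm_mul]
    have := hW a b ha0 hb0
    have hWa := hW0 a
    have hWb := hW0 b
    calc ‖r a‖ * ‖r b‖ * W (a * b) ≤ ‖r a‖ * ‖r b‖ * (W a * W b) := by gcongr
      _ = (‖r a‖ * W a) * (‖r b‖ * W b) := by ring
      _ ≤ _ := mul_le_mul (iha ha0) (ihb hb0) (by positivity)
        ((mul_nonneg (norm_nonneg _) hWa).trans (iha ha0))

/-- Rankin-type bound for a weighted sum of a multiplicative function by an Euler product. -/
theorem sum_norm_mul_le_exp {r : ArithmeticFunction ℂ} (hr : r.IsMultiplicative)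
    {W : ℕ → ℝ} (hW0 : ∀ n, 0 ≤ W n) (hW1 : W 1 = 1)
    (hW : ∀ m n, m ≠ 0 → n ≠ 0 → W (m * n) ≤ W m * W n) {M : ℕ → ℝ}
    (hM : ∀ p : ℕ, p.Prime → Summable (fun k : ℕ => ‖r (p ^ k)‖ * W (p ^ k)) ∧
      ∑' k : ℕ, ‖r (p ^ k)‖ * W (p ^ k) ≤ Real.exp (M p)) (v : ℝ) :
    ∑ n ∈ Finset.Icc 1 ⌊v⌋₊, ‖r n‖ * W n ≤ Real.exp (∑ p ∈ primesIoc 0 v, M p) := by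
  -- The weight is only submultiplicative. F is the genuinely multiplicative majorant with the same
  -- values at prime powers, to which the Euler product applies.
  set F : ℕ → ℝ := fun n => if n = 0 then 0 else
    n.factorization.prod fun p k => ‖r (p ^ k)‖ * W (p ^ k) with hF
  have hFn : ∀ n, n ≠ 0 → F n = n.factorization.prod fun p k => ‖r (p ^ k)‖ * W (p ^ k) :=
    fun n hn => if_neg hn
  have hF0 : ∀ n, 0 ≤ F n := by
    intro n
    rw [hF]
    dsimp only
    split_ifs
    · exact le_rfl
    · exact Finset.prod_nonneg fun p _ => mul_nonneg (norm_nonneg _) (hW0 _)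
  have hFp : ∀ p : ℕ, p.Prime → ∀ k, F (p ^ k) = ‖r (p ^ k)‖ * W (p ^ k) := by
    intro p hp k
    rw [hFn _ (pow_ne_zero k hp.ne_zero), hp.factorization_pow]
    exact Finsupp.prod_single_index (by simp [hr.map_one, hW1])
  have key := EulerProduct.summable_and_hasSum_factoredNumbers_prod_filter_prime_tsum
    (f := F) (by rw [hFn _ one_ne_zero]; simp)
    (fun {m n} hmn => by
      rcases eq_or_ne m 0 with rfl | hm
      · simp [hF]
      rcases eq_or_ne n 0 with rfl | hn
      · simp [hF]
      rw [hFn _ hm, hFn _ hn, hFn _ (mul_ne_zero hm hn), Nat.factorization_mul_of_coprime hmn]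
      exact Finsupp.prod_add_index_of_disjoint (Nat.Coprime.disjoint_primeFactors hmn) _)
    (fun {p} hp => by
      simp only [hFp p hp, Real.norm_eq_abs]
      exact (hM p hp).1.abs) (primesIoc 0 v)
  set s := primesIoc 0 v with hs
  have hsp : ∀ p ∈ s, p.Prime := fun p hp => (mem_primesIoc.1 hp).1
  have hmem : ∀ n ∈ Finset.Icc 1 ⌊v⌋₊, n ∈ Nat.factoredNumbers s := by
    intro n hn
    rw [Finset.mem_Icc] at hn
    refine Nat.mem_factoredNumbers'.2 fun p hp hpn => mem_primesIoc.2 ⟨hp, ?_, ?_⟩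
    · exact_mod_cast hp.pos
    · have h1 : p ≤ ⌊v⌋₊ := (Nat.le_of_dvd hn.1 hpn).trans hn.2
      exact (Nat.le_floor_iff' hp.ne_zero).1 h1
  calc ∑ n ∈ Finset.Icc 1 ⌊v⌋₊, ‖r n‖ * W n ≤ ∑ n ∈ Finset.Icc 1 ⌊v⌋₊, F n := by
        refine Finset.sum_le_sum fun n hn => ?_
        have hn0 : n ≠ 0 := by rw [Finset.mem_Icc] at hn; omega
        rw [hFn n hn0]
        exact mul_le_prod_factorization hr hW0 hW1.le hW n hn0
    _ = ∑ n ∈ (Finset.Icc 1 ⌊v⌋₊).subtype (· ∈ Nat.factoredNumbers s), F n := by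
        rw [Finset.sum_subtype_of_mem _ hmem]
    _ ≤ ∏ p ∈ s with p.Prime, ∑' k : ℕ, F (p ^ k) :=
        sum_le_hasSum _ (fun n _ => hF0 n) key.2
    _ = ∏ p ∈ s, ∑' k : ℕ, ‖r (p ^ k)‖ * W (p ^ k) := by
        rw [Finset.filter_true_of_mem hsp]
        refine Finset.prod_congr rfl fun p hp => ?_
        simp only [hFp p (hsp p hp)]
    _ ≤ ∏ p ∈ s, Real.exp (M p) := Finset.prod_le_prod
        (fun p _ => tsum_nonneg fun k => mul_nonneg (norm_nonneg _) (hW0 _))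
        fun p hp => (hM p (hsp p hp)).2
    _ = _ := (Real.exp_sum _ _).symm

/-- The quotient of `g` by the exponentially multiplicative function with the same values at the
primes. -/
noncomputable def expQuotient (g : ArithmeticFunction ℂ) : ArithmeticFunction ℂ :=
  g * expMult (-⇑g)

theorem expQuotient_mul (g : ArithmeticFunction ℂ) : expQuotient g * expMult g = g := by
  rw [expQuotient, mul_assoc, expMult_mul_expMult_neg, mul_one]

theorem expQuotient_isMultiplicative {g : ArithmeticFunction ℂ} (hg : g.IsMultiplicative) :
    (expQuotient g).IsMultiplicative :=
  hg.mul (expMult_isMultiplicative _)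

/-- The two linear terms g(p) and -g(p) cancel. Hence each Euler factor of the quotient deviates
from 1 only through |g(p)|² and the higher prime powers. -/
theorem expQuotient_prime {g : ArithmeticFunction ℂ} (hg : g.IsMultiplicative) {p : ℕ}
    (hp : p.Prime) : expQuotient g p = 0 := by
  have h := mul_apply_prime_pow g (expMult (-⇑g)) hp 1
  have h1 := expMult_prime_pow (-⇑g) hp 1
  simp only [pow_one] at h h1
  rw [expQuotient, h]
  simp [Finset.sum_range_succ, hg.map_one, expMult_one, h1]

/-- In the convolution at p^(k+2), the terms with g(p^i), i ≥ 2, are kept. Those with i = 0 and i =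
1 contain at least two factors of size ξ = ‖g p‖ W(p), and each is at most ξ² · ξ^k / k!. -/
theorem norm_expQuotient_mul_le {g : ArithmeticFunction ℂ} (hg : g.IsMultiplicative)
    {W : ℕ → ℝ} (hW0 : ∀ n, 0 ≤ W n) (hW1 : W 1 = 1)
    (hW : ∀ m n, m ≠ 0 → n ≠ 0 → W (m * n) ≤ W m * W n) {p : ℕ} (hp : p.Prime) (k : ℕ) :
    ‖expQuotient g (p ^ (k + 2))‖ * W (p ^ (k + 2)) ≤
      (∑ i ∈ Finset.range (k + 1), ‖g (p ^ (i + 2))‖ * W (p ^ (i + 2)) *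
        ((‖g p‖ * W p) ^ (k - i) / (k - i).factorial)) +
      2 * (‖g p‖ * W p) ^ 2 * ((‖g p‖ * W p) ^ k / k.factorial) := by
  set ξ := ‖g p‖ * W p with hξ
  have hξ0 : 0 ≤ ξ := mul_nonneg (norm_nonneg _) (hW0 _)
  have hpow : ∀ j : ℕ, W (p ^ j) ≤ W p ^ j := by
    intro j
    induction j with
    | zero => simp [hW1]
    | succ j ih =>
      rw [pow_succ, pow_succ]
      refine (hW _ _ (pow_ne_zero _ hp.ne_zero) hp.ne_zero).trans ?_
      have := hW0 p
      gcongr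
  have hterm : ∀ i j : ℕ, ‖g (p ^ i) * expMult (-⇑g) (p ^ j)‖ * W (p ^ (i + j)) ≤
      ‖g (p ^ i)‖ * W (p ^ i) * (ξ ^ j / j.factorial) := by
    intro i j
    rw [expMult_prime_pow _ hp, norm_mul, norm_div, norm_pow, Pi.neg_apply, norm_neg, hξ,
      mul_pow, pow_add]
    have h1 := hW _ _ (pow_ne_zero i hp.ne_zero) (pow_ne_zero j hp.ne_zero)
    have h2 := hpow j
    have h3 := hW0 (p ^ i)
    simp only [Complex.norm_natCast]
    calc ‖g (p ^ i)‖ * (‖g p‖ ^ j / j.factorial) * W (p ^ i * p ^ j) ≤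
          ‖g (p ^ i)‖ * (‖g p‖ ^ j / j.factorial) * (W (p ^ i) * W p ^ j) := by
          gcongr
          exact h1.trans (by gcongr)
      _ = _ := by ring
  have hall : ‖expQuotient g (p ^ (k + 2))‖ * W (p ^ (k + 2)) ≤
      ∑ i ∈ Finset.range (k + 2 + 1), ‖g (p ^ i)‖ * W (p ^ i) *
        (ξ ^ (k + 2 - i) / (k + 2 - i).factorial) := by
    rw [expQuotient, mul_apply_prime_pow _ _ hp]
    refine (mul_le_mul_of_nonneg_right (norm_sum_le _ _) (hW0 _)).trans ?_
    rw [Finset.sum_mul]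
    refine Finset.sum_le_sum fun i hi => ?_
    have hi2 : i + (k + 2 - i) = k + 2 := by
      rw [Finset.mem_range] at hi; omega
    have := hterm i (k + 2 - i)
    rwa [hi2] at this
  refine hall.trans ?_
  rw [Finset.sum_range_succ', Finset.sum_range_succ', add_assoc]
  refine add_le_add (le_of_eq ?_) ?_
  · refine Finset.sum_congr rfl fun i _ => ?_
    rw [show k + 2 - (i + 1 + 1) = k - i by omega]
  · have f1 : ((k + 1).factorial : ℝ)⁻¹ ≤ (k.factorial : ℝ)⁻¹ := by
      gcongr
      exact Nat.le_succ k
    have f2 : ((k + 2).factorial : ℝ)⁻¹ ≤ (k.factorial : ℝ)⁻¹ := by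
      gcongr
      omega
    simp only [zero_add, pow_one, pow_zero, hg.map_one, norm_one, hW1, one_mul, Nat.sub_zero,
      show k + 2 - 1 = k + 1 by omega, ← hξ, div_eq_mul_inv]
    calc ξ * (ξ ^ (k + 1) * ((k + 1).factorial : ℝ)⁻¹) + ξ ^ (k + 2) * ((k + 2).factorial : ℝ)⁻¹
        ≤ ξ * (ξ ^ (k + 1) * (k.factorial : ℝ)⁻¹) + ξ ^ (k + 2) * (k.factorial : ℝ)⁻¹ := by gcongr
      _ = _ := by ring

/-- The majorant is a Cauchy product with the exponential series of ‖g p‖ W(p), so it sums in closed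
form; the terms k = 0, 1 contribute 1 and 0, and 1 + t ≤ e^t. -/
theorem summable_norm_expQuotient_mul {g : ArithmeticFunction ℂ} (hg : g.IsMultiplicative)
    {W : ℕ → ℝ} (hW0 : ∀ n, 0 ≤ W n) (hW1 : W 1 = 1)
    (hW : ∀ m n, m ≠ 0 → n ≠ 0 → W (m * n) ≤ W m * W n) {p : ℕ} (hp : p.Prime)
    (hs : Summable fun i : ℕ => ‖g (p ^ (i + 2))‖ * W (p ^ (i + 2))) :
    Summable (fun k : ℕ => ‖expQuotient g (p ^ k)‖ * W (p ^ k)) ∧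
      ∑' k : ℕ, ‖expQuotient g (p ^ k)‖ * W (p ^ k) ≤
        Real.exp ((∑' i : ℕ, ‖g (p ^ (i + 2))‖ * W (p ^ (i + 2)) + 2 * (‖g p‖ * W p) ^ 2) *
          Real.exp (‖g p‖ * W p)) := by
  set ξ := ‖g p‖ * W p with hξ
  set v : ℕ → ℝ := fun i => ‖g (p ^ (i + 2))‖ * W (p ^ (i + 2)) with hv
  have hξ0 : 0 ≤ ξ := mul_nonneg (norm_nonneg _) (hW0 _)
  have hv0 : ∀ i, 0 ≤ v i := fun i => mul_nonneg (norm_nonneg _) (hW0 _)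
  set e : ℕ → ℝ := fun k => ξ ^ k / k.factorial with he
  have he0 : ∀ k, 0 ≤ e k := fun k => by positivity
  have hes : HasSum e (Real.exp ξ) := by
    rw [Real.exp_eq_exp_ℝ]
    exact NormedSpace.expSeries_div_hasSum_exp ξ
  have hvn : Summable fun i => ‖v i‖ := by simpa only [Real.norm_eq_abs] using hs.abs
  have hen : Summable fun k => ‖e k‖ := by simpa only [Real.norm_eq_abs] using hes.summable.abs
  have hconv := tsum_mul_tsum_eq_tsum_sum_range_of_summable_norm hvn hen
  have hconvs : Summable fun k => ∑ i ∈ Finset.range (k + 1), v i * e (k - i) :=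
    (summable_norm_sum_mul_range_of_summable_norm hvn hen).of_norm
  have hmaj : Summable fun k => ∑ i ∈ Finset.range (k + 1), v i * e (k - i) + 2 * ξ ^ 2 * e k :=
    hconvs.add (hes.summable.mul_left _)
  have hle : ∀ k, ‖expQuotient g (p ^ (k + 2))‖ * W (p ^ (k + 2)) ≤
      ∑ i ∈ Finset.range (k + 1), v i * e (k - i) + 2 * ξ ^ 2 * e k :=
    fun k => norm_expQuotient_mul_le hg hW0 hW1 hW hp k
  have h2 : Summable fun k => ‖expQuotient g (p ^ (k + 2))‖ * W (p ^ (k + 2)) :=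
    Summable.of_nonneg_of_le (fun k => mul_nonneg (norm_nonneg _) (hW0 _)) hle hmaj
  have hsum : Summable (fun k : ℕ => ‖expQuotient g (p ^ k)‖ * W (p ^ k)) :=
    (summable_nat_add_iff 2).1 h2
  refine ⟨hsum, ?_⟩
  rw [← hsum.sum_add_tsum_nat_add 2]
  have h3 : ∑ k ∈ Finset.range 2, ‖expQuotient g (p ^ k)‖ * W (p ^ k) = 1 := by
    simp [Finset.sum_range_succ, expQuotient_prime hg hp,
      (expQuotient_isMultiplicative hg).map_one, hW1]
  have h4 : ∑' k, ‖expQuotient g (p ^ (k + 2))‖ * W (p ^ (k + 2)) ≤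
      (∑' i, v i + 2 * ξ ^ 2) * Real.exp ξ := by
    refine (h2.tsum_le_tsum hle hmaj).trans (le_of_eq ?_)
    rw [hconvs.tsum_add (hes.summable.mul_left _), ← hconv, tsum_mul_left, hes.tsum_eq]
    ring
  rw [h3]
  have := Real.add_one_le_exp ((∑' i, v i + 2 * ξ ^ 2) * Real.exp ξ)
  linarith

/-- Half of the δ available in the pointwise bound for g(p) pays for the logarithmic weight. The
other half keeps the squares of ‖g p‖ W(p) summable, being O(p^{-1-δ}). -/
theorem one_add_log_rpow_le {γ δ : ℝ} (hγ : 0 < γ) (hδ : 0 < δ) {y : ℝ} (hy : 1 ≤ y) :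
    (1 + Real.log y) ^ γ ≤ (1 + 1 / (δ / (2 * γ))) ^ γ * y ^ (δ / 2) := by
  set η := δ / (2 * γ) with hη
  have hη0 : 0 < η := by positivity
  have h1 := Real.log_le_rpow_div (show 0 ≤ y by linarith) hη0
  have h2 : 1 ≤ y ^ η := Real.one_le_rpow hy hη0.le
  have h3 : 1 + Real.log y ≤ (1 + 1 / η) * y ^ η := by
    have : (1 + 1 / η) * y ^ η = y ^ η + y ^ η / η := by ring
    linarith
  have hl := Real.log_nonneg hy
  calc (1 + Real.log y) ^ γ ≤ ((1 + 1 / η) * y ^ η) ^ γ := by gcongr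
    _ = _ := by
      rw [Real.mul_rpow (by positivity) (by positivity), ← Real.rpow_mul (by linarith)]
      congr 2
      rw [hη]; field_simp

/-- The weight `(1 + log n) ^ γ / n` is submultiplicative. -/
theorem logWeight_mul_le {γ : ℝ} (hγ : 0 ≤ γ) (m n : ℕ) (hm : m ≠ 0) (hn : n ≠ 0) :
    (1 + Real.log (m * n : ℕ)) ^ γ / (m * n : ℕ) ≤
      (1 + Real.log m) ^ γ / m * ((1 + Real.log n) ^ γ / n) := by
  have h1 := Real.log_natCast_nonneg m
  have h2 := Real.log_natCast_nonneg n
  have hm' : (m : ℝ) ≠ 0 := by exact_mod_cast hm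
  have hn' : (n : ℝ) ≠ 0 := by exact_mod_cast hn
  rw [Nat.cast_mul, Real.log_mul hm' hn', div_mul_div_comm,
    ← Real.mul_rpow (by positivity) (by positivity)]
  gcongr
  nlinarith [mul_nonneg h1 h2]

theorem sum_tsum_prime_pow_le {φ : ℕ → ℝ} (hφ0 : ∀ n, 0 ≤ φ n)
    (hφ : Summable fun q : higherPrimePowers => φ q) {s : Finset ℕ} (hs : ∀ p ∈ s, p.Prime) :
    (∀ p ∈ s, Summable fun i : ℕ => φ (p ^ (i + 2))) ∧
      ∑ p ∈ s, ∑' i : ℕ, φ (p ^ (i + 2)) ≤ ∑' q : higherPrimePowers, φ q := by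
  set ι : s × ℕ → higherPrimePowers := fun a => ⟨(a.1 : ℕ) ^ (a.2 + 2),
    a.1, a.2 + 2, hs _ a.1.2, by omega, rfl⟩ with hι
  have hinj : Function.Injective ι := by
    rintro ⟨p, i⟩ ⟨q, j⟩ h
    have h1 : (p : ℕ) ^ (i + 2) = (q : ℕ) ^ (j + 2) := congrArg Subtype.val h
    obtain ⟨h2, h3⟩ := Nat.Prime.pow_inj' (hs _ p.2) (hs _ q.2) (by omega) (by omega) h1
    exact Prod.ext (Subtype.ext h2) (by simpa using h3)
  have hsum : Summable fun a : s × ℕ => φ ((a.1 : ℕ) ^ (a.2 + 2)) := hφ.comp_injective hinj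
  refine ⟨fun p hp => hsum.prod_factor ⟨p, hp⟩, ?_⟩
  have h1 : ∑' a : s × ℕ, φ ((a.1 : ℕ) ^ (a.2 + 2)) ≤ ∑' q : higherPrimePowers, φ q :=
    tsum_comp_le_tsum_of_inj hφ (fun q => hφ0 q) hinj
  refine le_trans (le_of_eq ?_) h1
  rw [hsum.tsum_prod, tsum_fintype, ← Finset.sum_coe_sort]

theorem sum_rpow_le_tsum {δ : ℝ} (hδ : 0 < δ) (s : Finset ℕ) :
    ∑ p ∈ s, (p : ℝ) ^ (-(1 + δ)) ≤ ∑' n : ℕ, (n : ℝ) ^ (-(1 + δ)) :=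
  (Real.summable_nat_rpow.2 (by linarith)).sum_le_tsum s fun n _ => by positivity

theorem one_le_log_four : 1 ≤ Real.log 4 := by
  have h := Real.log_two_gt_d9
  have : Real.log 4 = 2 * Real.log 2 := by
    rw [show (4 : ℝ) = 2 ^ 2 by norm_num, Real.log_pow]; norm_num
  linarith

/-- The quotient of `g` by its exponentially multiplicative part is small on average. -/
theorem exists_sum_norm_expQuotient_le {γ δ A₁ : ℝ} (hγ : 0 < γ) (hδ : 0 < δ) (hA₁ : 0 ≤ A₁)
    (B : ℝ) :
    ∃ K : ℝ, 0 < K ∧ ∀ g : ArithmeticFunction ℂ, g.IsMultiplicative →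
      (∀ p : ℕ, p.Prime → ‖g p‖ ≤ A₁ * (p : ℝ) ^ (1 / 2 - δ)) →
      Summable (fun q : higherPrimePowers => ‖g q‖ / (q : ℝ) * Real.log (q : ℝ) ^ γ) →
      ∑' q : higherPrimePowers, ‖g q‖ / (q : ℝ) * Real.log (q : ℝ) ^ γ ≤ B →
      ∀ v : ℝ, ∑ n ∈ Finset.Icc 1 ⌊v⌋₊, ‖expQuotient g n‖ * ((1 + Real.log n) ^ γ / n) ≤ K := by
  set C := A₁ * (1 + 1 / (δ / (2 * γ))) ^ γ with hC
  have hC0 : 0 ≤ C := by positivity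
  refine ⟨Real.exp ((2 ^ γ * B + 2 * (C ^ 2 * ∑' n : ℕ, (n : ℝ) ^ (-(1 + δ)))) * Real.exp C),
    Real.exp_pos _, fun g hg h1 hsum hB v => ?_⟩
  set W : ℕ → ℝ := fun n => (1 + Real.log n) ^ γ / n with hW
  have hW0 : ∀ n, 0 ≤ W n := fun n => by
    have := Real.log_natCast_nonneg n
    positivity
  have hW1 : W 1 = 1 := by simp [hW]
  have hWm : ∀ m n, m ≠ 0 → n ≠ 0 → W (m * n) ≤ W m * W n := logWeight_mul_le hγ.le
  have hξ : ∀ p : ℕ, p.Prime → ‖g p‖ * W p ≤ C * (p : ℝ) ^ (-((1 + δ) / 2)) := by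
    intro p hp
    have hp1 : (1 : ℝ) ≤ p := by exact_mod_cast hp.one_lt.le
    have hp0 : (0 : ℝ) < p := by linarith
    have hw := one_add_log_rpow_le hγ hδ hp1
    have hexp : (p : ℝ) ^ (1 / 2 - δ) * (p : ℝ) ^ (δ / 2) / p = (p : ℝ) ^ (-((1 + δ) / 2)) := by
      rw [← Real.rpow_add hp0, ← Real.rpow_sub_one hp0.ne']
      congr 1; ring
    have hl := Real.log_nonneg hp1
    calc ‖g p‖ * W p ≤ (A₁ * (p : ℝ) ^ (1 / 2 - δ)) *
          ((1 + 1 / (δ / (2 * γ))) ^ γ * (p : ℝ) ^ (δ / 2) / p) := by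
          rw [hW]; dsimp only
          gcongr
          exact h1 p hp
      _ = C * ((p : ℝ) ^ (1 / 2 - δ) * (p : ℝ) ^ (δ / 2) / p) := by rw [hC]; ring
      _ = _ := by rw [hexp]
  have hξ0 : ∀ p, 0 ≤ ‖g p‖ * W p := fun p => mul_nonneg (norm_nonneg _) (hW0 p)
  have hξC : ∀ p : ℕ, p.Prime → ‖g p‖ * W p ≤ C := fun p hp => (hξ p hp).trans
    (mul_le_of_le_one_right hC0 (Real.rpow_le_one_of_one_le_of_nonpos
      (by exact_mod_cast hp.one_lt.le) (by linarith)))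
  have hξ2 : ∀ p : ℕ, p.Prime → (‖g p‖ * W p) ^ 2 ≤ C ^ 2 * (p : ℝ) ^ (-(1 + δ)) := by
    intro p hp
    have hp0 : (0 : ℝ) < p := by exact_mod_cast hp.pos
    calc (‖g p‖ * W p) ^ 2 ≤ (C * (p : ℝ) ^ (-((1 + δ) / 2))) ^ 2 :=
          pow_le_pow_left₀ (hξ0 p) (hξ p hp) 2
      _ = C ^ 2 * (p : ℝ) ^ (-(1 + δ)) := by
          rw [mul_pow, ← Real.rpow_natCast ((p : ℝ) ^ _), ← Real.rpow_mul hp0.le]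
          congr 2; push_cast; ring
  set φ : ℕ → ℝ := fun q => ‖g q‖ / (q : ℝ) * Real.log (q : ℝ) ^ γ with hφ
  have hφ0 : ∀ n, 0 ≤ φ n := fun n => by
    have := Real.log_natCast_nonneg n
    positivity
  have hpp : ∀ {s : Finset ℕ}, (∀ p ∈ s, p.Prime) → _ := fun {s} => sum_tsum_prime_pow_le (s := s) hφ0 hsum
  have hφs : ∀ p : ℕ, p.Prime → Summable fun i : ℕ => φ (p ^ (i + 2)) := fun p hp =>
    (hpp (s := {p}) (by simpa using hp)).1 p (by simp)
  have hvφ : ∀ p : ℕ, p.Prime → ∀ i : ℕ,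
      ‖g (p ^ (i + 2))‖ * W (p ^ (i + 2)) ≤ 2 ^ γ * φ (p ^ (i + 2)) := by
    intro p hp i
    -- Higher prime powers are at least 4 > e, so 1 + log q ≤ 2 log q, which compares the weight
    -- with the one in the given series at a cost of 2^γ.
    have h4 : (4 : ℝ) ≤ ((p ^ (i + 2) : ℕ) : ℝ) := by
      have : 2 ^ 2 ≤ p ^ (i + 2) :=
        (Nat.pow_le_pow_left hp.two_le 2).trans (Nat.pow_le_pow_right hp.pos (by omega))
      exact_mod_cast this
    generalize p ^ (i + 2) = q at *
    have hlq : 1 ≤ Real.log q := one_le_log_four.trans (Real.log_le_log (by norm_num) h4)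
    calc ‖g q‖ * W q ≤ ‖g q‖ * ((2 * Real.log q) ^ γ / q) := by
          rw [hW]; dsimp only
          gcongr; linarith
      _ = _ := by
          rw [Real.mul_rpow (by norm_num) (by linarith), hφ]; ring
  have hvs : ∀ p : ℕ, p.Prime → Summable fun i : ℕ => ‖g (p ^ (i + 2))‖ * W (p ^ (i + 2)) :=
    fun p hp => Summable.of_nonneg_of_le (fun i => mul_nonneg (norm_nonneg _) (hW0 _))
      (hvφ p hp) ((hφs p hp).mul_left _)
  refine (sum_norm_mul_le_exp (expQuotient_isMultiplicative hg) hW0 hW1 hWm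
    (fun p hp => summable_norm_expQuotient_mul hg hW0 hW1 hWm hp (hvs p hp)) v).trans ?_
  refine Real.exp_le_exp.2 ?_
  set s := primesIoc 0 v with hs
  have hsp : ∀ p ∈ s, p.Prime := fun p hp => (mem_primesIoc.1 hp).1
  calc ∑ p ∈ s, (∑' i : ℕ, ‖g (p ^ (i + 2))‖ * W (p ^ (i + 2)) + 2 * (‖g p‖ * W p) ^ 2) *
        Real.exp (‖g p‖ * W p) ≤
        ∑ p ∈ s, (2 ^ γ * ∑' i : ℕ, φ (p ^ (i + 2)) + 2 * (C ^ 2 * (p : ℝ) ^ (-(1 + δ)))) *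
          Real.exp C := by
        refine Finset.sum_le_sum fun p hp => ?_
        have e1 : ∑' i : ℕ, ‖g (p ^ (i + 2))‖ * W (p ^ (i + 2)) ≤
            2 ^ γ * ∑' i : ℕ, φ (p ^ (i + 2)) := by
          rw [← tsum_mul_left]
          exact (hvs p (hsp p hp)).tsum_le_tsum (hvφ p (hsp p hp))
            ((hφs p (hsp p hp)).mul_left _)
        have e2 : 0 ≤ ∑' i : ℕ, ‖g (p ^ (i + 2))‖ * W (p ^ (i + 2)) :=
          tsum_nonneg fun i => mul_nonneg (norm_nonneg _) (hW0 _)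
        have e3 := hξ2 p (hsp p hp)
        have e4 := hξC p (hsp p hp)
        gcongr
    _ = (2 ^ γ * ∑ p ∈ s, ∑' i : ℕ, φ (p ^ (i + 2)) +
          2 * (C ^ 2 * ∑ p ∈ s, (p : ℝ) ^ (-(1 + δ)))) * Real.exp C := by
        rw [← Finset.sum_mul, Finset.sum_add_distrib, ← Finset.mul_sum, ← Finset.mul_sum,
          ← Finset.mul_sum]
    _ ≤ _ := by
        have e1 := (hpp hsp).2.trans hB
        have e2 := sum_rpow_le_tsum hδ s
        gcongr

/-! ### Transfer to g -/

theorem exp_le_one_add_mul_exp_sq {t : ℝ} (ht : 0 ≤ t) :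
    Real.exp t ≤ (1 + t) * Real.exp (t ^ 2) := by
  have h1 := Real.one_sub_inv_le_log_of_pos (show 0 < 1 + t by linarith)
  have h2 : t - t ^ 2 ≤ 1 - (1 + t)⁻¹ := by
    rw [← sub_nonneg]
    have : 1 - (1 + t)⁻¹ - (t - t ^ 2) = t ^ 3 / (1 + t) := by field_simp; ring
    rw [this]; positivity
  calc Real.exp t ≤ Real.exp (Real.log (1 + t) + t ^ 2) := Real.exp_le_exp.2 (by linarith)
    _ = _ := by rw [Real.exp_add, Real.exp_log (by linarith)]

/-- Exponential and product differ by a factor exp(∑ (|g(p)|/p)²), which is bounded because |g(p)|/p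
= O(p^{-1/2-δ}). -/
theorem exp_sum_le_prod {δ A₁ : ℝ} (hδ : 0 < δ) {g : ℕ → ℂ}
    (h1 : ∀ p : ℕ, p.Prime → ‖g p‖ ≤ A₁ * (p : ℝ) ^ (1 / 2 - δ)) (x : ℝ) :
    Real.exp (∑ p ∈ primesIoc 0 x, ‖g p‖ / p) ≤
      Real.exp (A₁ ^ 2 * ∑' n : ℕ, (n : ℝ) ^ (-(1 + δ))) *
        ∏ p ∈ primesIoc 0 x, (1 + ‖g p‖ / p) := by
  set s := primesIoc 0 x with hs
  have hsq : ∀ p ∈ s, (‖g p‖ / p) ^ 2 ≤ A₁ ^ 2 * (p : ℝ) ^ (-(1 + δ)) := by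
    intro p hp
    have hpp := (mem_primesIoc.1 hp).1
    have hp0 : (0 : ℝ) < p := by exact_mod_cast hpp.pos
    have hp1 : (1 : ℝ) ≤ p := by exact_mod_cast hpp.one_lt.le
    calc (‖g p‖ / p) ^ 2 ≤ (A₁ * (p : ℝ) ^ (1 / 2 - δ) / p) ^ 2 := by
          gcongr; exact h1 p hpp
      _ = A₁ ^ 2 * (p : ℝ) ^ (-(1 + 2 * δ)) := by
          rw [mul_div_assoc, ← Real.rpow_sub_one hp0.ne', mul_pow,
            ← Real.rpow_natCast ((p : ℝ) ^ _), ← Real.rpow_mul hp0.le]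
          congr 2; push_cast; ring
      _ ≤ _ := by
          gcongr
          linarith
  rw [Real.exp_sum]
  calc ∏ p ∈ s, Real.exp (‖g p‖ / p) ≤
        ∏ p ∈ s, ((1 + ‖g p‖ / p) * Real.exp ((‖g p‖ / p) ^ 2)) :=
        Finset.prod_le_prod (fun p _ => (Real.exp_pos _).le)
          fun p _ => exp_le_one_add_mul_exp_sq (by positivity)
    _ = Real.exp (∑ p ∈ s, (‖g p‖ / p) ^ 2) * ∏ p ∈ s, (1 + ‖g p‖ / p) := by
        rw [Finset.prod_mul_distrib, ← Real.exp_sum, mul_comm]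
    _ ≤ _ := by
        gcongr
        refine (Finset.sum_le_sum hsq).trans ?_
        rw [← Finset.mul_sum]
        have := sum_rpow_le_tsum hδ s
        gcongr

theorem partialSum_expMult_truncPrimes (g : ℕ → ℂ) {u x : ℝ} (hu : u ≤ x) :
    partialSum (expMult (truncPrimes g x)) u = partialSum (expMult g) u := by
  refine Finset.sum_congr rfl fun n hn => expMult_congr fun p hp => ?_
  rw [Finset.mem_Icc] at hn
  obtain ⟨hpp, hpn, hn0⟩ := Nat.mem_primeFactors.1 hp
  refine truncPrimes_of_mem (mem_primesIoc.2 ⟨hpp, by exact_mod_cast hpp.pos, ?_⟩)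
  exact ((Nat.le_floor_iff' hpp.ne_zero).1 ((Nat.le_of_dvd hn.1 hpn).trans hn.2)).trans hu

theorem norm_partialSum_le_sum_expQuotient (g : ArithmeticFunction ℂ) {x : ℝ} (hx : 1 ≤ x) :
    ‖partialSum g x‖ ≤ ∑ n ∈ Finset.Icc 1 ⌊x⌋₊,
      ‖expQuotient g n‖ * ‖partialSum (expMult (truncPrimes g x)) (x / n)‖ := by
  have h := partialSum_mul (expQuotient g) (expMult g) x
  rw [expQuotient_mul] at h
  rw [h]
  refine (norm_sum_le _ _).trans (le_of_eq (Finset.sum_congr rfl fun n hn => ?_))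
  rw [norm_mul, partialSum_expMult_truncPrimes]
  exact div_le_self (by linarith) (by exact_mod_cast (Finset.mem_Icc.1 hn).1)

/-- A mean-value bound on `[√x, x]` for the exponentially multiplicative part transfers to `g`. -/
theorem norm_partialSum_le_of_expMult (g : ArithmeticFunction ℂ) {γ x K M C D : ℝ} (hγ : 0 < γ)
    (hx : 1 ≤ x) (hK : 0 ≤ K) (hM : 0 ≤ M)
    (hlarge : ∀ X : ℝ, √x ≤ X → X ≤ x →
      ‖partialSum (expMult (truncPrimes g x)) X‖ ≤ K * X * M)
    (hsmall : (1 + Real.log x) ^ (-γ) * Real.exp (∑ p ∈ primesIoc 0 x, ‖g p‖ / p) ≤ D * M)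
    (hsum : ∑ n ∈ Finset.Icc 1 ⌊x⌋₊, ‖expQuotient g n‖ * ((1 + Real.log n) ^ γ / n) ≤ C) :
    ‖partialSum g x‖ ≤ C * (K + 2 ^ γ * D) * (x * M) := by
  set P := Real.exp (∑ p ∈ primesIoc 0 x, ‖g p‖ / p) with hP
  have hP0 : 0 < P := Real.exp_pos _
  have hx0 : 0 < x := by linarith
  have hlx := Real.log_nonneg hx
  have hDM : 0 ≤ D * M := le_trans (by positivity) hsmall
  have hterm : ∀ n ∈ Finset.Icc 1 ⌊x⌋₊,
      ‖partialSum (expMult (truncPrimes g x)) (x / n)‖ ≤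
        (1 + Real.log n) ^ γ / n * (x * (K * M + 2 ^ γ * (D * M))) := by
    intro n hn
    have hn1 : (1 : ℝ) ≤ n := by exact_mod_cast (Finset.mem_Icc.1 hn).1
    have hn0 : (0 : ℝ) < n := by linarith
    have hln := Real.log_nonneg hn1
    -- When x/n ≥ √x the main estimate applies at x/n. Otherwise n ≥ √x, log n is comparable with
    -- log x, and the weight (1 + log n)^γ compensates for using the trivial bound.
    rcases le_or_gt (√x) (x / n) with hs | hs
    · have hw : 1 ≤ (1 + Real.log n) ^ γ := Real.one_le_rpow (by linarith) hγ.le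
      calc ‖partialSum (expMult (truncPrimes g x)) (x / n)‖ ≤ K * (x / n) * M :=
            hlarge _ hs (div_le_self hx0.le hn1)
        _ = 1 / n * (x * (K * M + 0)) := by ring
        _ ≤ _ := by gcongr; positivity
    · have hn2 : √x ≤ n := by
        rw [div_lt_iff₀ hn0] at hs
        have h1 := Real.mul_self_sqrt hx0.le
        have h2 : 0 < √x := Real.sqrt_pos.2 hx0
        nlinarith
      have hl2 : Real.log x / 2 ≤ Real.log n := by
        rw [← Real.log_sqrt hx0.le]
        exact Real.log_le_log (Real.sqrt_pos.2 hx0) hn2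
      have hw : (1 + Real.log x) ^ γ ≤ 2 ^ γ * (1 + Real.log n) ^ γ := by
        rw [← Real.mul_rpow (by norm_num) (by linarith)]
        gcongr; linarith
      have hPle : P ≤ (1 + Real.log x) ^ γ * (D * M) := by
        calc P = (1 + Real.log x) ^ γ * ((1 + Real.log x) ^ (-γ) * P) := by
              rw [← mul_assoc, ← Real.rpow_add (by linarith), add_neg_cancel, Real.rpow_zero,
                one_mul]
          _ ≤ _ := by gcongr
      calc ‖partialSum (expMult (truncPrimes g x)) (x / n)‖ ≤ x / n * P :=
            norm_partialSum_expMult_le g (by positivity) (div_le_self hx0.le hn1)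
        _ ≤ x / n * (2 ^ γ * (1 + Real.log n) ^ γ * (D * M)) := by
            gcongr
            exact hPle.trans (by gcongr)
        _ = (1 + Real.log n) ^ γ / n * (x * (0 + 2 ^ γ * (D * M))) := by ring
        _ ≤ _ := by gcongr; positivity
  calc ‖partialSum g x‖ ≤ ∑ n ∈ Finset.Icc 1 ⌊x⌋₊,
        ‖expQuotient g n‖ * ‖partialSum (expMult (truncPrimes g x)) (x / n)‖ :=
        norm_partialSum_le_sum_expQuotient g hx
    _ ≤ ∑ n ∈ Finset.Icc 1 ⌊x⌋₊, ‖expQuotient g n‖ *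
        ((1 + Real.log n) ^ γ / n * (x * (K * M + 2 ^ γ * (D * M)))) :=
        Finset.sum_le_sum fun n hn => mul_le_mul_of_nonneg_left (hterm n hn) (norm_nonneg _)
    _ = (∑ n ∈ Finset.Icc 1 ⌊x⌋₊, ‖expQuotient g n‖ * ((1 + Real.log n) ^ γ / n)) *
        (x * (K * M + 2 ^ γ * (D * M))) := by
        rw [Finset.sum_mul]
        exact Finset.sum_congr rfl fun n _ => by ring
    _ ≤ C * (x * (K * M + 2 ^ γ * (D * M))) := by gcongr
    _ = _ := by ring

/-- The values of the twisted sum bound its minimum, which is nonnegative. -/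
theorem twistMin_bounds (g : ArithmeticFunction ℂ) (Y x : ℝ) {T : ℝ} (hT : 0 < T) :
    0 ≤ twistMin g Y x T ∧ ∀ t : ℝ, |t| ≤ T → twistMin g Y x T ≤ twistSum g Y x t := by
  obtain ⟨⟨t₀, -, ht₀⟩, hlb⟩ := isLeast_twistMin g Y x hT
  refine ⟨?_, fun t ht => hlb ⟨t, abs_le.1 ht, rfl⟩⟩
  rw [← ht₀]
  refine Finset.sum_nonneg fun p hp => div_nonneg (sub_nonneg.2 ?_) (Nat.cast_nonneg p)
  have hp0 := (mem_primesIoc.1 hp).1.pos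
  refine (Complex.re_le_norm _).trans (le_of_eq ?_)
  rw [norm_mul, Complex.norm_natCast_cpow_of_pos hp0]
  simp

end MeanValue

/-! ### Assembly of the mean-value theorem -/

theorem theorem5 (β c c₁ δ A₁ A₂ A₃ A₄ B : ℝ)
    (hβ : 0 < β) (hc : 0 < c) (hc₁ : 0 < c₁) (hδ₀ : 0 < δ) (hδ₁ : δ < 1) :
    ∃ K : ℝ, 0 < K ∧ ∀ g : ArithmeticFunction ℂ, g.IsMultiplicative →
      -- conditions on the values at the primes, replacing `|g(p)| ≤ β`
      (∀ p : ℕ, p.Prime → ‖g p‖ ≤ A₁ * (p : ℝ) ^ (1 / 2 - δ)) →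
      (∀ z : ℝ, 3 ≤ z →
        ∑ p ∈ primesIoc 0 z, ‖g p‖ ^ (1 + δ) / p ≤ A₂ * Real.log (Real.log z)) →
      (∀ z y : ℝ, 2 ≤ z → z ^ (1 - δ) ≤ y → y ≤ z →
        ∑ p ∈ primesIoc (z - y) z, ‖g p‖ * Real.log p ≤ A₃ * y) →
      (∀ u v : ℝ, 2 ≤ u → u ≤ v →
        ∑ p ∈ primesIoc u v, ‖g p‖ / p ≤ β * Real.log (Real.log v / Real.log u) + A₄) →
      -- the series over the higher prime-powers converges, with sum at most `B`
      Summable (fun q : higherPrimePowers =>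
        ‖g q‖ / (q : ℝ) * Real.log (q : ℝ) ^ (1 + c * β / (c + β))) →
      ∑' q : higherPrimePowers,
        ‖g q‖ / (q : ℝ) * Real.log (q : ℝ) ^ (1 + c * β / (c + β)) ≤ B →
      ∀ Y x T : ℝ, 3 / 2 ≤ Y → Y ≤ x → 0 < T →
        (∀ w : ℝ, Y ≤ w → w ≤ x → -c₁ ≤ ∑ p ∈ primesIoc w x, (‖g p‖ - c) / p) →
        ‖∑ n ∈ Finset.Icc 1 ⌊x⌋₊, g n‖ ≤
          K * (x / Real.log x) * (∏ p ∈ primesIoc 0 x, (1 + ‖g p‖ / p)) *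
            (Real.exp (-(twistMin g Y x T * c / (c + β))) + T ^ (-(1 / 2) : ℝ)) := by
  set α := c * β / (c + β) with hα
  have hα0 : 0 < α := by positivity
  -- The given constants may have any sign, while the estimates need nonnegative ones.
  set A := max A₃ 0 with hA
  set A' := max A₄ 0 with hA'
  obtain ⟨K₁, x₀, hK₁0, hx₀8, hK₁⟩ := exists_norm_partialSum_expMult_le hβ hc hδ₀
    (le_max_right A₃ 0) (le_max_right A₄ 0) c₁
  obtain ⟨C, hC0, hC⟩ := exists_sum_norm_expQuotient_le (γ := 1 + α) (by positivity) hδ₀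
    (abs_nonneg A₁) B
  set D := Real.exp (144 * A + β + A' + 12 * A * ∑' k : ℕ, 1 / (k : ℝ) ^ 2) with hD
  have hD0 : 0 < D := Real.exp_pos _
  set H := Real.exp (|A₁| ^ 2 * ∑' n : ℕ, (n : ℝ) ^ (-(1 + δ))) with hH
  have hH0 : 0 < H := Real.exp_pos _
  -- The second entry serves x < x₀: there the trivial bound X P suffices, since P E / log x is at
  -- least a constant times P.
  set K₂ := max K₁ ((1 + Real.log x₀) ^ (1 + α) * D) with hK₂
  have hK₂0 : 0 < K₂ := lt_max_of_lt_left hK₁0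
  refine ⟨C * (K₂ + 2 ^ (1 + α) * D) * H, by positivity, ?_⟩
  intro g hg h1 _ h3 h4 hs hB Y x T hY hYx hT hlow
  have hx1 : 1 < x := by linarith
  have hx0 : 0 < x := by linarith
  have hlx : 0 < Real.log x := Real.log_pos hx1
  have hlx₀ : 0 < Real.log x₀ := Real.log_pos (by linarith)
  have hb : PrimeBounds g δ A β A' c c₁ Y x :=
    { short := fun z y hz hy hyz => (h3 z y hz hy hyz).trans <| by
        have : 0 ≤ y := le_trans (by positivity) hy
        gcongr
        exact le_max_left _ _
      upper := fun u v hu huv => (h4 u v hu huv).trans (by gcongr; exact le_max_left _ _)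
      lower := hlow
      pos := hδ₀ }
  have h1' : ∀ p : ℕ, p.Prime → ‖g p‖ ≤ |A₁| * (p : ℝ) ^ (1 / 2 - δ) := fun p hp =>
    (h1 p hp).trans (by gcongr; exact le_abs_self _)
  obtain ⟨hl0, htw⟩ := twistMin_bounds g Y x hT
  set l := twistMin g Y x T with hl
  have hE := hb.rpow_le_error hβ hc (le_max_right A₄ 0) hx1.le hT htw
  set E := Real.exp (-(l * c / (c + β))) + T ^ (-(1 / 2) : ℝ) with hEdef
  have hE0 : 0 < E := by positivity
  set P := Real.exp (∑ p ∈ primesIoc 0 x, ‖g p‖ / p) with hP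
  have hP0 : 0 < P := Real.exp_pos _
  -- This is where the exponent 1 + α is needed: α for the lower bound on the error factor, and 1
  -- for the division by log x.
  have hsmall : (1 + Real.log x) ^ (-(1 + α)) * P ≤ D * (P * E / Real.log x) := by
    have e1 : (1 + Real.log x) ^ (-(1 + α)) = (1 + Real.log x) ^ (-α) / (1 + Real.log x) := by
      rw [← Real.rpow_sub_one (by positivity)]
      congr 1; ring
    rw [e1]
    calc (1 + Real.log x) ^ (-α) / (1 + Real.log x) * P ≤ D * E / Real.log x * P := by
          gcongr; linarith
      _ = _ := by ring
  have hlarge : ∀ X : ℝ, √x ≤ X → X ≤ x →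
      ‖partialSum (expMult (truncPrimes g x)) X‖ ≤ K₂ * X * (P * E / Real.log x) := by
    intro X hX hXx
    have hX0 : 0 < X := (Real.sqrt_pos.2 hx0).trans_le hX
    rcases le_or_gt x₀ x with hxx | hxx
    · refine (hK₁ g Y x T l hb (by linarith) hYx hxx hT hl0 htw X hX hXx).trans ?_
      gcongr
      exact le_max_left _ _
    · have hP1 : P ≤ (1 + Real.log x₀) ^ (1 + α) * D * (P * E / Real.log x) := by
        calc P = (1 + Real.log x) ^ (1 + α) * ((1 + Real.log x) ^ (-(1 + α)) * P) := by
              rw [← mul_assoc, ← Real.rpow_add (by positivity), add_neg_cancel, Real.rpow_zero,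
                one_mul]
          _ ≤ (1 + Real.log x₀) ^ (1 + α) * (D * (P * E / Real.log x)) := by
              gcongr
          _ = _ := by ring
      calc _ ≤ X * P := norm_partialSum_expMult_le g hX0.le hXx
        _ ≤ X * (K₂ * (P * E / Real.log x)) := by
            gcongr
            exact hP1.trans (by gcongr; exact le_max_right _ _)
        _ = _ := by ring
  have hfin := norm_partialSum_le_of_expMult g (by positivity) hx1.le hK₂0.le (by positivity)
    hlarge hsmall (hC g hg h1' hs hB x)
  have hPH := exp_sum_le_prod hδ₀ h1' x
  calc _ ≤ C * (K₂ + 2 ^ (1 + α) * D) * (x * (P * E / Real.log x)) := hfin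
    _ ≤ C * (K₂ + 2 ^ (1 + α) * D) *
        (x * (H * (∏ p ∈ primesIoc 0 x, (1 + ‖g p‖ / p)) * E / Real.log x)) := by gcongr
    _ = _ := by ring
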